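/- Call a complex manifold $M$ spin if $w_2(M)=0$, that is, if $c_1(M)\in H^2(M;\mathbb{Z})$ is divisible by $2$ (equivalently, the canonical bundle $K_M$ has a square root as a continuous complex line bundle). Let $a_1\in\mathbb{C}[x_1,x_2,x_3,x_4]$ be homogeneous of degree $4$ such that $\{x_1=0\}\cap\{a_1=0\}\subset\mathbb{P}^3$ is a smooth curve, cut out transversally. Let $X_4$ be the toric fourfold with homogeneous coordinates $x_1,x_2,x_3,x_4,a,w$ of weights $(1,1),(1,0),(1,0),(1,0),(4,1),(0,-1)$ under $(\mathbb{C}^*)^2$ and Stanley–Reisner ideal generated by $x_1a$ and $x_2x_3x_4w$. Let $H$ be the class of weight $(1,0)$ (that of $\{x_2=0\}$) and $E$ the class of $\{w=0\}$, of weight $(0,-1)$. Let $$\tilde B_3=\{\,wa=a_1(wx_1,x_2,x_3,x_4)\,\}\subset X_4 .$$ Then: 1. $\mathbb{P}^3$ and $\tilde B_3$ are compact complex threefolds, and the map $\tilde B_3\to\mathbb{P}^3$, $[x_1:x_2:x_3:x_4:a:w]\mapsto[wx_1:x_2:x_3:x_4]$, is the blow-up of $\mathbb{P}^3$ along $\{x_1=0\}\cap\{a_1=0\}$.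 2. $\mathbb{P}^3$ is spin, $c_1(\tilde B_3)=4H-E$ (restricted to $\tilde B_3$), and $\tilde B_3$ is not spin. 3. If moreover $a_1=x_2\hat a_1+x_3\tilde a_1$ with $\hat a_1,\tilde a_1$ homogeneous of degree $3$, then the locus $C=\{x_2=x_3=w=0\}\subset X_4$ is contained in $\tilde B_3$, it is a rational curve (the image of an injective holomorphic map from the Riemann sphere), and $$\int_{C}c_1(\tilde B_3)=1 .$$ 4. The intersection form of $X_4$ exists, is unique, and has $H^4=\tfrac14$, $H^3E=0$, $H^2E^2=-1$, $HE^3=-5$, $E^4=-21$. In particular $\int_{X_4}(4H-E)\,E\,H^2=1$, in agreement with 3. Here the intersection form is the linear functional on $\mathbb{Q}[H,E]$ that is concentrated in degree $4$, vanishes on the multiples of the products of divisor classes given by the Stanley–Reisner generators, and takes the value $1/N$ on the product of the four coordinate divisors through a torus-fixed point whose stabilizer in $(\mathbb{C}^*)^2$ has order $N$. -/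

import Mathlib

open scoped Manifold ContDiff

noncomputable section

namespace ToricBlowUp

/-! ### Quotients by algebraic tori -/

/-- The character of the torus `(ℂˣ)^r` with exponent vector `q`: `t ↦ ∏ k, t k ^ q k`. -/
def torusChar {r : ℕ} (t : Fin r → ℂˣ) (q : Fin r → ℤ) : ℂ :=
  ((∏ k, t k ^ q k : ℂˣ) : ℂ)

theorem torusChar_one {r : ℕ} (q : Fin r → ℤ) : torusChar (1 : Fin r → ℂˣ) q = 1 := by
  simp [torusChar]

theorem torusChar_mul {r : ℕ} (s t : Fin r → ℂˣ) (q : Fin r → ℤ) :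
    torusChar (s * t) q = torusChar s q * torusChar t q := by
  simp [torusChar, mul_zpow, Finset.prod_mul_distrib]

/-- Two points `z`, `z'` of `Z ⊆ ℂⁿ` are equivalent when they lie in the same orbit of `(ℂˣ)^r`,
which scales the `i`-th homogeneous coordinate with weight `Q i`. -/
def torusSetoid {n r : ℕ} (Q : Fin n → Fin r → ℤ) (Z : Set (Fin n → ℂ)) : Setoid Z where
  r z z' := ∃ t : Fin r → ℂˣ, ∀ i, z'.1 i = torusChar t (Q i) * z.1 i
  iseqv :=
    { refl := fun z => ⟨1, fun i => by simp [torusChar_one]⟩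
      symm := by
        rintro z z' ⟨t, ht⟩
        refine ⟨t⁻¹, fun i => ?_⟩
        rw [ht i, ← mul_assoc, ← torusChar_mul, inv_mul_cancel, torusChar_one, one_mul]
      trans := by
        rintro z z' z'' ⟨s, hs⟩ ⟨t, ht⟩
        refine ⟨t * s, fun i => ?_⟩
        rw [ht i, hs i, torusChar_mul, mul_assoc] }

/-- The space `Z / (ℂˣ)^r`, with the quotient topology. -/
abbrev TorusQuotient {n r : ℕ} (Q : Fin n → Fin r → ℤ) (Z : Set (Fin n → ℂ)) : Type :=
  Quotient (torusSetoid Q Z)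

/-- The point of `Z / (ℂˣ)^r` with given homogeneous coordinates. -/
def mkPt {n r : ℕ} (Q : Fin n → Fin r → ℤ) {Z : Set (Fin n → ℂ)} (z : Z) : TorusQuotient Q Z :=
  Quotient.mk (torusSetoid Q Z) z

/-- The charted space structure on `Z / (ℂˣ)^r` is its structure of complex manifold of
dimension `d`: the projection of a holomorphic family of points of `Z` is holomorphic,
and the projection has local holomorphic sections. These two properties determine the complex
structure uniquely. -/
class IsQuotientManifold (d : ℕ) {n r : ℕ} (Q : Fin n → Fin r → ℤ) (Z : Set (Fin n → ℂ))
    [ChartedSpace (Fin d → ℂ) (TorusQuotient Q Z)] : Prop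
    extends IsManifold 𝓘(ℂ, Fin d → ℂ) ω (TorusQuotient Q Z) where
  contMDiffOn_mkPt : ∀ (k : ℕ) (U : Set (Fin k → ℂ)) (s : (Fin k → ℂ) → Z), IsOpen U →
    ContDiffOn ℂ ω (fun u => (s u).1) U →
    ContMDiffOn 𝓘(ℂ, Fin k → ℂ) 𝓘(ℂ, Fin d → ℂ) ω (fun u => mkPt Q (s u)) U
  exists_section : ∀ p : TorusQuotient Q Z, ∃ U : Set (TorusQuotient Q Z), IsOpen U ∧ p ∈ U ∧
    ∃ s : TorusQuotient Q Z → Z,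
      ContMDiffOn 𝓘(ℂ, Fin d → ℂ) 𝓘(ℂ, Fin n → ℂ) ω (fun y => (s y).1) U ∧
      ∀ y ∈ U, mkPt Q (s y) = y

/-! ### First Chern classes -/

section Chern

/-- A continuous complex line bundle on `M`. -/
structure ComplexLineBundle (M : Type) [TopologicalSpace M] where
  fiber : M → Type
  [addCommGroup : ∀ x, AddCommGroup (fiber x)]
  [module : ∀ x, Module ℂ (fiber x)]
  [topFiber : ∀ x, TopologicalSpace (fiber x)]
  [topTotal : TopologicalSpace (Bundle.TotalSpace ℂ fiber)]
  [fiberBundle : FiberBundle ℂ fiber]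
  [vectorBundle : VectorBundle ℂ ℂ fiber]

attribute [instance] ComplexLineBundle.addCommGroup ComplexLineBundle.module
  ComplexLineBundle.topFiber ComplexLineBundle.topTotal ComplexLineBundle.fiberBundle
  ComplexLineBundle.vectorBundle

variable (d : ℕ) (M : Type) [TopologicalSpace M] [ChartedSpace (Fin d → ℂ) M]
  [IsManifold 𝓘(ℂ, Fin d → ℂ) ω M]

/-- A complex manifold `M` is spin when `w₂(M) = 0`, that is, when `c₁(M) ∈ H²(M; ℤ)` is an even
class. As `c₁` identifies continuous complex line bundles with `H²(M; ℤ)`, this says that there is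
a continuous complex line bundle `L` with `L ⊗ L ≅ K`, where `K = Λᵈ T*M` is the canonical bundle,
with `c₁(K) = - c₁(M)`. The isomorphism is given as a family `B` of pairings `L × L → K`,
nondegenerate in each fibre; its continuity is tested on all continuous families of points `p`,
vectors `l`, `l'` of `L` and tangent vectors `v 1, …, v d` at these points. -/
def IsSpin : Prop :=
  ∃ (L : ComplexLineBundle M)
    (B : ∀ x : M, L.fiber x →ₗ[ℂ] L.fiber x →ₗ[ℂ]
      ((TangentSpace 𝓘(ℂ, Fin d → ℂ) x) [⋀^Fin d]→ₗ[ℂ] ℂ)),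
    (∀ (x : M) (l : L.fiber x), l ≠ 0 → B x l l ≠ 0) ∧
    ∀ (Y : Type) [TopologicalSpace Y] (p : Y → M) (l l' : ∀ y, L.fiber (p y))
      (v : Fin d → ∀ y, TangentSpace 𝓘(ℂ, Fin d → ℂ) (p y)),
      Continuous (fun y => (⟨p y, l y⟩ : Bundle.TotalSpace ℂ L.fiber)) →
      Continuous (fun y => (⟨p y, l' y⟩ : Bundle.TotalSpace ℂ L.fiber)) →
      (∀ i, Continuous (fun y => (⟨p y, v i y⟩ : TangentBundle 𝓘(ℂ, Fin d → ℂ) M))) →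
      Continuous (fun y => B (p y) (l y) (l' y) (fun i => v i y))

/-- On `M = Z / (ℂˣ)^r` the line bundle `𝒪(χ)` is `Z × ℂ` modulo `(z, c) ~ (t • z, χ(t) c)`; its
sections are the functions on `Z` that are homogeneous of weight `χ`. The equality
`c₁(M) = c₁(𝒪(χ))` in `H²(M; ℤ)` means that `Λᵈ TM` and `𝒪(χ)` are isomorphic as continuous
complex line bundles. Such an isomorphism is a continuous family of nonzero alternating `d`-forms
`Ω x z` on `T_x M`, where `z ∈ Z` are homogeneous coordinates of `x`, equivariant in `z`. -/
def FirstChernClassEq {n r : ℕ} (Q : Fin n → Fin r → ℤ) (Z : Set (Fin n → ℂ))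
    [ChartedSpace (Fin d → ℂ) (TorusQuotient Q Z)]
    [IsManifold 𝓘(ℂ, Fin d → ℂ) ω (TorusQuotient Q Z)] (χ : Fin r → ℤ) : Prop :=
  ∃ Ω : ∀ x : TorusQuotient Q Z, {z : Z // mkPt Q z = x} →
      ((TangentSpace 𝓘(ℂ, Fin d → ℂ) x) [⋀^Fin d]→ₗ[ℂ] ℂ),
    (∀ x z, Ω x z ≠ 0) ∧
    (∀ x (z z' : {z : Z // mkPt Q z = x}) (t : Fin r → ℂˣ),
      (∀ i, z'.1.1 i = torusChar t (Q i) * z.1.1 i) → Ω x z' = torusChar t χ • Ω x z) ∧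
    ∀ (Y : Type) [TopologicalSpace Y] (z : Y → Z)
      (v : Fin d → ∀ y, TangentSpace 𝓘(ℂ, Fin d → ℂ) (mkPt Q (z y))),
      Continuous z →
      (∀ i, Continuous (fun y =>
        (⟨mkPt Q (z y), v i y⟩ : TangentBundle 𝓘(ℂ, Fin d → ℂ) (TorusQuotient Q Z)))) →
      Continuous (fun y => Ω (mkPt Q (z y)) ⟨z y, rfl⟩ (fun i => v i y))

/-- A continuous map from the Riemann sphere to `M`, given on its two standard affine charts
`t` and `u = t⁻¹`. -/
structure SphereMap (M : Type) [TopologicalSpace M] where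
  north : ℂ → M
  south : ℂ → M
  continuous_north : Continuous north
  continuous_south : Continuous south
  glue : ∀ t : ℂ, t ≠ 0 → south t⁻¹ = north t

variable {M}

/-- `σ` is a holomorphic bijection from the Riemann sphere onto the subset `C` of `M`. -/
def SphereMap.Parametrizes (σ : SphereMap M) (C : Set M) : Prop :=
  ContMDiff 𝓘(ℂ, ℂ) 𝓘(ℂ, Fin d → ℂ) ω σ.north ∧
  ContMDiff 𝓘(ℂ, ℂ) 𝓘(ℂ, Fin d → ℂ) ω σ.south ∧
  Function.Injective σ.north ∧ Function.Injective σ.south ∧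
  σ.south 0 ∉ Set.range σ.north ∧
  Set.range σ.north ∪ Set.range σ.south = C

/-- `h`, a nowhere vanishing function on the unit circle, has winding number `m` around `0`. -/
def HasWindingNumber (h : ℂ → ℂ) (m : ℤ) : Prop :=
  ∃ ψ : ℝ → ℂ, Continuous ψ ∧ (∀ θ : ℝ, h (Complex.exp (θ * Complex.I)) = Complex.exp (ψ θ)) ∧
    ψ (2 * Real.pi) - ψ 0 = 2 * Real.pi * Complex.I * m

/-- The integral of `σ^* c₁(M)` over the Riemann sphere is `m`: for continuous frames `e`, `f` of
`σ^* TM` over the two affine charts, the transition matrix `A` on the equator, with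
`f = A e`, has a determinant of winding number `m`. (For `M` the Riemann sphere and `σ` the identity
one may take `e = ∂/∂t`, `f = ∂/∂u = - t² ∂/∂t`, and `m = 2`.) -/
def SphereMap.HasC1Integral (σ : SphereMap M) (m : ℤ) : Prop :=
  ∃ (e : Fin d → ∀ t : ℂ, TangentSpace 𝓘(ℂ, Fin d → ℂ) (σ.north t))
    (f : Fin d → ∀ u : ℂ, TangentSpace 𝓘(ℂ, Fin d → ℂ) (σ.south u))
    (A : ℂ → Matrix (Fin d) (Fin d) ℂ),
    (∀ i, Continuous (fun t => (⟨σ.north t, e i t⟩ : TangentBundle 𝓘(ℂ, Fin d → ℂ) M))) ∧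
    (∀ i, Continuous (fun u => (⟨σ.south u, f i u⟩ : TangentBundle 𝓘(ℂ, Fin d → ℂ) M))) ∧
    (∀ t, LinearIndependent ℂ (fun i => e i t)) ∧
    (∀ u, LinearIndependent ℂ (fun i => f i u)) ∧
    (∀ t : ℂ, ‖t‖ = 1 → ∀ i,
      (⟨σ.south t⁻¹, f i t⁻¹⟩ : TangentBundle 𝓘(ℂ, Fin d → ℂ) M) =
        ⟨σ.north t, ∑ j, A t i j • e j t⟩) ∧
    HasWindingNumber (fun t => (A t).det) m

end Chern

/-! ### The projective space and the blow-up -/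

/-- The weights of the homogeneous coordinates `x₁, x₂, x₃, x₄` of `ℙ³`. -/
def weightP3 : Fin 4 → Fin 1 → ℤ := fun _ _ => 1

/-- The punctured space `ℂ⁴ ∖ {0}`. -/
def coneP3 : Set (Fin 4 → ℂ) := {x | x ≠ 0}

/-- The complex projective space `ℙ³`. -/
abbrev P3 : Type := TorusQuotient weightP3 coneP3

/-- The weights of the homogeneous coordinates `x₁, x₂, x₃, x₄, a, w` (in this order) of the toric
fourfold `X₄`. -/
def weightX4 : Fin 6 → Fin 2 → ℤ :=
  ![![1, 1], ![1, 0], ![1, 0], ![1, 0], ![4, 1], ![0, -1]]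

/-- The generators `x₁ a` and `x₂ x₃ x₄ w` of the Stanley-Reisner ideal of `X₄`. -/
def stanleyReisner : Finset (Finset (Fin 6)) := {{0, 4}, {1, 2, 3, 5}}

/-- The points of `ℂ⁶` at which no generator of the Stanley-Reisner ideal has all of its variables
equal to zero; `X₄` is the quotient of this set by `(ℂˣ)²`. -/
def coneX4 : Set (Fin 6 → ℂ) := {z | ∀ S ∈ stanleyReisner, ∃ i ∈ S, z i ≠ 0}

/-- The hypersurface `w a = a₁(w x₁, x₂, x₃, x₄)` in homogeneous coordinates. -/
def coneB (a₁ : MvPolynomial (Fin 4) ℂ) : Set (Fin 6 → ℂ) :=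
  {z | z ∈ coneX4 ∧ z 5 * z 4 = MvPolynomial.eval ![z 5 * z 0, z 1, z 2, z 3] a₁}

/-- The threefold `B̃₃ = {w a = a₁(w x₁, x₂, x₃, x₄)} ⊆ X₄`. -/
abbrev BTilde (a₁ : MvPolynomial (Fin 4) ℂ) : Type := TorusQuotient weightX4 (coneB a₁)

/-- The scheme `{x₁ = 0} ∩ {a₁ = 0}` in `ℙ³` is a smooth curve: by the Jacobian criterion,
`d a₁` is nowhere a multiple of `d x₁` on it. -/
def IsSmoothCenter (a₁ : MvPolynomial (Fin 4) ℂ) : Prop :=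
  ∀ x ∈ coneP3, x 0 = 0 → MvPolynomial.eval x a₁ = 0 →
    ∃ j : Fin 4, j ≠ 0 ∧ MvPolynomial.eval x (MvPolynomial.pderiv j a₁) ≠ 0

theorem blowDown_mem {a₁ : MvPolynomial (Fin 4) ℂ} (ha₁ : a₁.IsHomogeneous 4)
    {z : Fin 6 → ℂ} (hz : z ∈ coneB a₁) : ![z 5 * z 0, z 1, z 2, z 3] ∈ coneP3 := by
  intro h0
  have h1 : z 1 = 0 := by simpa using congrFun h0 1
  have h2 : z 2 = 0 := by simpa using congrFun h0 2
  have h3 : z 3 = 0 := by simpa using congrFun h0 3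
  have h50 : z 5 = 0 ∨ z 0 = 0 := by simpa using congrFun h0 0
  obtain ⟨hc, he⟩ := hz
  rw [h0] at he
  have hev : MvPolynomial.eval (0 : Fin 4 → ℂ) a₁ = 0 := by
    rw [MvPolynomial.eval_zero]
    exact ha₁.coeff_eq_zero (by simp)
  rw [hev] at he
  obtain ⟨i, hi, hi0⟩ := hc {0, 4} (by simp [stanleyReisner])
  obtain ⟨j, hj, hj0⟩ := hc {1, 2, 3, 5} (by simp [stanleyReisner])
  simp only [Finset.mem_insert, Finset.mem_singleton] at hi hj
  have h5 : z 5 ≠ 0 := by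
    rcases hj with rfl | rfl | rfl | rfl <;> simp_all
  have h0' : z 0 = 0 := h50.resolve_left h5
  have h4 : z 4 = 0 := (mul_eq_zero.mp he).resolve_left h5
  rcases hi with rfl | rfl <;> contradiction

/-- The blow-down map `B̃₃ → ℙ³`, `[x₁ : x₂ : x₃ : x₄ : a : w] ↦ [w x₁ : x₂ : x₃ : x₄]`. -/
def blowDown {a₁ : MvPolynomial (Fin 4) ℂ} (ha₁ : a₁.IsHomogeneous 4) : BTilde a₁ → P3 :=
  Quotient.map' (s₁ := torusSetoid weightX4 (coneB a₁)) (s₂ := torusSetoid weightP3 coneP3)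
    (fun z => ⟨![z.1 5 * z.1 0, z.1 1, z.1 2, z.1 3], blowDown_mem ha₁ z.2⟩) (by
      rintro z z' ⟨t, ht⟩
      refine ⟨fun _ => t 0, fun i => ?_⟩
      have hu : (t 1 : ℂ) ≠ 0 := (t 1).ne_zero
      fin_cases i <;>
        simp [ht, torusChar, weightX4, weightP3, Fin.prod_univ_two]
      field_simp)

/-- For a holomorphic map `ψ : Y → ℙ³`, the inverse image of the ideal sheaf of
`{x₁ = 0} ∩ {a₁ = 0}` is invertible: locally, for a holomorphic choice `s` of homogeneous
coordinates of `ψ`, the functions `x₁ ∘ s` and `a₁ ∘ s` are of the form `e u` and `e v`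
with `u`, `v` without common zero and `e` not identically zero on any nonempty open set. -/
def PullbackIdealInvertible (a₁ : MvPolynomial (Fin 4) ℂ) (k : ℕ) {Y : Type}
    [TopologicalSpace Y] [ChartedSpace (Fin k → ℂ) Y] (ψ : Y → P3) : Prop :=
  ∀ y₀ : Y, ∃ U : Set Y, IsOpen U ∧ y₀ ∈ U ∧ ∃ (s : Y → Fin 4 → ℂ) (u v e : Y → ℂ),
    ContMDiffOn 𝓘(ℂ, Fin k → ℂ) 𝓘(ℂ, Fin 4 → ℂ) ω s U ∧
    ContMDiffOn 𝓘(ℂ, Fin k → ℂ) 𝓘(ℂ, ℂ) ω u U ∧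
    ContMDiffOn 𝓘(ℂ, Fin k → ℂ) 𝓘(ℂ, ℂ) ω v U ∧
    ContMDiffOn 𝓘(ℂ, Fin k → ℂ) 𝓘(ℂ, ℂ) ω e U ∧
    (∀ y ∈ U, (∃ h : s y ∈ coneP3, ψ y = mkPt weightP3 ⟨s y, h⟩) ∧
      s y 0 = e y * u y ∧ MvPolynomial.eval (s y) a₁ = e y * v y ∧ (u y ≠ 0 ∨ v y ≠ 0)) ∧
    ∀ V : Set Y, IsOpen V → V.Nonempty → V ⊆ U → ∃ y ∈ V, e y ≠ 0

/-- The map `φ : X → ℙ³` of complex manifolds is the blow-up of `ℙ³` along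
`{x₁ = 0} ∩ {a₁ = 0}`: it is the universal holomorphic map for which the inverse image of the ideal
sheaf of this locus is invertible. -/
def IsBlowUp (a₁ : MvPolynomial (Fin 4) ℂ) [ChartedSpace (Fin 3 → ℂ) P3] {X : Type}
    [TopologicalSpace X] [ChartedSpace (Fin 3 → ℂ) X] (φ : X → P3) : Prop :=
  ContMDiff 𝓘(ℂ, Fin 3 → ℂ) 𝓘(ℂ, Fin 3 → ℂ) ω φ ∧
  PullbackIdealInvertible a₁ 3 φ ∧
  ∀ (k : ℕ) (Y : Type) [TopologicalSpace Y] [ChartedSpace (Fin k → ℂ) Y]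
    [IsManifold 𝓘(ℂ, Fin k → ℂ) ω Y] (ψ : Y → P3),
    ContMDiff 𝓘(ℂ, Fin k → ℂ) 𝓘(ℂ, Fin 3 → ℂ) ω ψ → PullbackIdealInvertible a₁ k ψ →
    ∃! Ψ : Y → X, ContMDiff 𝓘(ℂ, Fin k → ℂ) 𝓘(ℂ, Fin 3 → ℂ) ω Ψ ∧ φ ∘ Ψ = ψ

/-- The 2-cycle `{x₂ = x₃ = w = 0}`, as a subset of `B̃₃`. -/
def cycleC (a₁ : MvPolynomial (Fin 4) ℂ) : Set (BTilde a₁) :=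
  {p | ∃ z : coneB a₁, mkPt weightX4 z = p ∧ z.1 1 = 0 ∧ z.1 2 = 0 ∧ z.1 5 = 0}

/-! ### Intersection numbers on the ambient fourfold -/

/-- The class `H` of `{x₂ = 0}` on `X₄`, that is, of weight `(1, 0)`. -/
def clsH : MvPolynomial (Fin 2) ℚ := MvPolynomial.X 0

/-- The class `E` of `{w = 0}` on `X₄`, that is, of weight `(0, -1)`. -/
def clsE : MvPolynomial (Fin 2) ℚ := MvPolynomial.X 1

/-- The class on `X₄` of the divisor on which the `i`-th homogeneous coordinate vanishes. -/
def divisorClass (i : Fin 6) : MvPolynomial (Fin 2) ℚ :=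
  (weightX4 i 0 : ℚ) • clsH - (weightX4 i 1 : ℚ) • clsE

/-- `deg` is the intersection form of `X₄`, `P(H, E) ↦ ∫ P(H, E)`. As for each complete simplicial
toric variety, it is concentrated in top degree, it vanishes on the Stanley-Reisner ideal, and
at the torus-fixed point where all coordinates other than the `i`-th and the `j`-th vanish,
these vanishing divisors intersect with multiplicity `1 / N`, where `N` is the order of the
stabilizer in `(ℂˣ)²` of this point, `N = |det (Q i, Q j)|`. -/
structure IsIntersectionForm (deg : MvPolynomial (Fin 2) ℚ →ₗ[ℚ] ℚ) : Prop where
  of_degree_ne : ∀ (k : ℕ) (P : MvPolynomial (Fin 2) ℚ), k ≠ 4 → P.IsHomogeneous k → deg P = 0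
  of_stanleyReisner : ∀ S ∈ stanleyReisner, ∀ P : MvPolynomial (Fin 2) ℚ,
    deg (P * ∏ i ∈ S, divisorClass i) = 0
  fixedPoint : ∀ i j : Fin 6, i < j → (∀ S ∈ stanleyReisner, i ∈ S ∨ j ∈ S) →
    deg (∏ k ∈ ({i, j} : Finset (Fin 6))ᶜ, divisorClass k) =
      1 / |((weightX4 i 0 * weightX4 j 1 - weightX4 i 1 * weightX4 j 0 : ℤ) : ℚ)|

end ToricBlowUp

end

open ToricBlowUp

open scoped Manifold ContDiff Topology

noncomputable section

namespace ToricBlowUp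

/-! ### Slice charts for torus quotients -/

/-! Everything is computed in homogeneous coordinates, upstairs on the cone. The complex structure
comes from slices: wherever the torus acts freely one can normalise two coordinates (one for `ℙ³`)
to `1` and use three of the remaining ones as coordinates. On the cone over `B̃₃` with `w ≠ 0` the
slice is `w = 1`, `x m = 1` and is a piece of affine space. At `w = 0` the point lies over the
center, where some `∂ a₁/∂x k` with `k ≠ 0` is nonzero, so the inverse function theorem solves the
equation for `x k`. Any structure satisfying `IsQuotientManifold` makes all slice charts holomorphic
(`SliceChart.contMDiffOn_chart`), which is why the results hold for every such structure.

First Chern class: an alternating form on the cone which is equivariant of weight `χ` and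
insensitive to the Euler fields of the torus descends to a form on the quotient with values in
`𝒪(χ)`; if it vanishes nowhere, then `c₁` is the class of `𝒪(χ)` (`SliceForm`, `pullback_eq`,
`firstChernClassEq`). On `ℙ³` the form is `det(z, ·, ·, ·)`, of weight `4`, and since `4` is even
`𝒪(-2)` is a square root of the canonical bundle. On `B̃₃` it is the Poincaré residue of the volume
form of `ℂ⁶` contracted with the two Euler fields. Its weight is the sum `(8, 1)` of all weights
minus the weight `(4, 0)` of the equation, that is `(4, 1)`, the weight of `4H - E` (`residueForm`):
this is adjunction.

Exceptional curves: the fibre over a point of the center is a projective line with homogeneous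
coordinates `x₁` and `a`, and its two affine charts are identified by the torus element `(1, t)`, on
which the character `(4, 1)` takes the value `t`. So `c₁` has degree `1` on it
(`hasWindingNumber_det`). The curve `C` is the fibre over `[0 : 0 : 0 : 1]`. Degree `1` is odd, so
`B̃₃` is not spin: a square root of the canonical bundle would have roots of the residue form over
both discs, and comparing them on the equator would give a continuous square root of the identity of
the circle. The center is never empty (`exists_mem_centerCone`), so such a fibre always exists.

Blow-up: to write the pulled-back equations as `x₁ = e u` and `a₁ = e v` with `u`, `v` not both zero
is to give a point `[u : x₂ : x₃ : x₄ : v : e]` of `B̃₃`. This yields local lifts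
(`exists_local_lift`). They are unique, hence glue, because the blow-down is injective off the
exceptional divisor, the locus `e ≠ 0` is dense and `B̃₃` is Hausdorff (`eq_of_blowDown_comp_eq`).

Intersection numbers: the relation `H³E = 0`, two fixed points and the recursion from `(H - E)(4H -
E) = 0` determine all five numbers; conversely the functional with these values satisfies every
requirement. -/

/-- The action of the torus `(ℂˣ)^r` on `ℂⁿ` with weights `Q`. -/
def torusAct {n r : ℕ} (Q : Fin n → Fin r → ℤ) (t : Fin r → ℂˣ) (z : Fin n → ℂ) : Fin n → ℂ :=
  fun i => torusChar t (Q i) * z i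

section Action

variable {n r : ℕ} {Q : Fin n → Fin r → ℤ} {Z : Set (Fin n → ℂ)}

theorem torusChar_ne_zero (t : Fin r → ℂˣ) (q : Fin r → ℤ) : torusChar t q ≠ 0 :=
  Units.ne_zero _

theorem torusAct_one (z : Fin n → ℂ) : torusAct Q 1 z = z := by
  ext i; simp [torusAct, torusChar_one]

theorem torusAct_mul (s t : Fin r → ℂˣ) (z : Fin n → ℂ) :
    torusAct Q (s * t) z = torusAct Q s (torusAct Q t z) := by
  ext i; simp [torusAct, torusChar_mul, mul_assoc]

theorem torusAct_inv_torusAct (t : Fin r → ℂˣ) (z : Fin n → ℂ) :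
    torusAct Q t⁻¹ (torusAct Q t z) = z := by
  rw [← torusAct_mul, inv_mul_cancel, torusAct_one]

theorem torusAct_torusAct_inv (t : Fin r → ℂˣ) (z : Fin n → ℂ) :
    torusAct Q t (torusAct Q t⁻¹ z) = z := by
  rw [← torusAct_mul, mul_inv_cancel, torusAct_one]

theorem contDiff_torusAct (t : Fin r → ℂˣ) : ContDiff ℂ ω (torusAct Q t) := by
  unfold torusAct
  fun_prop

theorem mkPt_eq_mkPt_iff {z z' : Z} : mkPt Q z = mkPt Q z' ↔ ∃ t, z'.1 = torusAct Q t z.1 := by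
  refine Quotient.eq.trans ?_
  exact exists_congr fun t => ⟨fun h => funext h, fun h i => congrFun h i⟩

theorem continuous_mkPt : Continuous (mkPt Q : Z → TorusQuotient Q Z) :=
  continuous_quotient_mk'

theorem mkPt_out (x : TorusQuotient Q Z) : mkPt Q x.out = x := Quotient.out_eq x

/-- The saturation of an open set is a union of preimages under the continuous maps by which torus
elements act. Openness reduces Hausdorffness of the quotient to closedness of the orbit relation. -/
theorem isOpenQuotientMap_mkPt (hZ : ∀ t, ∀ z ∈ Z, torusAct Q t z ∈ Z) :
    IsOpenQuotientMap (mkPt Q : Z → TorusQuotient Q Z) := by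
  refine ⟨Quotient.mk_surjective, continuous_mkPt, fun U hU => ?_⟩
  refine isOpen_coinduced.2 ?_
  have : (mkPt Q ⁻¹' (mkPt Q '' U) : Set Z) =
      ⋃ t, (fun z : Z => (⟨torusAct Q t z.1, hZ t _ z.2⟩ : Z)) ⁻¹' U := by
    ext z
    simp only [Set.mem_preimage, Set.mem_image, Set.mem_iUnion]
    constructor
    · rintro ⟨z', hz', h⟩
      obtain ⟨t, ht⟩ := mkPt_eq_mkPt_iff.1 h.symm
      refine ⟨t, ?_⟩
      convert hz'
      exact ht.symm
    · rintro ⟨t, ht⟩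
      exact ⟨_, ht, (mkPt_eq_mkPt_iff.2 ⟨t, rfl⟩).symm⟩
  change IsOpen (mkPt Q ⁻¹' (mkPt Q '' U))
  rw [this]
  refine isOpen_iUnion fun t => hU.preimage ?_
  exact ((contDiff_torusAct t).continuous.comp continuous_subtype_val).subtype_mk _

end Action

/-- A slice chart for `Z / (ℂˣ)^r`: on the open set `dom` the torus action is normalised by `norm`,
the normalised points of `Z` are parametrised by `param`, and `coord` are the coordinates. -/
structure SliceChart (d : ℕ) {n r : ℕ} (Q : Fin n → Fin r → ℤ) (Z : Set (Fin n → ℂ)) where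
  dom : Set (Fin n → ℂ)
  target : Set (Fin d → ℂ)
  param : (Fin d → ℂ) → Fin n → ℂ
  coord : (Fin n → ℂ) → Fin d → ℂ
  norm : (Fin n → ℂ) → Fin r → ℂˣ
  base : Z
  isOpen_dom : IsOpen dom
  isOpen_target : IsOpen target
  contDiffOn_param : ContDiffOn ℂ ω param target
  contDiffOn_coord : ContDiffOn ℂ ω coord dom
  contDiffOn_norm : ∀ k, ContDiffOn ℂ ω (fun z => (norm z k : ℂ)) dom
  param_mem : ∀ u ∈ target, param u ∈ Z
  param_mem_dom : ∀ u ∈ target, param u ∈ dom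
  coord_mem : ∀ z ∈ dom, coord z ∈ target
  coord_param : ∀ u ∈ target, coord (param u) = u
  act_mem_dom : ∀ t, ∀ z ∈ dom, torusAct Q t z ∈ dom
  coord_act : ∀ t, ∀ z ∈ dom, coord (torusAct Q t z) = coord z
  -- This makes the action on `dom` free, since a torus element fixing a point must be `1`, and it
  -- makes the normalised point constant along orbits.
  norm_act : ∀ t, ∀ z ∈ dom, norm (torusAct Q t z) = norm z * t⁻¹
  param_coord : ∀ z ∈ Z, z ∈ dom → param (coord z) = torusAct Q (norm z) z

namespace SliceChart

variable {d n r : ℕ} {Q : Fin n → Fin r → ℤ} {Z : Set (Fin n → ℂ)} (c : SliceChart d Q Z)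

/-- The domain of the chart in the quotient. -/
def source : Set (TorusQuotient Q Z) := {x | x.out.1 ∈ c.dom}

/-- The chart on the quotient. -/
def chart (x : TorusQuotient Q Z) : Fin d → ℂ := c.coord x.out.1

open Classical in
/-- The parametrisation, with values in `Z`. -/
def lift (u : Fin d → ℂ) : Z := if h : u ∈ c.target then ⟨c.param u, c.param_mem u h⟩ else c.base

/-- The holomorphic section given by the slice. -/
def sect (x : TorusQuotient Q Z) : Z := c.lift (c.chart x)

variable {c}

theorem lift_val {u : Fin d → ℂ} (hu : u ∈ c.target) : (c.lift u).1 = c.param u := by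
  simp [lift, hu]

theorem mkPt_mem_source_iff {z : Z} : mkPt Q z ∈ c.source ↔ z.1 ∈ c.dom := by
  obtain ⟨t, ht⟩ := mkPt_eq_mkPt_iff.1 (mkPt_out (mkPt Q z))
  constructor
  · intro h
    rw [ht]
    exact c.act_mem_dom _ _ h
  · intro h
    have := c.act_mem_dom t⁻¹ _ h
    rwa [ht, torusAct_inv_torusAct] at this

theorem chart_mkPt {z : Z} (hz : z.1 ∈ c.dom) : c.chart (mkPt Q z) = c.coord z.1 := by
  obtain ⟨t, ht⟩ := mkPt_eq_mkPt_iff.1 (mkPt_out (mkPt Q z))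
  rw [ht, c.coord_act _ _ (mkPt_mem_source_iff.2 hz)]
  rfl

theorem chart_mem_target {x : TorusQuotient Q Z} (hx : x ∈ c.source) : c.chart x ∈ c.target :=
  c.coord_mem _ hx

theorem lift_mem_dom {u : Fin d → ℂ} (hu : u ∈ c.target) : (c.lift u).1 ∈ c.dom := by
  rw [lift_val hu]; exact c.param_mem_dom u hu

theorem mkPt_lift_mem_source {u : Fin d → ℂ} (hu : u ∈ c.target) :
    mkPt Q (c.lift u) ∈ c.source :=
  mkPt_mem_source_iff.2 (lift_mem_dom hu)

theorem chart_mkPt_lift {u : Fin d → ℂ} (hu : u ∈ c.target) : c.chart (mkPt Q (c.lift u)) = u := by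
  rw [chart_mkPt (lift_mem_dom hu), lift_val hu, c.coord_param u hu]

theorem sect_val {x : TorusQuotient Q Z} (hx : x ∈ c.source) :
    (c.sect x).1 = c.param (c.chart x) :=
  lift_val (chart_mem_target hx)

theorem sect_mkPt {z : Z} (hz : z.1 ∈ c.dom) :
    (c.sect (mkPt Q z)).1 = torusAct Q (c.norm z.1) z.1 := by
  rw [sect_val (mkPt_mem_source_iff.2 hz), chart_mkPt hz, c.param_coord _ z.2 hz]

theorem mkPt_sect {x : TorusQuotient Q Z} (hx : x ∈ c.source) : mkPt Q (c.sect x) = x := by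
  induction x using Quotient.inductionOn with
  | h z =>
    exact (mkPt_eq_mkPt_iff.2 ⟨_, sect_mkPt (mkPt_mem_source_iff.1 hx)⟩).symm

theorem continuousOn_lift : ContinuousOn c.lift c.target := by
  rw [Topology.IsInducing.subtypeVal.continuousOn_iff]
  exact c.contDiffOn_param.continuousOn.congr fun u hu => lift_val hu

theorem isOpen_source : IsOpen c.source := by
  refine isOpen_coinduced.2 ?_
  have : (Quotient.mk _ ⁻¹' c.source : Set Z) = Subtype.val ⁻¹' c.dom := by
    ext z
    exact mkPt_mem_source_iff
  change IsOpen (Quotient.mk _ ⁻¹' c.source : Set Z)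
  rw [this]
  exact c.isOpen_dom.preimage continuous_subtype_val

theorem continuousOn_chart : ContinuousOn c.chart c.source := by
  have hq : Topology.IsQuotientMap (mkPt Q : Z → TorusQuotient Q Z) := isQuotientMap_quotient_mk'
  rw [hq.continuousOn_isOpen_iff isOpen_source]
  have : (mkPt Q ⁻¹' c.source : Set Z) = Subtype.val ⁻¹' c.dom := by
    ext z
    exact mkPt_mem_source_iff
  rw [this]
  refine (c.contDiffOn_coord.continuousOn.comp continuous_subtype_val.continuousOn
    fun z hz => hz).congr fun z hz => ?_
  exact chart_mkPt hz

theorem differentiableAt_param {u : Fin d → ℂ} (hu : u ∈ c.target) :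
    DifferentiableAt ℂ c.param u :=
  (c.contDiffOn_param.contDiffAt (c.isOpen_target.mem_nhds hu)).differentiableAt (by simp)

theorem continuousOn_sect : ContinuousOn c.sect c.source :=
  continuousOn_lift.comp continuousOn_chart fun _ hx => chart_mem_target hx

variable (c) in
/-- The chart as an open partial homeomorphism. -/
def homeo : OpenPartialHomeomorph (TorusQuotient Q Z) (Fin d → ℂ) where
  toFun := c.chart
  invFun u := mkPt Q (c.lift u)
  source := c.source
  target := c.target
  map_source' _ hx := chart_mem_target hx
  map_target' _ hu := mkPt_lift_mem_source hu
  left_inv' _ hx := mkPt_sect hx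
  right_inv' _ hu := chart_mkPt_lift hu
  open_source := isOpen_source
  open_target := c.isOpen_target
  continuousOn_toFun := continuousOn_chart
  continuousOn_invFun := continuous_mkPt.comp_continuousOn continuousOn_lift

/-- As `coord` is constant on orbits, the transition is `c'.coord ∘ c.param`, with no trace of the
chosen representatives. -/
theorem contDiffOn_transition (c c' : SliceChart d Q Z) :
    ContDiffOn ℂ ω (c.homeo.symm ≫ₕ c'.homeo) (c.homeo.symm ≫ₕ c'.homeo).source := by
  have hs : (c.homeo.symm ≫ₕ c'.homeo).source =
      c.target ∩ (fun u => mkPt Q (c.lift u)) ⁻¹' c'.source := by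
    rw [OpenPartialHomeomorph.trans_source]; rfl
  rw [hs]
  have hmem : ∀ u ∈ c.target ∩ (fun u => mkPt Q (c.lift u)) ⁻¹' c'.source,
      (c.lift u).1 ∈ c'.dom := fun u hu => mkPt_mem_source_iff.1 hu.2
  refine (c'.contDiffOn_coord.comp (c.contDiffOn_param.mono Set.inter_subset_left)
    fun u hu => ?_).congr fun u hu => ?_
  · rw [← lift_val hu.1]; exact hmem u hu
  · change c'.chart (mkPt Q (c.lift u)) = _
    rw [chart_mkPt (hmem u hu), lift_val hu.1]
    rfl

end SliceChart

/-- Slice charts around all points of a torus-invariant subset `Z` of `ℂⁿ`. -/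
structure SliceAtlas (d : ℕ) {n r : ℕ} (Q : Fin n → Fin r → ℤ) (Z : Set (Fin n → ℂ)) where
  act_mem : ∀ t, ∀ z ∈ Z, torusAct Q t z ∈ Z
  sliceAt : Z → SliceChart d Q Z
  mem_sliceAt : ∀ z : Z, z.1 ∈ (sliceAt z).dom

namespace SliceAtlas

variable {d n r : ℕ} {Q : Fin n → Fin r → ℤ} {Z : Set (Fin n → ℂ)} (𝒜 : SliceAtlas d Q Z)

/-- A slice chart around a point of the quotient. -/
def chartOf (x : TorusQuotient Q Z) : SliceChart d Q Z := 𝒜.sliceAt x.out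

theorem mem_chartOf (x : TorusQuotient Q Z) : x ∈ (𝒜.chartOf x).source := 𝒜.mem_sliceAt x.out

/-- The charted space structure given by an atlas of slice charts. -/
abbrev chartedSpace : ChartedSpace (Fin d → ℂ) (TorusQuotient Q Z) where
  atlas := Set.range SliceChart.homeo
  chartAt x := (𝒜.chartOf x).homeo
  mem_chart_source := 𝒜.mem_chartOf
  chart_mem_atlas _ := ⟨_, rfl⟩

theorem isQuotientManifold :
    let := 𝒜.chartedSpace
    IsQuotientManifold d Q Z := by
  let := 𝒜.chartedSpace
  have hman : IsManifold 𝓘(ℂ, Fin d → ℂ) ω (TorusQuotient Q Z) := by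
    refine isManifold_of_contDiffOn _ _ _ ?_
    rintro _ _ ⟨c, rfl⟩ ⟨c', rfl⟩
    simpa using SliceChart.contDiffOn_transition c c'
  refine { hman with contMDiffOn_mkPt := ?_, exists_section := ?_ }
  · intro k U s hU hs u hu
    refine ContMDiffAt.contMDiffWithinAt ?_
    have hsu : ContDiffAt ℂ ω (fun u => (s u).1) u := hs.contDiffAt (hU.mem_nhds hu)
    have hcont : ContinuousAt s u :=
      Topology.IsInducing.subtypeVal.continuousAt_iff.2 hsu.continuousAt
    rw [contMDiffAt_iff_target]
    refine ⟨continuous_mkPt.continuousAt.comp hcont, ContDiffAt.contMDiffAt ?_⟩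
    set c := 𝒜.chartOf (mkPt Q (s u))
    have hmem : (s u).1 ∈ c.dom := SliceChart.mkPt_mem_source_iff.1 (𝒜.mem_chartOf _)
    have h1 : ContDiffAt ℂ ω (fun u => c.coord (s u).1) u :=
      (c.contDiffOn_coord.contDiffAt (c.isOpen_dom.mem_nhds hmem)).comp u hsu
    refine h1.congr_of_eventuallyEq ?_
    filter_upwards [hsu.continuousAt.preimage_mem_nhds (c.isOpen_dom.mem_nhds hmem)] with v hv
    simp only [extChartAt, mfld_simps]
    exact SliceChart.chart_mkPt hv
  · intro p
    set c := 𝒜.chartOf p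
    refine ⟨c.source, SliceChart.isOpen_source, 𝒜.mem_chartOf p, c.sect, ?_,
      fun y hy => SliceChart.mkPt_sect hy⟩
    have h1 : ContMDiffOn 𝓘(ℂ, Fin d → ℂ) 𝓘(ℂ, Fin d → ℂ) ω c.chart c.source :=
      contMDiffOn_of_mem_maximalAtlas (e := c.homeo)
        (IsManifold.subset_maximalAtlas ⟨c, rfl⟩)
    exact (c.contDiffOn_param.contMDiffOn.comp h1
      fun y hy => SliceChart.chart_mem_target hy).congr fun y hy => SliceChart.sect_val hy

end SliceAtlas

/-! ### Slice charts and the complex structure of the quotient -/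

namespace SliceChart

variable {d n r : ℕ} {Q : Fin n → Fin r → ℤ} {Z : Set (Fin n → ℂ)}
  [ChartedSpace (Fin d → ℂ) (TorusQuotient Q Z)] [IsQuotientManifold d Q Z]
  {c : SliceChart d Q Z}

theorem contMDiffOn_mkPt_lift :
    ContMDiffOn 𝓘(ℂ, Fin d → ℂ) 𝓘(ℂ, Fin d → ℂ) ω (fun u => mkPt Q (c.lift u)) c.target :=
  IsQuotientManifold.contMDiffOn_mkPt d c.target c.lift c.isOpen_target
    (c.contDiffOn_param.congr fun _ hu => lift_val hu)

/-- The given structure need not come from slices. Its own local holomorphic sections exhibit the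
chart as `coord` of a section. Together with `contMDiffOn_mkPt_lift` this makes slice charts
biholomorphic for every admissible structure. -/
theorem contMDiffOn_chart :
    ContMDiffOn 𝓘(ℂ, Fin d → ℂ) 𝓘(ℂ, Fin d → ℂ) ω c.chart c.source := by
  intro x hx
  obtain ⟨U, hU, hxU, s, hs, hsU⟩ := IsQuotientManifold.exists_section (d := d) x
  have hmem : ∀ y ∈ U ∩ c.source, (s y).1 ∈ c.dom := fun y hy => by
    rw [← mkPt_mem_source_iff, hsU y hy.1]; exact hy.2
  have h1 : ContMDiffOn 𝓘(ℂ, Fin d → ℂ) 𝓘(ℂ, Fin d → ℂ) ω (fun y => c.coord (s y).1)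
      (U ∩ c.source) :=
    c.contDiffOn_coord.contMDiffOn.comp (hs.mono Set.inter_subset_left) hmem
  have h2 : ContMDiffOn 𝓘(ℂ, Fin d → ℂ) 𝓘(ℂ, Fin d → ℂ) ω c.chart (U ∩ c.source) :=
    h1.congr fun y hy => by rw [← chart_mkPt (hmem y hy), hsU y hy.1]
  exact (h2.contMDiffAt ((hU.inter isOpen_source).mem_nhds ⟨hxU, hx⟩)).contMDiffWithinAt

theorem contMDiffOn_sect :
    ContMDiffOn 𝓘(ℂ, Fin d → ℂ) 𝓘(ℂ, Fin n → ℂ) ω (fun x => (c.sect x).1) c.source :=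
  (c.contDiffOn_param.contMDiffOn.comp contMDiffOn_chart
    fun _ hy => chart_mem_target hy).congr fun _ hy => sect_val hy

/-- The derivative of a slice chart. -/
def dchart (c : SliceChart d Q Z) (x : TorusQuotient Q Z) : (Fin d → ℂ) →L[ℂ] (Fin d → ℂ) :=
  mfderiv 𝓘(ℂ, Fin d → ℂ) 𝓘(ℂ, Fin d → ℂ) c.chart x

theorem mdifferentiableAt_chart {x : TorusQuotient Q Z} (hx : x ∈ c.source) :
    MDifferentiableAt 𝓘(ℂ, Fin d → ℂ) 𝓘(ℂ, Fin d → ℂ) c.chart x :=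
  ((contMDiffOn_chart (c := c)).contMDiffAt (isOpen_source.mem_nhds hx)).mdifferentiableAt (by simp)

theorem mdifferentiableAt_mkPt_lift {u : Fin d → ℂ} (hu : u ∈ c.target) :
    MDifferentiableAt 𝓘(ℂ, Fin d → ℂ) 𝓘(ℂ, Fin d → ℂ) (fun u => mkPt Q (c.lift u)) u :=
  ((contMDiffOn_mkPt_lift (c := c)).contMDiffAt (c.isOpen_target.mem_nhds hu)).mdifferentiableAt
    (by simp)

theorem dchart_mfderiv_mkPt_lift {u : Fin d → ℂ} (hu : u ∈ c.target) (w : Fin d → ℂ) :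
    c.dchart (mkPt Q (c.lift u))
      (mfderiv 𝓘(ℂ, Fin d → ℂ) 𝓘(ℂ, Fin d → ℂ) (fun u => mkPt Q (c.lift u)) u w) = w := by
  have h1 := mfderiv_comp u (mdifferentiableAt_chart (mkPt_lift_mem_source hu))
    (mdifferentiableAt_mkPt_lift hu)
  have h2 : mfderiv 𝓘(ℂ, Fin d → ℂ) 𝓘(ℂ, Fin d → ℂ)
      (c.chart ∘ fun u => mkPt Q (c.lift u)) u = ContinuousLinearMap.id ℂ _ := by
    have : (c.chart ∘ fun u => mkPt Q (c.lift u)) =ᶠ[𝓝 u] id := by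
      filter_upwards [c.isOpen_target.mem_nhds hu] with v hv using chart_mkPt_lift hv
    rw [this.mfderiv_eq, mfderiv_id]
  exact (congrArg (fun L : (Fin d → ℂ) →L[ℂ] (Fin d → ℂ) => L w) (h1.symm.trans h2) :)

theorem dchart_eq_comp {c c' : SliceChart d Q Z} {x : TorusQuotient Q Z} (hx : x ∈ c.source)
    (hx' : x ∈ c'.source) :
    c'.dchart x = (fderiv ℂ (fun u => c'.coord (c.param u)) (c.chart x)).comp (c.dchart x) := by
  have hev : c'.chart =ᶠ[𝓝 x] (fun u => c'.coord (c.param u)) ∘ c.chart := by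
    filter_upwards [isOpen_source.mem_nhds hx, isOpen_source.mem_nhds hx'] with y hy hy'
    have h1 : mkPt Q (c.sect y) = y := mkPt_sect hy
    have h2 : (c.sect y).1 ∈ c'.dom := by rw [← mkPt_mem_source_iff, h1]; exact hy'
    conv_lhs => rw [← h1, chart_mkPt h2, sect_val hy]
    rfl
  have hp : c.param (c.chart x) ∈ c'.dom := by
    rw [← sect_val hx, ← mkPt_mem_source_iff, mkPt_sect hx]; exact hx'
  have hd : DifferentiableAt ℂ (fun u => c'.coord (c.param u)) (c.chart x) :=
    ((c'.contDiffOn_coord.contDiffAt (c'.isOpen_dom.mem_nhds hp)).differentiableAt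
      (by simp)).comp _ (differentiableAt_param (chart_mem_target hx))
  have h := mfderiv_comp x hd.mdifferentiableAt (mdifferentiableAt_chart hx)
  rw [← hev.mfderiv_eq, mfderiv_eq_fderiv] at h
  exact h

theorem continuousOn_dchart {Y : Type*} [TopologicalSpace Y] {p : Y → TorusQuotient Q Z}
    {v : ∀ y, TangentSpace 𝓘(ℂ, Fin d → ℂ) (p y)}
    (hv : Continuous fun y => (⟨p y, v y⟩ : TangentBundle 𝓘(ℂ, Fin d → ℂ) (TorusQuotient Q Z))) :
    ContinuousOn (fun y => c.dchart (p y) (v y)) (p ⁻¹' c.source) := by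
  have h1 := (contMDiffOn_chart (c := c)).continuousOn_tangentMapWithin (by simp)
    (isOpen_source (c := c)).uniqueMDiffOn
  have h2 := h1.comp (s := p ⁻¹' c.source) hv.continuousOn (fun y hy => hy)
  have h3 := (tangentBundleModelSpaceHomeomorph 𝓘(ℂ, Fin d → ℂ)).continuous.comp_continuousOn h2
  have h4 := continuous_snd.comp_continuousOn h3
  refine h4.congr fun y hy => ?_
  change _ = mfderivWithin _ _ _ _ _ _
  rw [mfderivWithin_of_isOpen isOpen_source hy]
  rfl

end SliceChart

namespace SliceAtlas

variable {d n r : ℕ} {Q : Fin n → Fin r → ℤ} {Z : Set (Fin n → ℂ)}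
  [ChartedSpace (Fin d → ℂ) (TorusQuotient Q Z)] [IsQuotientManifold d Q Z]

/-- The definition of the quotient structure only tests families over open subsets of `ℂᵏ`.
Factoring through a slice extends it to families over an arbitrary manifold. -/
theorem contMDiffOn_mkPt_comp (𝒜 : SliceAtlas d Q Z) {E H Y : Type*} [NormedAddCommGroup E] [NormedSpace ℂ E]
    [TopologicalSpace H] {I : ModelWithCorners ℂ E H} [TopologicalSpace Y] [ChartedSpace H Y]
    {U : Set Y} {f : Y → Z}
    (hf : ContMDiffOn I 𝓘(ℂ, Fin n → ℂ) ω (fun y => (f y).1) U) :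
    ContMDiffOn I 𝓘(ℂ, Fin d → ℂ) ω (fun y => mkPt Q (f y)) U := by
  intro y hy
  set c := 𝒜.sliceAt (f y)
  have hmem := 𝒜.mem_sliceAt (f y)
  have h1 : ContMDiffWithinAt I 𝓘(ℂ, Fin d → ℂ) ω (fun y => c.coord (f y).1) U y :=
    (c.contDiffOn_coord.contDiffAt (c.isOpen_dom.mem_nhds hmem)).contMDiffAt.comp_contMDiffWithinAt
      (g := c.coord) y (hf y hy)
  have h2 : ContMDiffWithinAt I 𝓘(ℂ, Fin d → ℂ) ω (fun y => mkPt Q (c.lift (c.coord (f y).1)))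
      U y :=
    (SliceChart.contMDiffOn_mkPt_lift.contMDiffAt
      (c.isOpen_target.mem_nhds (c.coord_mem _ hmem))).comp_contMDiffWithinAt
      (g := fun u => mkPt Q (c.lift u)) y h1
  have key : ∀ y, (f y).1 ∈ c.dom → mkPt Q (f y) = mkPt Q (c.lift (c.coord (f y).1)) := by
    intro y hy
    rw [← SliceChart.chart_mkPt hy]
    exact (SliceChart.mkPt_sect (SliceChart.mkPt_mem_source_iff.2 hy)).symm
  refine h2.congr_of_eventuallyEq ?_ (key y hmem)
  filter_upwards [(hf y hy).continuousWithinAt.preimage_mem_nhdsWithin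
    (c.isOpen_dom.mem_nhds hmem)] with v hv using key v hv

theorem contMDiff_mkPt_comp (𝒜 : SliceAtlas d Q Z) {E H Y : Type*} [NormedAddCommGroup E] [NormedSpace ℂ E]
    [TopologicalSpace H] {I : ModelWithCorners ℂ E H} [TopologicalSpace Y] [ChartedSpace H Y]
    {f : Y → Z} (hf : ContMDiff I 𝓘(ℂ, Fin n → ℂ) ω (fun y => (f y).1)) :
    ContMDiff I 𝓘(ℂ, Fin d → ℂ) ω (fun y => mkPt Q (f y)) :=
  contMDiffOn_univ.1 (𝒜.contMDiffOn_mkPt_comp hf.contMDiffOn)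

end SliceAtlas

/-! ### Equivariant forms and the first Chern class -/

/-- The vector fields generating the torus action. -/
def eulerVec {n r : ℕ} (Q : Fin n → Fin r → ℤ) (k : Fin r) (z : Fin n → ℂ) : Fin n → ℂ :=
  fun i => (Q i k : ℂ) * z i

theorem hasDerivAt_torusChar {r : ℕ} {τ : ℂ → Fin r → ℂˣ} {τ' : Fin r → ℂ} {ε : ℂ}
    (hτ : ∀ k, HasDerivAt (fun ε => (τ ε k : ℂ)) (τ' k) ε) (q : Fin r → ℤ) :
    HasDerivAt (fun ε => torusChar (τ ε) q)
      (torusChar (τ ε) q * ∑ k, τ' k / (τ ε k : ℂ) * (q k : ℂ)) ε := by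
  have h1 : ∀ k ∈ Finset.univ, HasDerivAt (fun ε => (τ ε k : ℂ) ^ q k)
      ((q k : ℂ) * (τ ε k : ℂ) ^ (q k - 1) * τ' k) ε := fun k _ =>
    HasDerivAt.comp (h₂ := fun x : ℂ => x ^ q k) ε
      (hasDerivAt_zpow (q k) (τ ε k : ℂ) (Or.inl (τ ε k).ne_zero)) (hτ k)
  have h2 := HasDerivAt.fun_finsetProd h1
  have h3 : (fun ε => torusChar (τ ε) q) = fun ε => ∏ k, (τ ε k : ℂ) ^ q k := by
    funext ε; simp [torusChar]
  rw [h3]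
  refine h2.congr_deriv ?_
  rw [Finset.mul_sum]
  refine Finset.sum_congr rfl fun k _ => ?_
  have h4 : torusChar (τ ε) q =
      (∏ j ∈ Finset.univ.erase k, (τ ε j : ℂ) ^ q j) * (τ ε k : ℂ) ^ q k := by
    rw [Finset.prod_erase_mul _ _ (Finset.mem_univ k)]; simp [torusChar]
  rw [h4, zpow_sub_one₀ (τ ε k).ne_zero, smul_eq_mul]
  have := (τ ε k).ne_zero
  field_simp

/-- Product rule: the moving torus element contributes its logarithmic derivative times the Euler
fields. Hence forms that ignore Euler directions do not see a change of slice. -/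
theorem hasDerivAt_torusAct {n r : ℕ} (Q : Fin n → Fin r → ℤ) {τ : ℂ → Fin r → ℂˣ}
    {τ' : Fin r → ℂ} {f : ℂ → Fin n → ℂ} {f' : Fin n → ℂ} {ε : ℂ}
    (hτ : ∀ k, HasDerivAt (fun ε => (τ ε k : ℂ)) (τ' k) ε) (hf : HasDerivAt f f' ε) :
    HasDerivAt (fun ε => torusAct Q (τ ε) (f ε))
      (torusAct Q (τ ε) (f' + ∑ k, (τ' k / (τ ε k : ℂ)) • eulerVec Q k (f ε))) ε := by
  rw [hasDerivAt_pi] at hf ⊢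
  intro i
  refine ((hasDerivAt_torusChar hτ (Q i)).mul (hf i)).congr_deriv ?_
  simp only [torusAct, Pi.add_apply, Finset.sum_apply, Pi.smul_apply, eulerVec, smul_eq_mul,
    mul_add, Finset.mul_sum, Finset.sum_mul]
  rw [add_comm]
  congr 1
  refine Finset.sum_congr rfl fun k _ => ?_
  ring

/-- The one-parameter subgroups of the torus given by the coordinates. -/
def eulerUnit {r : ℕ} (k : Fin r) (ε : ℂ) (j : Fin r) : ℂˣ :=
  if j = k then Units.mk0 _ (Complex.exp_ne_zero ε) else 1

theorem eulerUnit_zero {r : ℕ} (k : Fin r) : eulerUnit k 0 = 1 := by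
  funext j; by_cases h : j = k <;> simp [eulerUnit, h]

theorem hasDerivAt_eulerUnit {r : ℕ} (k j : Fin r) :
    HasDerivAt (fun ε => (eulerUnit k ε j : ℂ)) (if j = k then 1 else 0) 0 := by
  by_cases h : j = k
  · simpa [eulerUnit, h] using Complex.hasDerivAt_exp 0
  · simpa [eulerUnit, h] using hasDerivAt_const (0 : ℂ) (1 : ℂ)

/-- Alternating forms on the tangent spaces of `Z ⊆ ℂⁿ`, depending continuously on the point, that
descend to forms on `Z / (ℂˣ)^r` with values in the line bundle of weight `χ`. -/
structure SliceForm (d : ℕ) {n r : ℕ} (Q : Fin n → Fin r → ℤ) (Z : Set (Fin n → ℂ))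
    (χ : Fin r → ℤ) where
  tangent : (Fin n → ℂ) → Submodule ℂ (Fin n → ℂ)
  form : (Fin n → ℂ) → (Fin n → ℂ) [⋀^Fin d]→ₗ[ℂ] ℂ
  -- `tangent` only has to contain the velocities of curves in `Z`; it may be larger, as for `ℙ³`,
  -- where it is everything.
  hasDerivAt_mem : ∀ (γ : ℂ → Fin n → ℂ) (V : Fin n → ℂ) (ε : ℂ), HasDerivAt γ V ε →
    (∀ᶠ ε' in 𝓝 ε, γ ε' ∈ Z) → V ∈ tangent (γ ε)
  continuousOn_form : ContinuousOn (fun p : (Fin n → ℂ) × (Fin d → Fin n → ℂ) => form p.1 p.2)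
    (Z ×ˢ Set.univ)
  form_act : ∀ t, ∀ z ∈ Z, ∀ V : Fin d → Fin n → ℂ, (∀ i, V i ∈ tangent z) →
    form (torusAct Q t z) (fun i => torusAct Q t (V i)) = torusChar t χ * form z V
  form_add_euler : ∀ z ∈ Z, ∀ (V : Fin d → Fin n → ℂ) (a : Fin d → Fin r → ℂ),
    (∀ i, V i ∈ tangent z) → form z (fun i => V i + ∑ k, a i k • eulerVec Q k z) = form z V

namespace SliceForm

section Tangent

variable {d n r : ℕ} {Q : Fin n → Fin r → ℤ} {Z : Set (Fin n → ℂ)} {χ : Fin r → ℤ}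
  (η : SliceForm d Q Z χ)

theorem fderiv_mem {f : (Fin d → ℂ) → Fin n → ℂ} {u : Fin d → ℂ} (hf : DifferentiableAt ℂ f u)
    (hZ : ∀ᶠ v in 𝓝 u, f v ∈ Z) (w : Fin d → ℂ) : fderiv ℂ f u w ∈ η.tangent (f u) := by
  have hline : HasDerivAt (fun ε : ℂ => u + ε • w) w 0 := by
    simpa using ((hasDerivAt_id (0 : ℂ)).smul_const w).const_add u
  have hu0 : u + (0 : ℂ) • w = u := by simp
  have hp : HasFDerivAt f (fderiv ℂ f u) (u + (0 : ℂ) • w) := by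
    rw [hu0]; exact hf.hasFDerivAt
  have h := η.hasDerivAt_mem _ _ _ (hp.comp_hasDerivAt (0 : ℂ) hline) ?_
  · simpa using h
  · have hc : Filter.Tendsto (fun ε : ℂ => u + ε • w) (𝓝 0) (𝓝 u) := by
      simpa using hline.continuousAt.tendsto
    exact hc.eventually hZ

theorem eulerVec_mem (hZ : ∀ t, ∀ z ∈ Z, torusAct Q t z ∈ Z) (k : Fin r) {z : Fin n → ℂ}
    (hz : z ∈ Z) : eulerVec Q k z ∈ η.tangent z := by
  have h := η.hasDerivAt_mem _ _ _ (hasDerivAt_torusAct Q (hasDerivAt_eulerUnit k)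
    (hasDerivAt_const (0 : ℂ) z))
    (Filter.Eventually.of_forall fun ε => hZ (eulerUnit k ε) z hz)
  simpa [eulerUnit_zero, torusAct_one] using h

end Tangent

variable {d n r : ℕ} {Q : Fin n → Fin r → ℤ} {Z : Set (Fin n → ℂ)} {χ : Fin r → ℤ}
  [ChartedSpace (Fin d → ℂ) (TorusQuotient Q Z)]
  (η : SliceForm d Q Z χ)

/-- The form on the quotient, in a slice chart. -/
def pullback (c : SliceChart d Q Z) (z : Z) : (Fin d → ℂ) [⋀^Fin d]→ₗ[ℂ] ℂ :=
  -- The form is evaluated at the normalised point; the character undoes the normalisation, so that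
  -- the result has weight `χ` in `z`.
  torusChar (c.norm z.1)⁻¹ χ • (η.form (c.param (c.coord z.1))).compLinearMap
    ((fderiv ℂ c.param (c.coord z.1)).comp (c.dchart (mkPt Q z)) :
      (Fin d → ℂ) →ₗ[ℂ] (Fin n → ℂ))

theorem pullback_apply (c : SliceChart d Q Z) (z : Z) (v : Fin d → Fin d → ℂ) :
    η.pullback c z v = torusChar (c.norm z.1)⁻¹ χ * η.form (c.param (c.coord z.1))
      (fun i => fderiv ℂ c.param (c.coord z.1) (c.dchart (mkPt Q z) (v i))) := rfl

theorem pullback_act {c : SliceChart d Q Z} {z z' : Z} (hz : z.1 ∈ c.dom) (t : Fin r → ℂˣ)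
    (h : z'.1 = torusAct Q t z.1) : η.pullback c z' = torusChar t χ • η.pullback c z := by
  have hp : mkPt Q z' = mkPt Q z := (mkPt_eq_mkPt_iff.2 ⟨t, h⟩).symm
  ext v
  rw [AlternatingMap.smul_apply, pullback_apply, pullback_apply, hp, h, c.coord_act _ _ hz,
    c.norm_act _ _ hz, mul_inv, inv_inv, torusChar_mul, smul_eq_mul]
  ring

variable [IsQuotientManifold d Q Z]

/-- Two slices differ by a holomorphic torus-valued function `τ`. Differentiating `param' = τ •
param` gives the old derivative moved by `τ`, up to Euler vectors. The latter drop out of the form,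
and the character of `τ` is exactly the discrepancy between the two normalisations. -/
theorem pullback_eq (hZ : ∀ t, ∀ z ∈ Z, torusAct Q t z ∈ Z) {c c' : SliceChart d Q Z} {z : Z}
    (hz : z.1 ∈ c.dom) (hz' : z.1 ∈ c'.dom) :
    η.pullback c z = η.pullback c' z := by
  ext v
  have hx := SliceChart.mkPt_mem_source_iff.2 hz
  have hx' := SliceChart.mkPt_mem_source_iff.2 hz'
  have hch : c.chart (mkPt Q z) = c.coord z.1 := SliceChart.chart_mkPt hz
  set u := c.coord z.1 with hu
  have hut : u ∈ c.target := c.coord_mem _ hz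
  have hpu : c.param u = torusAct Q (c.norm z.1) z.1 := c.param_coord _ z.2 hz
  have hpu' : c.param u ∈ c'.dom := by rw [hpu]; exact c'.act_mem_dom _ _ hz'
  have hcu' : c'.coord (c.param u) = c'.coord z.1 := by rw [hpu, c'.coord_act _ _ hz']
  set τ := c'.norm (c.param u) with hτ
  have hτ2 : τ = c'.norm z.1 * (c.norm z.1)⁻¹ := by rw [hτ, hpu, c'.norm_act _ _ hz']
  have hev : ∀ᶠ w in 𝓝 u, c'.param (c'.coord (c.param w)) =
      torusAct Q (c'.norm (c.param w)) (c.param w) := by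
    have hc := (SliceChart.differentiableAt_param hut).continuousAt
    filter_upwards [hc.preimage_mem_nhds (c'.isOpen_dom.mem_nhds hpu'),
      c.isOpen_target.mem_nhds hut] with w hw hw'
    exact c'.param_coord _ (c.param_mem _ hw') hw
  have hpt : c'.param (c'.coord z.1) = torusAct Q τ (c.param u) := by
    rw [← hcu']; exact hev.self_of_nhds
  have hder : ∀ w : Fin d → ℂ, ∃ a : Fin r → ℂ,
      fderiv ℂ c'.param (c'.coord z.1) (fderiv ℂ (fun u => c'.coord (c.param u)) u w) =
        torusAct Q τ (fderiv ℂ c.param u w + ∑ k, a k • eulerVec Q k (c.param u)) := by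
    intro w
    have hline : HasDerivAt (fun ε : ℂ => u + ε • w) w 0 := by
      simpa using ((hasDerivAt_id (0 : ℂ)).smul_const w).const_add u
    have hu0 : u + (0 : ℂ) • w = u := by simp
    have hp : HasFDerivAt c.param (fderiv ℂ c.param u) (u + (0 : ℂ) • w) := by
      rw [hu0]; exact (SliceChart.differentiableAt_param hut).hasFDerivAt
    have h1 : HasDerivAt (fun ε : ℂ => c.param (u + ε • w)) (fderiv ℂ c.param u w) 0 :=
      hp.comp_hasDerivAt (0 : ℂ) hline
    have hn : ∀ k, DifferentiableAt ℂ (fun ε : ℂ => (c'.norm (c.param (u + ε • w)) k : ℂ)) 0 := by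
      intro k
      have := (c'.contDiffOn_norm k).contDiffAt (c'.isOpen_dom.mem_nhds hpu')
      have h2 : DifferentiableAt ℂ (fun z => (c'.norm z k : ℂ)) (c.param (u + (0 : ℂ) • w)) := by
        rw [hu0]; exact this.differentiableAt (by simp)
      exact DifferentiableAt.comp (g := fun z => (c'.norm z k : ℂ)) (0 : ℂ) h2 h1.differentiableAt
    have h3 := hasDerivAt_torusAct Q (fun k => (hn k).hasDerivAt) h1
    have hcd : HasFDerivAt (fun u => c'.coord (c.param u))
        (fderiv ℂ (fun u => c'.coord (c.param u)) u) (u + (0 : ℂ) • w) := by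
      rw [hu0]
      refine DifferentiableAt.hasFDerivAt ?_
      exact ((c'.contDiffOn_coord.contDiffAt (c'.isOpen_dom.mem_nhds hpu')).differentiableAt
        (by simp)).comp _ (SliceChart.differentiableAt_param hut)
    have h4 := hcd.comp_hasDerivAt (0 : ℂ) hline
    have hp' : HasFDerivAt c'.param (fderiv ℂ c'.param (c'.coord z.1))
        ((fun u => c'.coord (c.param u)) (u + (0 : ℂ) • w)) := by
      simp only [hu0, hcu']
      exact (SliceChart.differentiableAt_param (c'.coord_mem _ hz')).hasFDerivAt
    have h5 := hp'.comp_hasDerivAt (0 : ℂ) h4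
    have hev2 : (fun ε : ℂ => torusAct Q (c'.norm (c.param (u + ε • w))) (c.param (u + ε • w)))
        =ᶠ[𝓝 0] (c'.param ∘ (fun u => c'.coord (c.param u)) ∘ fun ε : ℂ => u + ε • w) := by
      have hc : Filter.Tendsto (fun ε : ℂ => u + ε • w) (𝓝 0) (𝓝 u) := by
        simpa using hline.continuousAt.tendsto
      filter_upwards [hc.eventually hev] with ε hε using hε.symm
    have h6 := (h5.congr_of_eventuallyEq hev2).unique h3
    rw [hu0] at h6
    exact ⟨_, h6⟩
  choose a ha using hder
  rw [pullback_apply, pullback_apply, SliceChart.dchart_eq_comp hx hx', hch]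
  simp only [ContinuousLinearMap.comp_apply, ha]
  have hT : ∀ w, fderiv ℂ c.param u w ∈ η.tangent (c.param u) :=
    η.fderiv_mem (SliceChart.differentiableAt_param hut)
      (Filter.mem_of_superset (c.isOpen_target.mem_nhds hut) fun v hv => c.param_mem v hv)
  rw [hpt, η.form_act _ _ (c.param_mem u hut) _ fun i => add_mem (hT _) (sum_mem fun k _ =>
    Submodule.smul_mem _ _ (η.eulerVec_mem hZ k (c.param_mem u hut))),
    η.form_add_euler _ (c.param_mem u hut) _ _ fun i => hT _, ← mul_assoc, ← torusChar_mul]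
  congr 2
  rw [hτ2, inv_mul_cancel_left]

/-- The form on the quotient. -/
def descend (𝒜 : SliceAtlas d Q Z) (z : Z) : (Fin d → ℂ) [⋀^Fin d]→ₗ[ℂ] ℂ :=
  η.pullback (𝒜.sliceAt z) z

variable {𝒜 : SliceAtlas d Q Z}

/-- The derivative of the inverse chart supplies tangent vectors whose images under `dchart` are the
coordinate vectors, so it suffices to test the form on the coordinate frame of each slice. -/
theorem descend_ne_zero
    (hη : ∀ z, ∀ u ∈ (𝒜.sliceAt z).target, η.form ((𝒜.sliceAt z).param u)
      (fun l => fderiv ℂ (𝒜.sliceAt z).param u (Pi.single l 1)) ≠ 0) (z : Z) :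
    η.descend 𝒜 z ≠ 0 := by
  intro h0
  rw [descend] at h0
  set c := 𝒜.sliceAt z with hc
  have hz : z.1 ∈ c.dom := 𝒜.mem_sliceAt z
  have hu := c.coord_mem _ hz
  have hpt : mkPt Q (c.lift (c.coord z.1)) = mkPt Q z := by
    rw [← SliceChart.chart_mkPt hz]
    exact SliceChart.mkPt_sect (SliceChart.mkPt_mem_source_iff.2 hz)
  have h1 := DFunLike.congr_fun h0 ((fun l => mfderiv 𝓘(ℂ, Fin d → ℂ) 𝓘(ℂ, Fin d → ℂ)
    (fun u => mkPt Q (c.lift u)) (c.coord z.1) (Pi.single l (1 : ℂ) : Fin d → ℂ) :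
    Fin d → Fin d → ℂ))
  have h2 : ∀ w : Fin d → ℂ, c.dchart (mkPt Q z) (mfderiv 𝓘(ℂ, Fin d → ℂ) 𝓘(ℂ, Fin d → ℂ)
      (fun u => mkPt Q (c.lift u)) (c.coord z.1) w) = w := fun w => by
    rw [← hpt]; exact SliceChart.dchart_mfderiv_mkPt_lift hu w
  rcases mul_eq_zero.1 ((η.pullback_apply c z _).symm.trans h1) with h | h
  · exact torusChar_ne_zero _ _ h
  · refine hη z _ hu (Eq.trans ?_ h)
    exact congrArg _ (funext fun l => congrArg _ (h2 _).symm)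

theorem descend_act {z z' : Z} (t : Fin r → ℂˣ) (h : z'.1 = torusAct Q t z.1) :
    η.descend 𝒜 z' = torusChar t χ • η.descend 𝒜 z := by
  have hz := 𝒜.mem_sliceAt z
  refine Eq.trans (η.pullback_eq 𝒜.act_mem (𝒜.mem_sliceAt z') ?_) (η.pullback_act hz t h)
  rw [h]
  exact (𝒜.sliceAt z).act_mem_dom _ _ hz

theorem continuous_descend {Y : Type*} [TopologicalSpace Y] {z : Y → Z} {v : Fin d → Y → Fin d → ℂ}
    (hz : Continuous z)
    (hv : ∀ i, Continuous (fun y =>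
      (⟨mkPt Q (z y), v i y⟩ : TangentBundle 𝓘(ℂ, Fin d → ℂ) (TorusQuotient Q Z)))) :
    Continuous (fun y => η.descend 𝒜 (z y) (fun i => v i y)) := by
  rw [continuous_iff_continuousAt]
  intro y₀
  -- `descend` uses a slice that may jump from point to point. Near `y₀` all values are computed in
  -- the one slice chosen at `y₀`, which `pullback_eq` permits.
  set c := 𝒜.sliceAt (z y₀) with hc
  have hz0 : (z y₀).1 ∈ c.dom := 𝒜.mem_sliceAt (z y₀)
  have hzc : Continuous fun y => (z y).1 := continuous_subtype_val.comp hz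
  have hN : (fun y => (z y).1) ⁻¹' c.dom ∈ 𝓝 y₀ := (c.isOpen_dom.preimage hzc).mem_nhds hz0
  have hcont : ContinuousAt (fun y => η.pullback c (z y) (fun i => v i y)) y₀ := by
    simp only [pullback_apply]
    have hcoord : ContinuousAt (fun y => c.coord (z y).1) y₀ :=
      (c.contDiffOn_coord.continuousOn.continuousAt (c.isOpen_dom.mem_nhds hz0)).comp
        (f := fun y => (z y).1) hzc.continuousAt
    have htar := c.isOpen_target.mem_nhds (c.coord_mem _ hz0)
    have hnorm : ContinuousAt (fun y => torusChar (c.norm (z y).1)⁻¹ χ) y₀ := by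
      have : (fun y => torusChar (c.norm (z y).1)⁻¹ χ) =
          fun y => ∏ k, ((c.norm (z y).1 k : ℂ) ^ χ k)⁻¹ := by
        funext y; simp [torusChar]
      rw [this]
      refine tendsto_finsetProd _ fun k _ => ?_
      refine ContinuousAt.inv₀ (ContinuousAt.zpow₀ ?_ _ (Or.inl (Units.ne_zero _)))
        (zpow_ne_zero _ (Units.ne_zero _))
      exact ((c.contDiffOn_norm k).continuousOn.continuousAt (c.isOpen_dom.mem_nhds hz0)).comp
        (f := fun y => (z y).1) hzc.continuousAt
    refine hnorm.mul ?_
    have hparam : ContinuousAt (fun y => c.param (c.coord (z y).1)) y₀ :=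
      (c.contDiffOn_param.continuousOn.continuousAt htar).comp
        (f := fun y => c.coord (z y).1) hcoord
    have hder : ContinuousAt (fun y => fderiv ℂ c.param (c.coord (z y).1)) y₀ :=
      ((c.contDiffOn_param.continuousOn_fderiv_of_isOpen c.isOpen_target
        (by simp)).continuousAt htar).comp (f := fun y => c.coord (z y).1) hcoord
    have hvec : ∀ i, ContinuousAt (fun y => c.dchart (mkPt Q (z y)) (v i y)) y₀ := fun i =>
      (SliceChart.continuousOn_dchart (hv i)).continuousAt
        ((SliceChart.isOpen_source.preimage (continuous_mkPt.comp hz)).mem_nhds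
          (SliceChart.mkPt_mem_source_iff.2 hz0))
    have hpair : ContinuousAt (fun y => ((c.param (c.coord (z y).1),
        fun i => fderiv ℂ c.param (c.coord (z y).1) (c.dchart (mkPt Q (z y)) (v i y))) :
        (Fin n → ℂ) × (Fin d → Fin n → ℂ))) y₀ :=
      hparam.prodMk (continuousAt_pi.2 fun i => hder.clm_apply (hvec i))
    have hform := η.continuousOn_form (c.param (c.coord (z y₀).1), fun i =>
      fderiv ℂ c.param (c.coord (z y₀).1) (c.dchart (mkPt Q (z y₀)) (v i y₀)))
      ⟨c.param_mem _ (c.coord_mem _ hz0), trivial⟩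
    refine hform.tendsto.comp (tendsto_nhdsWithin_iff.2 ⟨hpair, ?_⟩)
    filter_upwards [hN] with y hy
    exact ⟨c.param_mem _ (c.coord_mem _ hy), trivial⟩
  refine hcont.congr ?_
  filter_upwards [hN] with y hy
  rw [descend, η.pullback_eq 𝒜.act_mem (𝒜.mem_sliceAt (z y)) hy]

/-- A nondegenerate equivariant form identifies the first Chern class. -/
theorem firstChernClassEq
    (hη : ∀ z, ∀ u ∈ (𝒜.sliceAt z).target, η.form ((𝒜.sliceAt z).param u)
      (fun l => fderiv ℂ (𝒜.sliceAt z).param u (Pi.single l 1)) ≠ 0) :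
    FirstChernClassEq d Q Z χ :=
  ⟨fun _ z => η.descend 𝒜 z.1, fun _ z => η.descend_ne_zero hη z.1,
    fun _ _ _ t h => η.descend_act t (funext h), fun _ _ _ _ hz hv => η.continuous_descend hz hv⟩

end SliceForm

/-! ### Projective space -/

theorem fderiv_apply_eq_of_eventually_const {m n : ℕ} {f : (Fin m → ℂ) → Fin n → ℂ} {u : Fin m → ℂ}
    (hf : DifferentiableAt ℂ f u) {k : Fin n} {a : ℂ} (h : ∀ᶠ v in 𝓝 u, f v k = a)
    (w : Fin m → ℂ) : fderiv ℂ f u w k = 0 := by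
  have h1 := (hasFDerivAt_pi'.1 hf.hasFDerivAt k).congr_of_eventuallyEq
    (f₁ := fun _ => a) (h.mono fun _ hv => hv.symm)
  have h2 := h1.unique (hasFDerivAt_const a u)
  exact congrArg (fun L : (Fin m → ℂ) →L[ℂ] ℂ => L w) h2

theorem fderiv_apply_eq_of_eventually_coord {m n : ℕ} {f : (Fin m → ℂ) → Fin n → ℂ} {u : Fin m → ℂ}
    (hf : DifferentiableAt ℂ f u) {k : Fin n} {l : Fin m} (h : ∀ᶠ v in 𝓝 u, f v k = v l)
    (w : Fin m → ℂ) : fderiv ℂ f u w k = w l := by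
  have h1 := (hasFDerivAt_pi'.1 hf.hasFDerivAt k).congr_of_eventuallyEq
    (f₁ := fun v => v l) (h.mono fun _ hv => hv.symm)
  have h2 := h1.unique (hasFDerivAt_apply l u)
  exact congrArg (fun L : (Fin m → ℂ) →L[ℂ] ℂ => L w) h2

theorem torusChar_fin_one (t : Fin 1 → ℂˣ) (q : Fin 1 → ℤ) : torusChar t q = (t 0 : ℂ) ^ q 0 := by
  simp [torusChar]

theorem torusAct_weightP3 (t : Fin 1 → ℂˣ) (z : Fin 4 → ℂ) (i : Fin 4) :
    torusAct weightP3 t z i = (t 0 : ℂ) * z i := by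
  simp [torusAct, torusChar_fin_one, weightP3]

theorem exists_ne_zero_of_mem_coneP3 {z : Fin 4 → ℂ} (hz : z ∈ coneP3) : ∃ i, z i ≠ 0 :=
  Function.ne_iff.1 hz

theorem torusAct_mem_coneP3 (t : Fin 1 → ℂˣ) (z : Fin 4 → ℂ) (hz : z ∈ coneP3) :
    torusAct weightP3 t z ∈ coneP3 := by
  obtain ⟨i, hi⟩ := exists_ne_zero_of_mem_coneP3 hz
  refine Function.ne_iff.2 ⟨i, ?_⟩
  rw [torusAct_weightP3]
  exact mul_ne_zero (t 0).ne_zero hi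

theorem contDiff_insertNth_one (i : Fin 4) :
    ContDiff ℂ ω (fun u : Fin 3 → ℂ => (i.insertNth 1 u : Fin 4 → ℂ)) := by
  rw [contDiff_pi]
  intro k
  rcases Fin.eq_self_or_eq_succAbove i k with rfl | ⟨l, rfl⟩
  · simpa using contDiff_const
  · simpa using contDiff_apply ℂ ℂ l

theorem insertNth_one_mem_coneP3 (i : Fin 4) (u : Fin 3 → ℂ) :
    (i.insertNth 1 u : Fin 4 → ℂ) ∈ coneP3 :=
  Function.ne_iff.2 ⟨i, by simp⟩

/-- The inverse of the unit given by a complex number, or `1` at zero. -/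
def invUnit (x : ℂ) : ℂˣ := if h : x = 0 then 1 else (Units.mk0 x h)⁻¹

theorem invUnit_val {x : ℂ} (h : x ≠ 0) : (invUnit x : ℂ) = x⁻¹ := by simp [invUnit, h]

/-- The affine chart `x i ≠ 0` of `ℙ³`. -/
def affineSlice (i : Fin 4) : SliceChart 3 weightP3 coneP3 where
  dom := {z | z i ≠ 0}
  target := Set.univ
  param u := i.insertNth 1 u
  coord z j := z (i.succAbove j) / z i
  norm z _ := invUnit (z i)
  base := ⟨i.insertNth 1 0, insertNth_one_mem_coneP3 i 0⟩
  isOpen_dom := isOpen_ne_fun (continuous_apply i) continuous_const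
  isOpen_target := isOpen_univ
  contDiffOn_param := (contDiff_insertNth_one i).contDiffOn
  contDiffOn_coord := contDiffOn_pi.2 fun j =>
    (contDiff_apply ℂ ℂ (i.succAbove j)).contDiffOn.div (contDiff_apply ℂ ℂ i).contDiffOn
      fun _ hz => hz
  contDiffOn_norm _ := ((contDiff_apply ℂ ℂ i).contDiffOn.inv fun _ hz => hz).congr
    fun _ hz => invUnit_val hz
  param_mem u _ := insertNth_one_mem_coneP3 i u
  param_mem_dom u _ := by simp
  coord_mem _ _ := trivial
  coord_param u _ := by simp
  act_mem_dom t z hz := by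
    change torusAct weightP3 t z i ≠ 0
    rw [torusAct_weightP3]; exact mul_ne_zero (t 0).ne_zero hz
  coord_act t z hz := by
    ext j
    rw [torusAct_weightP3, torusAct_weightP3, mul_div_mul_left _ _ (t 0).ne_zero]
  norm_act t z hz := by
    ext k
    have hz' : torusAct weightP3 t z i ≠ 0 := by
      rw [torusAct_weightP3]; exact mul_ne_zero (t 0).ne_zero hz
    rw [invUnit_val hz', torusAct_weightP3, Pi.mul_apply, Units.val_mul, invUnit_val hz,
      Subsingleton.elim k 0, Pi.inv_apply, Units.val_inv_eq_inv_val, mul_inv, mul_comm]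
  param_coord z _ hz := by
    ext k
    rw [torusAct_weightP3, invUnit_val hz]
    rcases Fin.eq_self_or_eq_succAbove i k with rfl | ⟨l, rfl⟩
    · simpa using (inv_mul_cancel₀ hz).symm
    · simp [div_eq_inv_mul]

theorem affineSlice_sect_val {i : Fin 4} {x : P3} (hx : x ∈ (affineSlice i).source) (j : Fin 4) :
    ((affineSlice i).sect x).1 j = x.out.1 j / x.out.1 i := by
  have h := SliceChart.sect_mkPt (c := affineSlice i) (z := x.out) hx
  rw [mkPt_out] at h
  rw [h, torusAct_weightP3]
  change ((invUnit (x.out.1 i) : ℂˣ) : ℂ) * _ = _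
  rw [invUnit_val hx, div_eq_inv_mul]

/-- The atlas of `ℙ³` by affine charts. -/
def sliceAtlasP3 : SliceAtlas 3 weightP3 coneP3 where
  act_mem := torusAct_mem_coneP3
  sliceAt z := affineSlice (exists_ne_zero_of_mem_coneP3 z.2).choose
  mem_sliceAt z := (exists_ne_zero_of_mem_coneP3 z.2).choose_spec

/-- Proportionality is the vanishing of all `2 × 2` minors; in this form the orbit relation is
visibly closed. -/
theorem mkPt_P3_eq_iff {z z' : coneP3} :
    mkPt weightP3 z = mkPt weightP3 z' ↔ ∀ i j, z.1 i * z'.1 j = z.1 j * z'.1 i := by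
  rw [mkPt_eq_mkPt_iff]
  constructor
  · rintro ⟨t, ht⟩ i j
    rw [ht, torusAct_weightP3, torusAct_weightP3]; ring
  · intro h
    obtain ⟨i, hi⟩ := exists_ne_zero_of_mem_coneP3 z.2
    have hi' : z'.1 i ≠ 0 := by
      intro h0
      obtain ⟨j, hj⟩ := exists_ne_zero_of_mem_coneP3 z'.2
      have := h i j
      rw [h0, mul_zero] at this
      exact mul_ne_zero hi hj this
    refine ⟨fun _ => Units.mk0 (z'.1 i / z.1 i) (div_ne_zero hi' hi), ?_⟩
    ext j
    rw [torusAct_weightP3, Units.val_mk0]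
    field_simp
    rw [mul_comm, h i j, mul_comm]

/-! ### Separation and compactness of `ℙ³` -/

theorem t2Space_P3 : T2Space P3 := by
  rw [t2Space_iff_of_isOpenQuotientMap (isOpenQuotientMap_mkPt torusAct_mem_coneP3)]
  simp only [mkPt_P3_eq_iff, Set.ofPred_forall]
  refine isClosed_iInter fun i => isClosed_iInter fun j => ?_
  have h : ∀ i : Fin 4, Continuous fun z : coneP3 => z.1 i := fun i =>
    (continuous_apply i).comp continuous_subtype_val
  exact isClosed_eq (((h i).comp continuous_fst).mul ((h j).comp continuous_snd))
    (((h j).comp continuous_fst).mul ((h i).comp continuous_snd))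

theorem compactSpace_P3 : CompactSpace P3 := by
  let f : Metric.sphere (0 : Fin 4 → ℂ) 1 → P3 := fun x =>
    mkPt weightP3 ⟨x.1, ne_zero_of_mem_unit_sphere x⟩
  have hf : Continuous f := continuous_mkPt.comp (continuous_subtype_val.subtype_mk _)
  have hs : Function.Surjective f := by
    intro p
    induction p using Quotient.inductionOn with
    | h z =>
      have hz : ‖z.1‖ ≠ 0 := norm_ne_zero_iff.2 z.2
      refine ⟨⟨((‖z.1‖⁻¹ : ℝ) : ℂ) • z.1, by simp [norm_smul, hz]⟩, ?_⟩
      refine (mkPt_eq_mkPt_iff.2 ⟨fun _ => Units.mk0 ((‖z.1‖⁻¹ : ℝ) : ℂ) (by simpa using hz), ?_⟩).symm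
      ext i
      rw [torusAct_weightP3]; simp
  have : CompactSpace (Metric.sphere (0 : Fin 4 → ℂ) 1) :=
    isCompact_iff_compactSpace.1 (isCompact_sphere _ _)
  exact ⟨by rw [← hs.range_eq]; exact isCompact_range hf⟩

/-! ### The equivariant form of weight `4` on `ℙ³` -/

/-- The form `det(z, V₀, V₁, V₂)` on `ℂ⁴`. -/
def contractedDet (z : Fin 4 → ℂ) : (Fin 4 → ℂ) [⋀^Fin 3]→ₗ[ℂ] ℂ :=
  (Matrix.detRowAlternating (n := Fin 4) (R := ℂ)).curryLeft z

theorem contractedDet_apply (z : Fin 4 → ℂ) (V : Fin 3 → Fin 4 → ℂ) :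
    contractedDet z V = (Matrix.of (Matrix.vecCons z V)).det := by
  rw [contractedDet, AlternatingMap.curryLeft_apply_apply]
  rfl

theorem continuous_contractedDet :
    Continuous fun p : (Fin 4 → ℂ) × (Fin 3 → Fin 4 → ℂ) => contractedDet p.1 p.2 := by
  simp only [contractedDet_apply]
  refine Continuous.matrix_det (continuous_pi fun i => continuous_pi fun j => ?_)
  refine Fin.cases ?_ (fun i => ?_) i
  · exact (continuous_apply j).comp continuous_fst
  · exact (continuous_apply j).comp ((continuous_apply i).comp continuous_snd)

theorem contractedDet_act (t : Fin 1 → ℂˣ) (z : Fin 4 → ℂ) (V : Fin 3 → Fin 4 → ℂ) :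
    contractedDet (torusAct weightP3 t z) (fun i => torusAct weightP3 t (V i)) =
      torusChar t ![4] * contractedDet z V := by
  have h : torusChar t ![4] = ∏ _i : Fin 4, (t 0 : ℂ) := by
    rw [torusChar_fin_one]; simp
  rw [contractedDet_apply, contractedDet_apply, h, ← Matrix.det_mul_row]
  congr 1
  ext i j
  refine Fin.cases ?_ (fun i => ?_) i
  · exact torusAct_weightP3 t z j
  · exact torusAct_weightP3 t (V i) j

/-- All weights are `1`, so the Euler vector is `z` itself, the first row of the determinant. -/
theorem contractedDet_add_euler (z : Fin 4 → ℂ) (V : Fin 3 → Fin 4 → ℂ) (a : Fin 3 → Fin 1 → ℂ) :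
    contractedDet z (fun i => V i + ∑ k, a i k • eulerVec weightP3 k z) = contractedDet z V := by
  rw [contractedDet_apply, contractedDet_apply]
  refine Matrix.det_eq_of_forall_row_eq_smul_add_const (Fin.cons 0 fun i => a i 0) 0 rfl ?_
  intro i j
  refine Fin.cases ?_ (fun i => ?_) i
  · simp
  · simp [eulerVec, weightP3]

/-- The form `det(z, V₀, V₁, V₂)` on `ℂ⁴ ∖ {0}`, of weight `4`. -/
def formP3 : SliceForm 3 weightP3 coneP3 ![4] where
  tangent _ := ⊤
  form := contractedDet
  hasDerivAt_mem _ _ _ _ _ := trivial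
  continuousOn_form := continuous_contractedDet.continuousOn
  form_act t z _ V _ := contractedDet_act t z V
  form_add_euler z _ V a _ := contractedDet_add_euler z V a

theorem affineSlice_param_same (i : Fin 4) (u : Fin 3 → ℂ) : (affineSlice i).param u i = 1 :=
  Fin.insertNth_apply_same (α := fun _ => ℂ) i 1 u

theorem affineSlice_param_succAbove (i : Fin 4) (u : Fin 3 → ℂ) (l : Fin 3) :
    (affineSlice i).param u (i.succAbove l) = u l :=
  Fin.insertNth_apply_succAbove (α := fun _ => ℂ) i 1 u l

/-- A vanishing determinant gives a relation among the rows. Its component `i`, where the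
parametrisation is constantly `1`, kills the coefficient of `z`; the other components form an
identity matrix and kill the rest. -/
theorem formP3_ne_zero (i : Fin 4) (u : Fin 3 → ℂ) :
    formP3.form ((affineSlice i).param u)
      (fun l => fderiv ℂ (affineSlice i).param u (Pi.single l 1)) ≠ 0 := by
  intro h0
  have hd : DifferentiableAt ℂ (affineSlice i).param u :=
    SliceChart.differentiableAt_param (c := affineSlice i) trivial
  obtain ⟨v, hv, hv0⟩ := Matrix.exists_vecMul_eq_zero_iff.2
    ((contractedDet_apply _ _).symm.trans h0)
  have hcol : ∀ k, v 0 * (affineSlice i).param u k +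
      ∑ l : Fin 3, v l.succ * fderiv ℂ (affineSlice i).param u (Pi.single l 1) k = 0 := by
    intro k
    have := congrFun hv0 k
    simpa [Matrix.vecMul, dotProduct, Fin.sum_univ_succ] using this
  have hi : ∀ w, fderiv ℂ (affineSlice i).param u w i = 0 := fun w =>
    fderiv_apply_eq_of_eventually_const hd (a := 1)
      (Filter.Eventually.of_forall fun u => affineSlice_param_same i u) w
  have hj : ∀ (l : Fin 3) w, fderiv ℂ (affineSlice i).param u w (i.succAbove l) = w l :=
    fun l w => fderiv_apply_eq_of_eventually_coord hd
      (Filter.Eventually.of_forall fun u => affineSlice_param_succAbove i u l) w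
  have h1 : v 0 = 0 := by
    have := hcol i
    simp only [hi, mul_zero, Finset.sum_const_zero, add_zero] at this
    simpa [affineSlice_param_same] using this
  have h2 : ∀ l : Fin 3, v l.succ = 0 := by
    intro l
    have := hcol (i.succAbove l)
    simpa [hj, h1, Pi.single_apply] using this
  exact hv (funext fun k => Fin.cases h1 h2 k)

/-! ### A square root of the canonical bundle of `ℙ³` -/

/-- The line bundle `𝒪(-2)` on `ℙ³`. -/
def tautCore : VectorBundleCore ℂ P3 ℂ (Fin 4) where
  baseSet i := (affineSlice i).source
  isOpen_baseSet _ := SliceChart.isOpen_source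
  indexAt x := (exists_ne_zero_of_mem_coneP3 x.out.2).choose
  mem_baseSet_at x := (exists_ne_zero_of_mem_coneP3 x.out.2).choose_spec
  -- The exponent `2` is half the weight `4` of the form, so that two fibre coordinates together
  -- compensate its change.
  coordChange i j x := (x.out.1 j / x.out.1 i) ^ 2 • ContinuousLinearMap.id ℂ ℂ
  coordChange_self i x hx v := by
    have hx : x.out.1 i ≠ 0 := hx
    simp [div_self hx]
  continuousOn_coordChange i j := by
    refine ContinuousOn.smul (f := fun x : P3 => (x.out.1 j / x.out.1 i) ^ 2)
      (ContinuousOn.pow ?_ 2) continuousOn_const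
    have h : ContinuousOn (fun x => (affineSlice i).param ((affineSlice i).chart x))
        (affineSlice i).source :=
      (affineSlice i).contDiffOn_param.continuousOn.comp SliceChart.continuousOn_chart
        fun _ hx => SliceChart.chart_mem_target hx
    refine (((continuous_apply j).comp_continuousOn h).mono Set.inter_subset_left).congr ?_
    intro x hx
    change x.out.1 j / x.out.1 i = (affineSlice i).param ((affineSlice i).chart x) j
    rw [← affineSlice_sect_val hx.1, SliceChart.sect_val hx.1]
  coordChange_comp i j k x hx v := by
    have hi : x.out.1 i ≠ 0 := hx.1.1
    have hj : x.out.1 j ≠ 0 := hx.1.2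
    simp only [smul_apply, ContinuousLinearMap.id_apply, smul_eq_mul]
    field_simp

/-- The line bundle `𝒪(-2)` on `ℙ³` as a bundled object. -/
def tautBundle : ComplexLineBundle P3 where
  fiber := tautCore.Fiber

theorem tangentBundle_mk_congr {d : ℕ} {M : Type} [TopologicalSpace M] [ChartedSpace (Fin d → ℂ) M]
    [IsManifold 𝓘(ℂ, Fin d → ℂ) ω M] {x x' : M} (h : x = x') (v : Fin d → ℂ) :
    (⟨x, v⟩ : TangentBundle 𝓘(ℂ, Fin d → ℂ) M) = ⟨x', v⟩ := by
  subst h; rfl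

section Spin

variable [ChartedSpace (Fin 3 → ℂ) P3] [IsQuotientManifold 3 weightP3 coneP3]

/-- The pairing `𝒪(-2) × 𝒪(-2) → K`. -/
def tautPairing (x : P3) : ℂ →ₗ[ℂ] ℂ →ₗ[ℂ] ((Fin 3 → ℂ) [⋀^Fin 3]→ₗ[ℂ] ℂ) :=
  LinearMap.mk₂ ℂ (fun l l' => (l * l') •
      formP3.descend sliceAtlasP3 ((affineSlice (tautCore.indexAt x)).sect x))
    (fun _ _ _ => by rw [add_mul, add_smul]) (fun _ _ _ => by rw [smul_smul, smul_eq_mul, mul_assoc])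
    (fun _ _ _ => by rw [mul_add, add_smul])
    (fun _ _ _ => by rw [smul_smul, smul_eq_mul, mul_left_comm])

/-- The pairing is defined in the preferred frame at `x`, which may jump. Passing to a fixed frame
`i` changes the form by the fourth power of a ratio of coordinates and each fibre coordinate by its
square, so the formula is the same in all frames; continuity is then local. -/
theorem tautPairing_eq {x : P3} {i : Fin 4} (hx : x ∈ (affineSlice i).source) (l l' : ℂ) :
    tautPairing x l l' = (tautCore.coordChange (tautCore.indexAt x) i x l *
      tautCore.coordChange (tautCore.indexAt x) i x l') •
        formP3.descend sliceAtlasP3 ((affineSlice i).sect x) := by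
  set j := tautCore.indexAt x with hj
  have hxj : x ∈ (affineSlice j).source := tautCore.mem_baseSet_at x
  have hi0 : x.out.1 i ≠ 0 := hx
  have hj0 : x.out.1 j ≠ 0 := hxj
  have h1 : ((affineSlice j).sect x).1 = torusAct weightP3
      (fun _ => Units.mk0 (x.out.1 i / x.out.1 j) (div_ne_zero hi0 hj0))
      ((affineSlice i).sect x).1 := by
    ext k
    rw [torusAct_weightP3, affineSlice_sect_val hx, affineSlice_sect_val hxj, Units.val_mk0]
    field_simp
  change (l * l') • formP3.descend sliceAtlasP3 ((affineSlice j).sect x) = _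
  rw [formP3.descend_act _ h1, smul_smul]
  congr 1
  rw [torusChar_fin_one, Units.val_mk0]
  change _ = ((x.out.1 i / x.out.1 j) ^ 2 * l) * ((x.out.1 i / x.out.1 j) ^ 2 * l')
  have h4 : (x.out.1 i / x.out.1 j) ^ (![4] : Fin 1 → ℤ) 0 = (x.out.1 i / x.out.1 j) ^ 4 := rfl
  rw [h4]
  ring

theorem continuous_tautPairing {Y : Type} [TopologicalSpace Y] {p : Y → P3}
    {l l' : ∀ y, tautCore.Fiber (p y)} {v : Fin 3 → Y → Fin 3 → ℂ}
    (hl : Continuous (fun y => (⟨p y, l y⟩ : Bundle.TotalSpace ℂ tautCore.Fiber)))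
    (hl' : Continuous (fun y => (⟨p y, l' y⟩ : Bundle.TotalSpace ℂ tautCore.Fiber)))
    (hv : ∀ i, Continuous (fun y => (⟨p y, v i y⟩ : TangentBundle 𝓘(ℂ, Fin 3 → ℂ) P3))) :
    Continuous (fun y => tautPairing (p y) (l y) (l' y) (fun i => v i y)) := by
  rw [continuous_iff_continuousAt]
  intro y₀
  set i := tautCore.indexAt (p y₀) with hi
  have hp : Continuous p := (FiberBundle.continuous_proj ℂ tautCore.Fiber).comp hl
  have hNo : IsOpen (p ⁻¹' (affineSlice i).source) := SliceChart.isOpen_source.preimage hp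
  have hy₀ : y₀ ∈ p ⁻¹' (affineSlice i).source := tautCore.mem_baseSet_at (p y₀)
  have hco : ∀ {l : ∀ y, tautCore.Fiber (p y)},
      Continuous (fun y => (⟨p y, l y⟩ : Bundle.TotalSpace ℂ tautCore.Fiber)) →
      ContinuousOn (fun y => tautCore.coordChange (tautCore.indexAt (p y)) i (p y) (l y))
        (p ⁻¹' (affineSlice i).source) := by
    intro l hl
    have h1 := (tautCore.localTriv i).continuousOn.comp (s := p ⁻¹' (affineSlice i).source)
      hl.continuousOn (fun y hy => (tautCore.mem_localTriv_source i _).2 hy)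
    exact continuous_snd.comp_continuousOn h1
  have hform : ContinuousOn (fun y => formP3.descend sliceAtlasP3 ((affineSlice i).sect (p y))
      (fun k => v k y)) (p ⁻¹' (affineSlice i).source) := by
    rw [continuousOn_iff_continuous_domRestrict]
    have hsect : Continuous fun y : p ⁻¹' (affineSlice i).source =>
        (affineSlice i).sect (p y.1) :=
      (SliceChart.continuousOn_sect (c := affineSlice i)).comp_continuous
        (hp.comp continuous_subtype_val) (fun y => y.2)
    have hvec : ∀ k, Continuous fun y : p ⁻¹' (affineSlice i).source =>
        (⟨mkPt weightP3 ((affineSlice i).sect (p y.1)), v k y.1⟩ :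
          TangentBundle 𝓘(ℂ, Fin 3 → ℂ) P3) := by
      intro k
      refine ((hv k).comp continuous_subtype_val).congr fun y => ?_
      exact tangentBundle_mk_congr (SliceChart.mkPt_sect y.2).symm _
    exact formP3.continuous_descend (𝒜 := sliceAtlasP3)
      (z := fun y : p ⁻¹' (affineSlice i).source => (affineSlice i).sect (p y.1))
      (v := fun k y => v k y.1) hsect hvec
  refine ContinuousAt.congr ((((hco hl).mul (hco hl')).mul hform).continuousAt
    (hNo.mem_nhds hy₀)) ?_
  filter_upwards [hNo.mem_nhds hy₀] with y hy
  exact (DFunLike.congr_fun (tautPairing_eq hy (l y) (l' y)) (fun k => v k y)).symm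

theorem isSpin_P3 : IsSpin 3 P3 := by
  refine ⟨tautBundle, tautPairing, fun x l hl => ?_, fun Y _ p l l' v hl hl' hv =>
    continuous_tautPairing hl hl' hv⟩
  have hl0 : (show ℂ from l) ≠ 0 := hl
  exact smul_ne_zero (mul_ne_zero hl0 hl0)
    (formP3.descend_ne_zero (𝒜 := sliceAtlasP3) (fun z u _ => formP3_ne_zero _ u) _)

end Spin

/-! ### Polynomial functions -/

theorem contDiff_eval {m : ℕ} (p : MvPolynomial (Fin m) ℂ) :
    ContDiff ℂ ω (fun x : Fin m → ℂ => MvPolynomial.eval x p) := by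
  induction p using MvPolynomial.induction_on with
  | C a => simpa using contDiff_const
  | add p q hp hq => simpa using hp.add hq
  | mul_X p i hp => simpa using hp.mul (contDiff_apply ℂ ℂ i)

theorem hasDerivAt_eval {m : ℕ} (p : MvPolynomial (Fin m) ℂ) {γ : ℂ → Fin m → ℂ} {v : Fin m → ℂ}
    {ε : ℂ} (hγ : HasDerivAt γ v ε) :
    HasDerivAt (fun ε => MvPolynomial.eval (γ ε) p)
      (∑ j, MvPolynomial.eval (γ ε) (MvPolynomial.pderiv j p) * v j) ε := by
  induction p using MvPolynomial.induction_on with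
  | C a => simpa using hasDerivAt_const ε a
  | add p q hp hq =>
    simp only [map_add, add_mul, Finset.sum_add_distrib]
    exact hp.add hq
  | mul_X p i hp =>
    have h := hp.mul (hasDerivAt_pi.1 hγ i)
    simp only [map_mul, MvPolynomial.eval_X]
    refine h.congr_deriv ?_
    have : ∀ j, MvPolynomial.eval (γ ε) (MvPolynomial.pderiv j (p * MvPolynomial.X i)) * v j =
        MvPolynomial.eval (γ ε) (MvPolynomial.pderiv j p) * v j * γ ε i +
          (if i = j then MvPolynomial.eval (γ ε) p * v i else 0) := by
      intro j
      rw [MvPolynomial.pderiv_mul]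
      by_cases hij : i = j
      · subst hij; simp; ring
      · simp [MvPolynomial.pderiv_X_of_ne hij, hij]; ring
    simp only [this, Finset.sum_add_distrib, Finset.sum_mul]
    simp

theorem eval_smul_of_isHomogeneous {m k : ℕ} {p : MvPolynomial (Fin m) ℂ} (hp : p.IsHomogeneous k)
    (s : ℂ) (x : Fin m → ℂ) :
    MvPolynomial.eval (fun i => s * x i) p = s ^ k * MvPolynomial.eval x p := by
  rw [MvPolynomial.eval_eq', MvPolynomial.eval_eq', Finset.mul_sum]
  refine Finset.sum_congr rfl fun e he => ?_
  have h1 : ∑ i, e i = k := by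
    have := hp (MvPolynomial.mem_support_iff.1 he)
    rw [← this, Finsupp.weight_apply, Finsupp.sum_fintype _ _ (by simp)]
    simp
  simp only [mul_pow, Finset.prod_mul_distrib, Finset.prod_pow_eq_pow_sum, h1]
  ring

/-! ### The homogeneous coordinates of the blow-up -/

/-- The homogeneous coordinates of the image in `ℙ³`. -/
def blowCoord (z : Fin 6 → ℂ) : Fin 4 → ℂ := ![z 5 * z 0, z 1, z 2, z 3]

/-- The equation of the blow-up. -/
def blowEq (a₁ : MvPolynomial (Fin 4) ℂ) (z : Fin 6 → ℂ) : ℂ :=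
  z 5 * z 4 - MvPolynomial.eval (blowCoord z) a₁

theorem torusChar_fin_two (t : Fin 2 → ℂˣ) (q : Fin 2 → ℤ) :
    torusChar t q = (t 0 : ℂ) ^ q 0 * (t 1 : ℂ) ^ q 1 := by
  simp [torusChar, Fin.prod_univ_two]

theorem fin_six_ext {f g : Fin 6 → ℂ} (h0 : f 0 = g 0) (h1 : f 1 = g 1) (h2 : f 2 = g 2)
    (h3 : f 3 = g 3) (h4 : f 4 = g 4) (h5 : f 5 = g 5) : f = g := by
  ext i
  fin_cases i <;> assumption

section Act

variable (t : Fin 2 → ℂˣ) (z : Fin 6 → ℂ)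

theorem torusAct_weightX4_zero :
    torusAct weightX4 t z 0 = (t 0 : ℂ) * (t 1 : ℂ) * z 0 := by
  simp [torusAct, torusChar_fin_two, weightX4]

theorem torusAct_weightX4_one : torusAct weightX4 t z 1 = (t 0 : ℂ) * z 1 := by
  simp [torusAct, torusChar_fin_two, weightX4]

theorem torusAct_weightX4_two : torusAct weightX4 t z 2 = (t 0 : ℂ) * z 2 := by
  simp [torusAct, torusChar_fin_two, weightX4]

theorem torusAct_weightX4_three : torusAct weightX4 t z 3 = (t 0 : ℂ) * z 3 := by
  simp [torusAct, torusChar_fin_two, weightX4]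

theorem torusAct_weightX4_four :
    torusAct weightX4 t z 4 = (t 0 : ℂ) ^ 4 * (t 1 : ℂ) * z 4 := by
  have h : ∀ x : ℂ, x ^ (4 : ℤ) = x ^ 4 := fun x => by norm_cast
  simp [torusAct, torusChar_fin_two, weightX4, h]

theorem torusAct_weightX4_five : torusAct weightX4 t z 5 = (t 1 : ℂ)⁻¹ * z 5 := by
  simp [torusAct, torusChar_fin_two, weightX4]

theorem blowCoord_act (i : Fin 4) :
    blowCoord (torusAct weightX4 t z) i = (t 0 : ℂ) * blowCoord z i := by
  have := (t 1).ne_zero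
  fin_cases i
  · simp only [blowCoord, torusAct_weightX4_zero, torusAct_weightX4_five]
    simp
    field_simp
  · exact torusAct_weightX4_one t z
  · exact torusAct_weightX4_two t z
  · exact torusAct_weightX4_three t z

variable {a₁ : MvPolynomial (Fin 4) ℂ}

theorem blowEq_act (ha₁ : a₁.IsHomogeneous 4) : blowEq a₁ (torusAct weightX4 t z) = (t 0 : ℂ) ^ 4 * blowEq a₁ z := by
  have h : blowCoord (torusAct weightX4 t z) = fun i => (t 0 : ℂ) * blowCoord z i :=
    funext (blowCoord_act t z)
  have := (t 1).ne_zero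
  rw [blowEq, h, eval_smul_of_isHomogeneous ha₁, torusAct_weightX4_four, torusAct_weightX4_five,
    blowEq]
  field_simp

end Act

theorem mem_coneX4_iff {z : Fin 6 → ℂ} :
    z ∈ coneX4 ↔ (z 0 ≠ 0 ∨ z 4 ≠ 0) ∧ (z 1 ≠ 0 ∨ z 2 ≠ 0 ∨ z 3 ≠ 0 ∨ z 5 ≠ 0) := by
  simp [coneX4, stanleyReisner]

theorem mem_coneB_iff {a₁ : MvPolynomial (Fin 4) ℂ} {z : Fin 6 → ℂ} :
    z ∈ coneB a₁ ↔ z ∈ coneX4 ∧ z 5 * z 4 = MvPolynomial.eval (blowCoord z) a₁ := Iff.rfl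

theorem blowEq_eq_zero {a₁ : MvPolynomial (Fin 4) ℂ} {z : Fin 6 → ℂ} (hz : z ∈ coneB a₁) :
    blowEq a₁ z = 0 := sub_eq_zero.2 hz.2

theorem torusAct_mem_coneX4 (t : Fin 2 → ℂˣ) {z : Fin 6 → ℂ} (hz : z ∈ coneX4) :
    torusAct weightX4 t z ∈ coneX4 := by
  intro S hS
  obtain ⟨i, hi, h⟩ := hz S hS
  exact ⟨i, hi, mul_ne_zero (torusChar_ne_zero _ _) h⟩

theorem torusAct_mem_coneB {a₁ : MvPolynomial (Fin 4) ℂ} (ha₁ : a₁.IsHomogeneous 4)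
    (t : Fin 2 → ℂˣ) (z : Fin 6 → ℂ) (hz : z ∈ coneB a₁) : torusAct weightX4 t z ∈ coneB a₁ := by
  refine ⟨torusAct_mem_coneX4 t hz.1, sub_eq_zero.1 ?_⟩
  exact (blowEq_act t z ha₁).trans (by rw [blowEq_eq_zero hz, mul_zero])

theorem contDiff_blowCoord : ContDiff ℂ ω blowCoord := by
  rw [contDiff_pi]
  intro i
  fin_cases i
  · exact (contDiff_apply ℂ ℂ (5 : Fin 6)).mul (contDiff_apply ℂ ℂ (0 : Fin 6))
  · exact contDiff_apply ℂ ℂ (1 : Fin 6)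
  · exact contDiff_apply ℂ ℂ (2 : Fin 6)
  · exact contDiff_apply ℂ ℂ (3 : Fin 6)

theorem contDiff_blowEq (a₁ : MvPolynomial (Fin 4) ℂ) : ContDiff ℂ ω (blowEq a₁) :=
  ((contDiff_apply ℂ ℂ (5 : Fin 6)).mul (contDiff_apply ℂ ℂ (4 : Fin 6))).sub
    ((contDiff_eval a₁).comp contDiff_blowCoord)

theorem exists_bound_on_unit_sphere (a₁ : MvPolynomial (Fin 4) ℂ) :
    ∃ C : ℝ, ∀ x : Fin 4 → ℂ, ‖x‖ = 1 →
    ‖MvPolynomial.eval x a₁‖ ≤ C := by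
  obtain ⟨C, hC⟩ := (isCompact_sphere (0 : Fin 4 → ℂ) 1).exists_bound_of_continuousOn
    (contDiff_eval a₁).continuous.continuousOn
  exact ⟨C, fun x hx => hC x (by simpa using hx)⟩

/-! ### Separation and compactness of the blow-up -/

section Topology

variable {a₁ : MvPolynomial (Fin 4) ℂ}

theorem blowCoord_mem (ha₁ : a₁.IsHomogeneous 4) {z : Fin 6 → ℂ} (hz : z ∈ coneB a₁) : blowCoord z ∈ coneP3 :=
  blowDown_mem ha₁ hz

/-- An orbit is determined by its image in `ℙ³` and the ratio of `a` to `x₁`. That ratio has weight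
`(3, 0)`, whence the cubes of coordinates of `ℙ³`. Both conditions are polynomial, hence closed. -/
theorem mkPt_BTilde_eq_iff (ha₁ : a₁.IsHomogeneous 4) {z z' : coneB a₁} :
    mkPt weightX4 z = mkPt weightX4 z' ↔
      (∀ i j, blowCoord z.1 i * blowCoord z'.1 j = blowCoord z.1 j * blowCoord z'.1 i) ∧
      ∀ i, z'.1 4 * z.1 0 * blowCoord z.1 i ^ 3 = z.1 4 * z'.1 0 * blowCoord z'.1 i ^ 3 := by
  rw [mkPt_eq_mkPt_iff]
  constructor
  · rintro ⟨t, ht⟩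
    refine ⟨fun i j => ?_, fun i => ?_⟩
    · rw [ht, blowCoord_act, blowCoord_act]; ring
    · rw [ht, blowCoord_act, torusAct_weightX4_four, torusAct_weightX4_zero]; ring
  · rintro ⟨h1, h2⟩
    obtain ⟨s, hs⟩ := mkPt_eq_mkPt_iff.1 (mkPt_P3_eq_iff (z := ⟨_, blowCoord_mem ha₁ z.2⟩)
      (z' := ⟨_, blowCoord_mem ha₁ z'.2⟩) |>.2 h1)
    have hs : ∀ i, blowCoord z'.1 i = (s 0 : ℂ) * blowCoord z.1 i := fun i => by
      rw [← torusAct_weightP3]; exact congrFun hs i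
    obtain ⟨i, hi⟩ := exists_ne_zero_of_mem_coneP3 (blowCoord_mem ha₁ z.2)
    have hs0 := (s 0).ne_zero
    have h3 : z'.1 4 * z.1 0 = z.1 4 * z'.1 0 * (s 0 : ℂ) ^ 3 := by
      have := h2 i
      rw [hs, mul_pow] at this
      exact mul_right_cancel₀ (pow_ne_zero 3 hi) (this.trans (by ring))
    have hz := (mem_coneX4_iff.1 z.2.1).1
    have hz' := (mem_coneX4_iff.1 z'.2.1).1
    have hw : z'.1 5 * z'.1 0 = s 0 * (z.1 5 * z.1 0) := hs 0
    have hsv : blowCoord z'.1 = fun i => (s 0 : ℂ) * blowCoord z.1 i := funext hs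
    have ha : z'.1 5 * z'.1 4 = (s 0 : ℂ) ^ 4 * (z.1 5 * z.1 4) := by
      rw [(mem_coneB_iff.1 z'.2).2, hsv, eval_smul_of_isHomogeneous ha₁, (mem_coneB_iff.1 z.2).2]
    -- The second torus component is read off from whichever of `x₁`, `a` is nonzero; the factor for
    -- `w` then follows from the known factor of `w x₁` or `w a`.
    obtain ⟨l, hl⟩ : ∃ l : ℂˣ, z'.1 0 = s 0 * l * z.1 0 ∧ z'.1 4 = (s 0 : ℂ) ^ 4 * l * z.1 4 ∧
        z'.1 5 = (l : ℂ)⁻¹ * z.1 5 := by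
      by_cases h0 : z.1 0 = 0
      · have h4 : z.1 4 ≠ 0 := hz.resolve_left (not_not.2 h0)
        have h0' : z'.1 0 = 0 := by
          rw [h0, mul_zero] at h3
          have := mul_eq_zero.1 h3.symm
          simpa [h4, hs0] using this
        have h4' : z'.1 4 ≠ 0 := hz'.resolve_left (not_not.2 h0')
        refine ⟨Units.mk0 (z'.1 4 / ((s 0 : ℂ) ^ 4 * z.1 4))
          (div_ne_zero h4' (mul_ne_zero (pow_ne_zero 4 hs0) h4)), ?_, ?_, ?_⟩
        · rw [h0, h0', mul_zero]
        · rw [Units.val_mk0]; field_simp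
        · rw [Units.val_mk0, inv_div, eq_comm, div_mul_eq_mul_div, div_eq_iff h4', ha]; ring
      · have h0' : z'.1 0 ≠ 0 := by
          intro h0'
          rw [h0', mul_zero, zero_mul, mul_eq_zero] at h3
          exact h3.elim (fun h => hz'.elim (fun h' => h' h0') fun h' => h' h) h0
        refine ⟨Units.mk0 (z'.1 0 / ((s 0 : ℂ) * z.1 0))
          (div_ne_zero h0' (mul_ne_zero hs0 h0)), ?_, ?_, ?_⟩
        · rw [Units.val_mk0]; field_simp
        · rw [Units.val_mk0]; field_simp; rw [h3]; ring
        · rw [Units.val_mk0, inv_div, eq_comm, div_mul_eq_mul_div, div_eq_iff h0', hw]; ring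
    exact ⟨![s 0, l], fin_six_ext (hl.1.trans (torusAct_weightX4_zero ![s 0, l] z.1).symm)
      ((hs 1).trans (torusAct_weightX4_one ![s 0, l] z.1).symm)
      ((hs 2).trans (torusAct_weightX4_two ![s 0, l] z.1).symm)
      ((hs 3).trans (torusAct_weightX4_three ![s 0, l] z.1).symm)
      (hl.2.1.trans (torusAct_weightX4_four ![s 0, l] z.1).symm)
      (hl.2.2.trans (torusAct_weightX4_five ![s 0, l] z.1).symm)⟩

theorem t2Space_BTilde (ha₁ : a₁.IsHomogeneous 4) : T2Space (BTilde a₁) := by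
  rw [t2Space_iff_of_isOpenQuotientMap (isOpenQuotientMap_mkPt (torusAct_mem_coneB ha₁))]
  simp only [mkPt_BTilde_eq_iff ha₁, Set.ofPred_and, Set.ofPred_forall]
  have h : ∀ i : Fin 6, Continuous fun z : coneB a₁ => z.1 i := fun i =>
    (continuous_apply i).comp continuous_subtype_val
  have hb : ∀ i : Fin 4, Continuous fun z : coneB a₁ => blowCoord z.1 i := fun i =>
    (continuous_apply i).comp (contDiff_blowCoord.continuous.comp continuous_subtype_val)
  refine IsClosed.inter (isClosed_iInter fun i => isClosed_iInter fun j => ?_)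
    (isClosed_iInter fun i => ?_)
  · exact isClosed_eq (((hb i).comp continuous_fst).mul ((hb j).comp continuous_snd))
      (((hb j).comp continuous_fst).mul ((hb i).comp continuous_snd))
  · exact isClosed_eq
      ((((h 4).comp continuous_snd).mul ((h 0).comp continuous_fst)).mul
        (((hb i).comp continuous_fst).pow 3))
      ((((h 4).comp continuous_fst).mul ((h 0).comp continuous_snd)).mul
        (((hb i).comp continuous_snd).pow 3))

/-- Each orbit meets the set where the image in `ℂ⁴` has norm `1` and the larger of `|x₁|`, `|a|` is
`1`. There `w` is bounded too: `|w x₁| ≤ 1`, and `w a` is a value of `a₁` on the unit sphere. -/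
theorem compactSpace_BTilde (ha₁ : a₁.IsHomogeneous 4) : CompactSpace (BTilde a₁) := by
  obtain ⟨C, hC⟩ := exists_bound_on_unit_sphere a₁
  let K : Set (Fin 6 → ℂ) := {z | ‖blowCoord z‖ = 1 ∧ max ‖z 0‖ ‖z 4‖ = 1 ∧ blowEq a₁ z = 0}
  have hcl : IsClosed K := by
    refine IsClosed.inter (isClosed_eq contDiff_blowCoord.continuous.norm continuous_const)
      (IsClosed.inter (isClosed_eq ?_ continuous_const)
        (isClosed_eq (contDiff_blowEq a₁).continuous continuous_const))
    exact (continuous_apply 0).norm.max (continuous_apply 4).norm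
  have hbd : ∀ z ∈ K, ‖z‖ ≤ max 1 C := by
    rintro z ⟨h1, h2, h3⟩
    have hx : ∀ i, ‖blowCoord z i‖ ≤ 1 := fun i => h1 ▸ norm_le_pi_norm _ i
    have h4 : ‖z 0‖ ≤ 1 := h2 ▸ le_max_left _ _
    have h5 : ‖z 4‖ ≤ 1 := h2 ▸ le_max_right _ _
    have h6 : ‖z 5‖ ≤ max 1 C := by
      rcases max_choice ‖z 0‖ ‖z 4‖ with h | h
      · have : ‖z 5 * z 0‖ ≤ 1 := hx 0
        rw [norm_mul, ← h, h2, mul_one] at this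
        exact this.trans (le_max_left _ _)
      · have : ‖z 5 * z 4‖ ≤ C := by rw [sub_eq_zero.1 h3]; exact hC _ h1
        rw [norm_mul, ← h, h2, mul_one] at this
        exact this.trans (le_max_right _ _)
    refine (pi_norm_le_iff_of_nonneg (zero_le_one.trans (le_max_left _ _))).2 fun i => ?_
    fin_cases i
    · exact h4.trans (le_max_left _ _)
    · exact (hx 1).trans (le_max_left _ _)
    · exact (hx 2).trans (le_max_left _ _)
    · exact (hx 3).trans (le_max_left _ _)
    · exact h5.trans (le_max_left _ _)
    · exact h6
  have hK : IsCompact K := Metric.isCompact_of_isClosed_isBounded hcl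
    (isBounded_iff_forall_norm_le.2 ⟨_, hbd⟩)
  have hKB : ∀ z ∈ K, z ∈ coneB a₁ := by
    rintro z ⟨h1, h2, h3⟩
    refine ⟨mem_coneX4_iff.2 ⟨?_, ?_⟩, sub_eq_zero.1 h3⟩
    · by_contra! h
      simp [h.1, h.2] at h2
    · by_contra! h
      obtain ⟨h4, h5, h6, h7⟩ := h
      have : blowCoord z = 0 := by
        ext i; fin_cases i <;> simp [blowCoord, h4, h5, h6, h7]
      simp [this] at h1
  let f : K → BTilde a₁ := fun z => mkPt weightX4 ⟨z.1, hKB z.1 z.2⟩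
  have hf : Continuous f := continuous_mkPt.comp (continuous_subtype_val.subtype_mk _)
  have hs : Function.Surjective f := by
    intro p
    induction p using Quotient.inductionOn with
    | h z =>
      have hb : ‖blowCoord z.1‖ ≠ 0 := norm_ne_zero_iff.2 (blowCoord_mem ha₁ z.2)
      set s : ℂ := ((‖blowCoord z.1‖⁻¹ : ℝ) : ℂ) with hs
      have hs0 : s ≠ 0 := by simpa [hs] using hb
      set M : ℝ := max ‖s * z.1 0‖ ‖s ^ 4 * z.1 4‖ with hM
      have hM0 : M ≠ 0 := by
        refine ne_of_gt ?_
        rcases (mem_coneX4_iff.1 z.2.1).1 with h | h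
        · exact lt_max_of_lt_left (norm_pos_iff.2 (mul_ne_zero hs0 h))
        · exact lt_max_of_lt_right (norm_pos_iff.2 (mul_ne_zero (pow_ne_zero 4 hs0) h))
      have hMpos : 0 ≤ M := (norm_nonneg _).trans (le_max_left _ _)
      have hl0 : ((M⁻¹ : ℝ) : ℂ) ≠ 0 := by simpa using hM0
      set t : Fin 2 → ℂˣ := ![Units.mk0 s hs0, Units.mk0 _ hl0] with ht
      have ht0 : (t 0 : ℂ) = s := rfl
      have ht1 : (t 1 : ℂ) = ((M⁻¹ : ℝ) : ℂ) := rfl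
      have hmem : torusAct weightX4 t z.1 ∈ K := by
        refine ⟨?_, ?_, blowEq_eq_zero (torusAct_mem_coneB ha₁ t _ z.2)⟩
        · have : blowCoord (torusAct weightX4 t z.1) = s • blowCoord z.1 :=
            funext (blowCoord_act t z.1)
          rw [this, norm_smul, hs]
          simp [hb]
        · have h0 : torusAct weightX4 t z.1 0 = ((M⁻¹ : ℝ) : ℂ) * (s * z.1 0) := by
            rw [torusAct_weightX4_zero, ht0, ht1]; ring
          have h4 : torusAct weightX4 t z.1 4 = ((M⁻¹ : ℝ) : ℂ) * (s ^ 4 * z.1 4) := by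
            rw [torusAct_weightX4_four, ht0, ht1]; ring
          have hn : ‖((M⁻¹ : ℝ) : ℂ)‖ = M⁻¹ := by
            rw [Complex.norm_real, Real.norm_of_nonneg (inv_nonneg.2 hMpos)]
          rw [h0, h4, norm_mul _ (s * z.1 0), norm_mul _ (s ^ 4 * z.1 4), hn, ← mul_max_of_nonneg _ _ (inv_nonneg.2 hMpos), ← hM,
            inv_mul_cancel₀ hM0]
      exact ⟨⟨_, hmem⟩, (mkPt_eq_mkPt_iff.2 ⟨t, rfl⟩).symm⟩
  have : CompactSpace K := isCompact_iff_compactSpace.1 hK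
  exact ⟨by rw [← hs.range_eq]; exact isCompact_range hf⟩

end Topology

/-! ### Slice charts of the blow-up -/

theorem contDiffOn_torusChar {m r : ℕ} {τ : (Fin m → ℂ) → Fin r → ℂˣ} {D : Set (Fin m → ℂ)}
    (hτ : ∀ k, ContDiffOn ℂ ω (fun z => (τ z k : ℂ)) D) (q : Fin r → ℤ) :
    ContDiffOn ℂ ω (fun z => torusChar (τ z) q) D := by
  have h : (fun z => torusChar (τ z) q) = fun z => ∏ k, (τ z k : ℂ) ^ q k := by
    funext z; simp [torusChar]
  rw [h]
  refine contDiffOn_prod fun k _ => ?_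
  obtain ⟨a, ha | ha⟩ := Int.eq_nat_or_neg (q k)
  · simpa [ha] using (hτ k).pow a
  · simp only [ha, zpow_neg, zpow_natCast]
    exact ((hτ k).pow a).inv fun z _ => pow_ne_zero a (τ z k).ne_zero

/-- The torus element that scales `f` and `h`, of weights `(1, 0)` and `(0, 1)`, to `1`. -/
def normalizer (f h : (Fin 6 → ℂ) → ℂ) (z : Fin 6 → ℂ) : Fin 2 → ℂˣ :=
  ![invUnit (f z), invUnit (h z)]

/-- A pair of functions of weights `(1, 0)` and `(0, 1)` on `ℂ⁶`. -/
structure NormalizingPair where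
  fst : (Fin 6 → ℂ) → ℂ
  snd : (Fin 6 → ℂ) → ℂ
  fst_act : ∀ t z, fst (torusAct weightX4 t z) = (t 0 : ℂ) * fst z
  snd_act : ∀ t z, snd (torusAct weightX4 t z) = (t 1 : ℂ) * snd z
  isOpen_dom : IsOpen {z | fst z ≠ 0 ∧ snd z ≠ 0}
  contDiffOn_fst : ContDiffOn ℂ ω fst {z | fst z ≠ 0 ∧ snd z ≠ 0}
  contDiffOn_snd : ContDiffOn ℂ ω snd {z | fst z ≠ 0 ∧ snd z ≠ 0}

namespace NormalizingPair

variable (N : NormalizingPair)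

/-- The locus on which the pair can be normalised. -/
def dom : Set (Fin 6 → ℂ) := {z | N.fst z ≠ 0 ∧ N.snd z ≠ 0}

/-- The normalising torus element. -/
def norm (z : Fin 6 → ℂ) : Fin 2 → ℂˣ := normalizer N.fst N.snd z

/-- The normalised point. -/
def normalize (z : Fin 6 → ℂ) : Fin 6 → ℂ := torusAct weightX4 (N.norm z) z

variable {N}

theorem act_mem_dom (t : Fin 2 → ℂˣ) {z : Fin 6 → ℂ} (hz : z ∈ N.dom) :
    torusAct weightX4 t z ∈ N.dom := by
  refine ⟨?_, ?_⟩
  · rw [N.fst_act]; exact mul_ne_zero (t 0).ne_zero hz.1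
  · rw [N.snd_act]; exact mul_ne_zero (t 1).ne_zero hz.2

theorem norm_zero {z : Fin 6 → ℂ} (hz : z ∈ N.dom) : (N.norm z 0 : ℂ) = (N.fst z)⁻¹ :=
  invUnit_val hz.1

theorem norm_one {z : Fin 6 → ℂ} (hz : z ∈ N.dom) : (N.norm z 1 : ℂ) = (N.snd z)⁻¹ :=
  invUnit_val hz.2

theorem norm_act (t : Fin 2 → ℂˣ) {z : Fin 6 → ℂ} (hz : z ∈ N.dom) :
    N.norm (torusAct weightX4 t z) = N.norm z * t⁻¹ := by
  funext k
  ext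
  fin_cases k
  · simp only [Fin.zero_eta, Pi.mul_apply, Pi.inv_apply, Units.val_mul, Units.val_inv_eq_inv_val,
      norm_zero hz, norm_zero (act_mem_dom t hz), N.fst_act, mul_inv]
    exact mul_comm _ _
  · simp only [Fin.mk_one, Pi.mul_apply, Pi.inv_apply, Units.val_mul, Units.val_inv_eq_inv_val,
      norm_one hz, norm_one (act_mem_dom t hz), N.snd_act, mul_inv]
    exact mul_comm _ _

theorem normalize_act (t : Fin 2 → ℂˣ) {z : Fin 6 → ℂ} (hz : z ∈ N.dom) :
    N.normalize (torusAct weightX4 t z) = N.normalize z := by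
  rw [normalize, norm_act t hz, ← torusAct_mul, inv_mul_cancel_right, normalize]

theorem fst_normalize {z : Fin 6 → ℂ} (hz : z ∈ N.dom) : N.fst (N.normalize z) = 1 := by
  rw [normalize, N.fst_act, norm_zero hz, inv_mul_cancel₀ hz.1]

theorem snd_normalize {z : Fin 6 → ℂ} (hz : z ∈ N.dom) : N.snd (N.normalize z) = 1 := by
  rw [normalize, N.snd_act, norm_one hz, inv_mul_cancel₀ hz.2]

theorem mem_dom_of_eq_one {z : Fin 6 → ℂ} (h1 : N.fst z = 1) (h2 : N.snd z = 1) : z ∈ N.dom :=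
  ⟨by rw [h1]; exact one_ne_zero, by rw [h2]; exact one_ne_zero⟩

theorem normalize_eq_self {z : Fin 6 → ℂ} (h1 : N.fst z = 1) (h2 : N.snd z = 1) :
    N.normalize z = z := by
  have : N.norm z = 1 := by
    have hz := mem_dom_of_eq_one h1 h2
    funext k
    ext
    fin_cases k
    · simp [norm_zero hz, h1]
    · simp [norm_one hz, h2]
  rw [normalize, this, torusAct_one]

theorem contDiffOn_norm (k : Fin 2) : ContDiffOn ℂ ω (fun z => (N.norm z k : ℂ)) N.dom := by
  fin_cases k
  · exact (N.contDiffOn_fst.inv fun z hz => hz.1).congr fun z hz => norm_zero hz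
  · exact (N.contDiffOn_snd.inv fun z hz => hz.2).congr fun z hz => norm_one hz

theorem contDiffOn_normalize : ContDiffOn ℂ ω N.normalize N.dom :=
  contDiffOn_pi.2 fun i => (contDiffOn_torusChar contDiffOn_norm (weightX4 i)).mul
    (contDiff_apply ℂ ℂ i).contDiffOn

end NormalizingPair

/-- A parametrised slice: normalised points of the cone over the blow-up, in an open set `region`,
parametrised by the three coordinates `idx`. -/
structure ParamSlice (a₁ : MvPolynomial (Fin 4) ℂ) extends NormalizingPair where
  idx : Fin 3 → Fin 6
  region : Set (Fin 6 → ℂ)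
  target : Set (Fin 3 → ℂ)
  param : (Fin 3 → ℂ) → Fin 6 → ℂ
  isOpen_region : IsOpen region
  isOpen_target : IsOpen target
  contDiffOn_param : ContDiffOn ℂ ω param target
  param_mem : ∀ u ∈ target, param u ∈ coneB a₁
  param_mem_region : ∀ u ∈ target, param u ∈ region
  fst_param : ∀ u ∈ target, fst (param u) = 1
  snd_param : ∀ u ∈ target, snd (param u) = 1
  param_idx : ∀ u ∈ target, ∀ l, param u (idx l) = u l
  param_eq : ∀ z ∈ coneB a₁, fst z = 1 → snd z = 1 → z ∈ region → (fun l => z (idx l)) ∈ target →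
    param (fun l => z (idx l)) = z

namespace ParamSlice

variable {a₁ : MvPolynomial (Fin 4) ℂ} (P : ParamSlice a₁)

/-- The slice chart of a parametrised slice. -/
def toSliceChart (ha₁ : a₁.IsHomogeneous 4) (base : coneB a₁) :
    SliceChart 3 weightX4 (coneB a₁) where
  dom := P.dom ∩ P.normalize ⁻¹' (P.region ∩ {z | (fun l => z (P.idx l)) ∈ P.target})
  target := P.target
  param := P.param
  coord z l := P.normalize z (P.idx l)
  norm := P.norm
  base := base
  isOpen_dom := NormalizingPair.contDiffOn_normalize.continuousOn.isOpen_inter_preimage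
    P.isOpen_dom (P.isOpen_region.inter (P.isOpen_target.preimage
      (continuous_pi fun l => continuous_apply (P.idx l))))
  isOpen_target := P.isOpen_target
  contDiffOn_param := P.contDiffOn_param
  contDiffOn_coord := contDiffOn_pi.2 fun l =>
    ((contDiffOn_pi.1 NormalizingPair.contDiffOn_normalize) (P.idx l)).mono Set.inter_subset_left
  contDiffOn_norm k := (NormalizingPair.contDiffOn_norm k).mono Set.inter_subset_left
  param_mem := P.param_mem
  param_mem_dom u hu := by
    have h1 := P.fst_param u hu
    have h2 := P.snd_param u hu
    refine ⟨NormalizingPair.mem_dom_of_eq_one h1 h2, ?_⟩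
    rw [Set.mem_preimage, NormalizingPair.normalize_eq_self h1 h2]
    refine ⟨P.param_mem_region u hu, ?_⟩
    simpa [P.param_idx u hu] using hu
  coord_mem z hz := hz.2.2
  coord_param u hu := by
    rw [NormalizingPair.normalize_eq_self (P.fst_param u hu) (P.snd_param u hu)]
    exact funext fun l => P.param_idx u hu l
  act_mem_dom t z hz := by
    refine ⟨NormalizingPair.act_mem_dom t hz.1, ?_⟩
    rw [Set.mem_preimage, NormalizingPair.normalize_act t hz.1]
    exact hz.2
  coord_act t z hz := by rw [NormalizingPair.normalize_act t hz.1]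
  norm_act t z hz := NormalizingPair.norm_act t hz.1
  param_coord z hz hzd := P.param_eq _ (torusAct_mem_coneB ha₁ _ _ hz)
    (NormalizingPair.fst_normalize hzd.1) (NormalizingPair.snd_normalize hzd.1) hzd.2.1 hzd.2.2

end ParamSlice

/-- In the slice chart `c` two coordinates with independent weights are `1`, and three are the
coordinates of the chart; the coordinate `w` is among these five. -/
def IsAdapted {a₁ : MvPolynomial (Fin 4) ℂ} (c : SliceChart 3 weightX4 (coneB a₁)) : Prop :=
  ∃ (p : Fin 3 → Fin 6) (i j : Fin 6),
    (∀ u ∈ c.target, (∀ l, c.param u (p l) = u l) ∧ c.param u i = 1 ∧ c.param u j = 1) ∧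
    weightX4 i 0 * weightX4 j 1 - weightX4 i 1 * weightX4 j 0 ≠ 0 ∧
    -- This guarantees that `w` vanishes identically on no nonempty open set, as the blow-up
    -- property requires of the local equation of the exceptional divisor.
    (5 = i ∨ 5 = j ∨ ∃ l, p l = 5)

/-! ### Charts off the exceptional divisor -/

/-- The normalisation `x m = 1` in `ℙ³`, `w = 1`. -/
def affinePair (m : Fin 4) : NormalizingPair where
  fst z := blowCoord z m
  snd z := (z 5)⁻¹
  fst_act t z := blowCoord_act t z m
  snd_act t z := by rw [torusAct_weightX4_five, mul_inv, inv_inv]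
  isOpen_dom := by
    have h : {z : Fin 6 → ℂ | blowCoord z m ≠ 0 ∧ (z 5)⁻¹ ≠ 0} =
        {z | blowCoord z m ≠ 0} ∩ {z | z 5 ≠ 0} := by
      ext z; simp
    rw [h]
    exact (isOpen_ne_fun ((continuous_apply m).comp contDiff_blowCoord.continuous)
      continuous_const).inter (isOpen_ne_fun (continuous_apply 5) continuous_const)
  contDiffOn_fst := ((contDiff_apply ℂ ℂ m).comp contDiff_blowCoord).contDiffOn
  contDiffOn_snd := (contDiff_apply ℂ ℂ (5 : Fin 6)).contDiffOn.inv fun z hz => by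
    simpa using hz.2

/-- The point of the cone over the blow-up with `w = 1` over a point of `ℂ⁴`. -/
def liftPoint (a₁ : MvPolynomial (Fin 4) ℂ) (x : Fin 4 → ℂ) : Fin 6 → ℂ :=
  ![x 0, x 1, x 2, x 3, MvPolynomial.eval x a₁, 1]

theorem blowCoord_liftPoint (a₁ : MvPolynomial (Fin 4) ℂ) (x : Fin 4 → ℂ) :
    blowCoord (liftPoint a₁ x) = x := by
  ext i
  fin_cases i <;> simp [blowCoord, liftPoint]

theorem liftPoint_blowCoord {a₁ : MvPolynomial (Fin 4) ℂ} {z : Fin 6 → ℂ} (hz : z ∈ coneB a₁)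
    (h5 : z 5 = 1) : liftPoint a₁ (blowCoord z) = z := by
  have h4 := (mem_coneB_iff.1 hz).2
  rw [h5, one_mul] at h4
  refine fin_six_ext ?_ rfl rfl rfl h4.symm h5.symm
  simp [liftPoint, blowCoord, h5]

theorem contDiff_liftPoint (a₁ : MvPolynomial (Fin 4) ℂ) : ContDiff ℂ ω (liftPoint a₁) := by
  rw [contDiff_pi]
  intro i
  fin_cases i
  · exact contDiff_apply ℂ ℂ (0 : Fin 4)
  · exact contDiff_apply ℂ ℂ (1 : Fin 4)
  · exact contDiff_apply ℂ ℂ (2 : Fin 4)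
  · exact contDiff_apply ℂ ℂ (3 : Fin 4)
  · exact contDiff_eval a₁
  · exact contDiff_const

theorem castLE_apply_liftPoint (a₁ : MvPolynomial (Fin 4) ℂ) (x : Fin 4 → ℂ) (i : Fin 4) :
    liftPoint a₁ x (Fin.castLE (by norm_num) i) = x i := by
  fin_cases i <;> rfl

/-- The slice `w = 1`, `x m = 1`. -/
def affineParamSlice (a₁ : MvPolynomial (Fin 4) ℂ) (m : Fin 4) : ParamSlice a₁ where
  toNormalizingPair := affinePair m
  idx l := Fin.castLE (by norm_num) (m.succAbove l)
  region := Set.univ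
  -- For `w = 1` the equation reads `a = a₁(x)`, so the Stanley–Reisner condition on `x₁` and `a`
  -- removes exactly the center.
  target := {u | (m.insertNth 1 u : Fin 4 → ℂ) 0 ≠ 0 ∨
    MvPolynomial.eval (m.insertNth 1 u : Fin 4 → ℂ) a₁ ≠ 0}
  param u := liftPoint a₁ (m.insertNth 1 u)
  isOpen_region := isOpen_univ
  isOpen_target := (isOpen_ne_fun ((continuous_apply 0).comp (contDiff_insertNth_one m).continuous)
    continuous_const).union (isOpen_ne_fun ((contDiff_eval a₁).continuous.comp
      (contDiff_insertNth_one m).continuous) continuous_const)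
  contDiffOn_param := ((contDiff_liftPoint a₁).comp (contDiff_insertNth_one m)).contDiffOn
  param_mem u hu := by
    refine mem_coneB_iff.2 ⟨mem_coneX4_iff.2 ⟨hu, ?_⟩, ?_⟩
    · simp [liftPoint]
    · rw [blowCoord_liftPoint]; simp [liftPoint]
  param_mem_region _ _ := trivial
  fst_param u _ := by
    change blowCoord (liftPoint a₁ _) m = 1
    rw [blowCoord_liftPoint]
    exact affineSlice_param_same m u
  snd_param u _ := by simp [affinePair, liftPoint]
  param_idx u _ l := (castLE_apply_liftPoint a₁ _ _).trans (affineSlice_param_succAbove m u l)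
  param_eq z hz h1 h2 _ _ := by
    have h5 : z 5 = 1 := by simpa [affinePair] using h2
    have h1 : blowCoord z m = 1 := h1
    have : (m.insertNth 1 fun l => z (Fin.castLE (by norm_num) (m.succAbove l)) : Fin 4 → ℂ) =
        blowCoord z := by
      have hz' : ∀ i : Fin 4, z (Fin.castLE (by norm_num) i) = blowCoord z i := by
        intro i
        rw [← castLE_apply_liftPoint a₁ (blowCoord z), liftPoint_blowCoord hz h5]
      simp only [hz']
      ext k
      rcases Fin.eq_self_or_eq_succAbove m k with rfl | ⟨l, rfl⟩
      · simp [h1]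
      · simp
    rw [this, liftPoint_blowCoord hz h5]

theorem exists_affine_chart {a₁ : MvPolynomial (Fin 4) ℂ} (ha₁ : a₁.IsHomogeneous 4) (z : coneB a₁)
    (h5 : z.1 5 ≠ 0) :
    ∃ c : SliceChart 3 weightX4 (coneB a₁), z.1 ∈ c.dom ∧ IsAdapted c := by
  obtain ⟨m, hm⟩ := exists_ne_zero_of_mem_coneP3 (blowCoord_mem ha₁ z.2)
  have hd : z.1 ∈ (affinePair m).dom := ⟨hm, inv_ne_zero h5⟩
  refine ⟨(affineParamSlice a₁ m).toSliceChart ha₁ z, ⟨hd, trivial, ?_⟩, ?_⟩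
  · set z' := (affinePair m).normalize z.1 with hz'
    have hzB : z' ∈ coneB a₁ := torusAct_mem_coneB ha₁ _ _ z.2
    have h5' : z' 5 = 1 := by
      have h : (z' 5)⁻¹ = 1 := NormalizingPair.snd_normalize hd
      exact inv_eq_one.1 h
    have h1 : blowCoord z' m = 1 := NormalizingPair.fst_normalize hd
    have hx : ((m.insertNth 1 fun l => z' ((affineParamSlice a₁ m).idx l)) : Fin 4 → ℂ) =
        blowCoord z' := by
      have hzi : ∀ i : Fin 4, z' (Fin.castLE (by norm_num) i) = blowCoord z' i := by
        intro i
        rw [← castLE_apply_liftPoint a₁ (blowCoord z'), liftPoint_blowCoord hzB h5']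
      ext k
      rcases Fin.eq_self_or_eq_succAbove m k with rfl | ⟨l, rfl⟩
      · simp [h1]
      · rw [Fin.insertNth_apply_succAbove]
        exact hzi _
    change _ ≠ 0 ∨ _ ≠ 0
    have h := (mem_coneX4_iff.1 hzB.1).1
    rw [← liftPoint_blowCoord hzB h5'] at h
    exact hx ▸ h
  · refine ⟨(affineParamSlice a₁ m).idx, Fin.castLE (by norm_num) m, 5, fun u hu =>
      ⟨(affineParamSlice a₁ m).param_idx u hu, ?_, rfl⟩, ?_, Or.inr (Or.inl rfl)⟩
    · exact (castLE_apply_liftPoint a₁ _ _).trans (affineSlice_param_same m u)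
    · fin_cases m <;> simp [weightX4]

/-! ### Charts along the exceptional divisor -/

/-- The inverse function theorem for the replacement of one coordinate by a function. -/
theorem exists_inverse_update {m : ℕ} {f : (Fin m → ℂ) → ℂ} (hf : ContDiff ℂ ω f) (k : Fin m)
    (x₀ : Fin m → ℂ) (hk : fderiv ℂ f x₀ (Pi.single k 1) ≠ 0) :
    ∃ (O O' : Set (Fin m → ℂ)) (ψ : (Fin m → ℂ) → Fin m → ℂ), IsOpen O ∧ IsOpen O' ∧ x₀ ∈ O ∧
      ContDiffOn ℂ ω ψ O' ∧
      (∀ x ∈ O, Function.update x k (f x) ∈ O' ∧ ψ (Function.update x k (f x)) = x) ∧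
      ∀ y ∈ O', ψ y ∈ O ∧ Function.update (ψ y) k (f (ψ y)) = y := by
  set Φ : (Fin m → ℂ) → Fin m → ℂ := fun x => Function.update x k (f x) with hΦ
  have hΦd : ContDiff ℂ ω Φ := by
    rw [contDiff_pi]
    intro i
    by_cases h : i = k
    · subst h; simpa [hΦ] using hf
    · simpa [hΦ, h] using contDiff_apply ℂ ℂ i
  have hL : ∀ v i, fderiv ℂ Φ x₀ v i = Function.update v k (fderiv ℂ f x₀ v) i := by
    intro v i
    have h1 := hasFDerivAt_pi'.1 (hΦd.differentiable (by simp) x₀).hasFDerivAt i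
    by_cases h : i = k
    · subst h
      have h2 : HasFDerivAt f (fderiv ℂ f x₀) x₀ := (hf.differentiable (by simp) x₀).hasFDerivAt
      simp only [hΦ, Function.update_self] at h1 ⊢
      exact congrArg (fun L : (Fin m → ℂ) →L[ℂ] ℂ => L v) (h1.unique h2)
    · simp only [hΦ, Function.update_of_ne h] at h1 ⊢
      exact congrArg (fun L : (Fin m → ℂ) →L[ℂ] ℂ => L v) (h1.unique (hasFDerivAt_apply i x₀))
  -- A kernel vector has no components other than the `k`-th, hence is a multiple of the basis
  -- vector `k`, on which the derivative of `f` is nonzero.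
  have hinj : Function.Injective (fderiv ℂ Φ x₀ : (Fin m → ℂ) →ₗ[ℂ] (Fin m → ℂ)) := by
    rw [injective_iff_map_eq_zero]
    intro v hv
    have hv' : ∀ i, Function.update v k (fderiv ℂ f x₀ v) i = 0 := fun i => by
      rw [← hL]; exact congrFun hv i
    have hne : ∀ i, i ≠ k → v i = 0 := fun i hi => by simpa [hi] using hv' i
    have hvk : v = v k • Pi.single k (1 : ℂ) := by
      ext i
      by_cases h : i = k
      · subst h; simp
      · simp [h, hne i h]
    have h0 : fderiv ℂ f x₀ v = 0 := by simpa using hv' k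
    rw [hvk, map_smul, smul_eq_mul, mul_eq_zero] at h0
    rw [hvk, h0.resolve_right hk, zero_smul]
  let e := (LinearEquiv.ofInjectiveEndo _ hinj).toContinuousLinearEquiv
  have he : HasFDerivAt Φ (e : (Fin m → ℂ) →L[ℂ] (Fin m → ℂ)) x₀ := by
    have : (e : (Fin m → ℂ) →L[ℂ] (Fin m → ℂ)) = fderiv ℂ Φ x₀ := by
      ext v; rfl
    rw [this]
    exact (hΦd.differentiable (by simp) x₀).hasFDerivAt
  let H := ContDiffAt.toOpenPartialHomeomorph Φ hΦd.contDiffAt he (by simp : (ω : WithTop ℕ∞) ≠ 0)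
  have hH : ∀ x, H x = Φ x := fun x => rfl
  have hx₀ : x₀ ∈ H.source :=
    ContDiffAt.mem_toOpenPartialHomeomorph_source hΦd.contDiffAt he (by simp)
  have hsymm : ContDiffAt ℂ ω H.symm (H x₀) :=
    H.contDiffAt_symm (f₀' := e) (H.map_source hx₀) (by rw [H.left_inv hx₀]; exact he)
      (by rw [H.left_inv hx₀]; exact hΦd.contDiffAt)
  -- Being analytic at a point is an open condition, so the local inverse can be restricted to open
  -- sets on which both directions are analytic.
  have hω : (ω : WithTop ℕ∞) ≠ ∞ := by simp
  let H' := H.restrContDiff ℂ ω hω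
  exact ⟨H'.source, H'.target, H'.symm, H'.open_source, H'.open_target,
    ⟨hx₀, hΦd.contDiffAt, hsymm⟩, H.contDiffOn_restrContDiff_target ℂ hω,
    fun x hx => ⟨H'.map_source hx, H'.left_inv hx⟩, fun y hy => ⟨H'.map_target hy, H'.right_inv hy⟩⟩

theorem fderiv_eval_single {m : ℕ} (p : MvPolynomial (Fin m) ℂ) (x : Fin m → ℂ) (k : Fin m) :
    fderiv ℂ (fun x => MvPolynomial.eval x p) x (Pi.single k 1) =
      MvPolynomial.eval x (MvPolynomial.pderiv k p) := by
  have hline : HasDerivAt (fun ε : ℂ => x + ε • (Pi.single k 1 : Fin m → ℂ)) (Pi.single k 1) 0 := by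
    simpa using ((hasDerivAt_id (0 : ℂ)).smul_const (Pi.single k 1 : Fin m → ℂ)).const_add x
  have hx0 : x + (0 : ℂ) • (Pi.single k 1 : Fin m → ℂ) = x := by simp
  have h1 := hasDerivAt_eval p hline
  have h2 : HasFDerivAt (fun x => MvPolynomial.eval x p)
      (fderiv ℂ (fun x => MvPolynomial.eval x p) x)
      (x + (0 : ℂ) • (Pi.single k 1 : Fin m → ℂ)) := by
    rw [hx0]
    exact ((contDiff_eval p).differentiable (by simp) x).hasFDerivAt
  have h4 : HasDerivAt (fun ε : ℂ => MvPolynomial.eval (x + ε • (Pi.single k 1 : Fin m → ℂ)) p)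
      (fderiv ℂ (fun x => MvPolynomial.eval x p) x (Pi.single k 1)) 0 :=
    HasFDerivAt.comp_hasDerivAt (l := fun x => MvPolynomial.eval x p) (0 : ℂ) h2 hline
  have h3 := h4.unique h1
  rw [h3, hx0]
  simp [Pi.single_apply]

/-- The coordinate of `ℂ⁶` with the same name as a coordinate of `ℂ⁴`. -/
def emb (j : Fin 4) : Fin 6 := Fin.castLE (by norm_num) j

theorem blowCoord_apply_of_ne (z : Fin 6 → ℂ) {j : Fin 4} (hj : j ≠ 0) :
    blowCoord z j = z (emb j) := by
  fin_cases j
  · exact absurd rfl hj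
  all_goals rfl

theorem blowCoord_update (z : Fin 6 → ℂ) {k : Fin 4} (hk : k ≠ 0) (a : ℂ) :
    blowCoord (Function.update z (emb k) a) = Function.update (blowCoord z) k a := by
  ext j
  have h0 : (0 : Fin 6) ≠ emb k := by revert k; decide
  have h5 : (5 : Fin 6) ≠ emb k := by revert k; decide
  by_cases hj : j = 0
  · subst hj
    rw [Function.update_of_ne hk.symm]
    simp [blowCoord, Function.update_of_ne h0, Function.update_of_ne h5]
  · rw [blowCoord_apply_of_ne _ hj]
    by_cases hjk : j = k
    · subst hjk; simp
    · have : emb j ≠ emb k := fun h => hjk (Fin.castLE_injective _ h)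
      rw [Function.update_of_ne this, Function.update_of_ne hjk, blowCoord_apply_of_ne _ hj]

/-- The choice of coordinates for a slice near the exceptional divisor: the coordinate `i` (one of
`x₁`, `a`, of weight `(e, 1)`) and the coordinate `l` of `ℙ³` are normalised to `1`, and the
coordinate `k` is a function of the coordinates `i'`, `m` and `w`. -/
structure ExcIndex where
  i : Fin 6
  i' : Fin 6
  e : ℕ
  k : Fin 4
  l : Fin 4
  m : Fin 4
  first : i = 0 ∧ i' = 4 ∧ e = 1 ∨ i = 4 ∧ i' = 0 ∧ e = 4
  k_ne : k ≠ 0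
  l_ne : l ≠ 0
  m_ne : m ≠ 0
  k_ne_l : k ≠ l
  k_ne_m : k ≠ m
  l_ne_m : l ≠ m

namespace ExcIndex

variable (I : ExcIndex)

theorem cover (j : Fin 6) :
    j = I.i ∨ j = I.i' ∨ j = 5 ∨ j = emb I.k ∨ j = emb I.l ∨ j = emb I.m := by
  have h : ∀ k l m : Fin 4, k ≠ 0 → l ≠ 0 → m ≠ 0 → k ≠ l → k ≠ m → l ≠ m → ∀ j : Fin 6,
      (j = 0 ∨ j = 4) ∨ j = 5 ∨ j = emb k ∨ j = emb l ∨ j = emb m := by decide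
  have := h _ _ _ I.k_ne I.l_ne I.m_ne I.k_ne_l I.k_ne_m I.l_ne_m j
  rcases I.first with ⟨h1, h2, -⟩ | ⟨h1, h2, -⟩ <;> rw [h1, h2] <;> tauto

theorem i_ne : I.i ≠ I.i' ∧ I.i ≠ 5 ∧ (∀ j, j ≠ 0 → I.i ≠ emb j) ∧
    I.i' ≠ 5 ∧ ∀ j, j ≠ 0 → I.i' ≠ emb j := by
  rcases I.first with ⟨h1, h2, -⟩ | ⟨h1, h2, -⟩ <;> rw [h1, h2] <;> decide

theorem emb_ne {j k : Fin 4} (h : j ≠ k) : emb j ≠ emb k := fun h' => h (Fin.castLE_injective _ h')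

theorem emb_ne_five (j : Fin 4) : emb j ≠ 5 := by revert j; decide

/-- The normalisation of the coordinates `i` and `l`. -/
def pair : NormalizingPair where
  fst z := blowCoord z I.l
  snd z := z I.i / blowCoord z I.l ^ I.e
  fst_act t z := blowCoord_act t z I.l
  snd_act t z := by
    have ht := (t 0).ne_zero
    have h : torusAct weightX4 t z I.i = (t 0 : ℂ) ^ I.e * t 1 * z I.i := by
      rcases I.first with ⟨h1, -, h3⟩ | ⟨h1, -, h3⟩ <;> rw [h1, h3]
      · rw [torusAct_weightX4_zero, pow_one]
      · exact torusAct_weightX4_four t z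
    rw [h, blowCoord_act, mul_pow, mul_assoc, mul_div_mul_left _ _ (pow_ne_zero _ ht), mul_div_assoc]
  isOpen_dom := by
    have h : {z : Fin 6 → ℂ | blowCoord z I.l ≠ 0 ∧ z I.i / blowCoord z I.l ^ I.e ≠ 0} =
        {z | blowCoord z I.l ≠ 0} ∩ {z | z I.i ≠ 0} := by
      ext z
      simp only [Set.mem_ofPred_eq, Set.mem_inter_iff]
      refine and_congr_right fun hz => ?_
      simp [hz]
    rw [h]
    exact (isOpen_ne_fun ((continuous_apply I.l).comp contDiff_blowCoord.continuous)
      continuous_const).inter (isOpen_ne_fun (continuous_apply I.i) continuous_const)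
  contDiffOn_fst := ((contDiff_apply ℂ ℂ I.l).comp contDiff_blowCoord).contDiffOn
  contDiffOn_snd := (contDiff_apply ℂ ℂ I.i).contDiffOn.div
    (((contDiff_apply ℂ ℂ I.l).comp contDiff_blowCoord).contDiffOn.pow I.e)
    fun z hz => pow_ne_zero _ hz.1

/-- The normalised point with given coordinates `i'`, `m`, `w`, up to the coordinate `k`. -/
def pre (u : Fin 3 → ℂ) (j : Fin 6) : ℂ :=
  if j = I.i' then u 0 else if j = emb I.m then u 1 else if j = 5 then u 2 else 1

theorem contDiff_pre : ContDiff ℂ ω I.pre := by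
  rw [contDiff_pi]
  intro j
  unfold pre
  split_ifs
  · exact contDiff_apply ℂ ℂ 0
  · exact contDiff_apply ℂ ℂ 1
  · exact contDiff_apply ℂ ℂ 2
  · exact contDiff_const

/-- The point of `ℂ⁴` at which the coordinate `k` has to be solved for. -/
def solvePt (u : Fin 3 → ℂ) : Fin 4 → ℂ :=
  -- On the hypersurface `w a` is the value of `a₁`, so this is the image of the wanted point of
  -- `ℂ⁴` under the map that replaces its coordinate `k` by the value of `a₁`.
  Function.update (blowCoord (I.pre u)) I.k (I.pre u 5 * I.pre u 4)

theorem contDiff_solvePt : ContDiff ℂ ω I.solvePt := by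
  rw [contDiff_pi]
  intro j
  by_cases h : j = I.k
  · subst h
    simp only [solvePt, Function.update_self]
    exact ((contDiff_pi.1 I.contDiff_pre 5).mul (contDiff_pi.1 I.contDiff_pre 4))
  · simp only [solvePt, Function.update_of_ne h]
    exact contDiff_pi.1 (contDiff_blowCoord.comp I.contDiff_pre) j

/-- The three coordinates of the slice. -/
def idx : Fin 3 → Fin 6 := ![I.i', emb I.m, 5]

theorem pre_idx (u : Fin 3 → ℂ) (l : Fin 3) : I.pre u (I.idx l) = u l := by
  obtain ⟨h1, h2, h3, h4, h5⟩ := I.i_ne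
  have h6 := (h5 I.m I.m_ne).symm
  have h7 := (emb_ne_five I.m).symm
  fin_cases l
  · simp [pre, idx]
  · simp [pre, idx, h6]
  · simp [pre, idx, h4.symm, h7]

theorem pre_i (u : Fin 3 → ℂ) : I.pre u I.i = 1 := by
  obtain ⟨h1, h2, h3, h4, h5⟩ := I.i_ne
  simp [pre, h1, h2, h3 I.m I.m_ne]

theorem pre_l (u : Fin 3 → ℂ) : I.pre u (emb I.l) = 1 := by
  obtain ⟨h1, h2, h3, h4, h5⟩ := I.i_ne
  simp [pre, (h5 I.l I.l_ne).symm, emb_ne I.l_ne_m, emb_ne_five]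

theorem idx_ne (l : Fin 3) : I.idx l ≠ emb I.k := by
  obtain ⟨h1, h2, h3, h4, h5⟩ := I.i_ne
  fin_cases l
  · exact h5 I.k I.k_ne
  · exact emb_ne I.k_ne_m.symm
  · exact (emb_ne_five I.k).symm

theorem update_pre_eq {z : Fin 6 → ℂ} (hi : z I.i = 1) (hl : z (emb I.l) = 1) :
    Function.update (I.pre fun l => z (I.idx l)) (emb I.k) (z (emb I.k)) = z := by
  have hd : ∀ l, (I.pre fun l => z (I.idx l)) (I.idx l) = z (I.idx l) := fun l => I.pre_idx _ l
  ext j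
  by_cases hjk : j = emb I.k
  · subst hjk; simp
  rw [Function.update_of_ne hjk]
  rcases I.cover j with h | h | h | h | h | h
  · rw [h, hi, pre_i]
  · rw [h]; exact hd 0
  · rw [h]; exact hd 2
  · exact absurd h hjk
  · rw [h, hl, pre_l]
  · rw [h]; exact hd 1

theorem update_pre_four_five (u : Fin 3 → ℂ) (a : ℂ) :
    Function.update (I.pre u) (emb I.k) a 5 = I.pre u 5 ∧
    Function.update (I.pre u) (emb I.k) a 4 = I.pre u 4 := by
  have h4 : ∀ k : Fin 4, (4 : Fin 6) ≠ emb k := by decide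
  exact ⟨Function.update_of_ne (emb_ne_five I.k).symm _ _, Function.update_of_ne (h4 _) _ _⟩

/-- A local inverse of the map that replaces the coordinate `k` by the value of `a₁`. -/
structure Inverse (a₁ : MvPolynomial (Fin 4) ℂ) (k : Fin 4) where
  dom : Set (Fin 4 → ℂ)
  target : Set (Fin 4 → ℂ)
  inv : (Fin 4 → ℂ) → Fin 4 → ℂ
  isOpen_dom : IsOpen dom
  isOpen_target : IsOpen target
  contDiffOn_inv : ContDiffOn ℂ ω inv target
  left_inv : ∀ x ∈ dom, Function.update x k (MvPolynomial.eval x a₁) ∈ target ∧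
    inv (Function.update x k (MvPolynomial.eval x a₁)) = x
  right_inv : ∀ y ∈ target, inv y ∈ dom ∧
    Function.update (inv y) k (MvPolynomial.eval (inv y) a₁) = y

variable {I} {a₁ : MvPolynomial (Fin 4) ℂ} (J : Inverse a₁ I.k)

/-- The parametrisation of the slice. -/
def param (u : Fin 3 → ℂ) : Fin 6 → ℂ :=
  Function.update (I.pre u) (emb I.k) (J.inv (I.solvePt u) I.k)

/-- The local inverse changes only the coordinate `k`, and that is the coordinate which `param`
inserts. -/
theorem blowCoord_param {u : Fin 3 → ℂ} (hu : I.solvePt u ∈ J.target) :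
    blowCoord (param J u) = J.inv (I.solvePt u) := by
  have h := (J.right_inv _ hu).2
  rw [param, blowCoord_update _ I.k_ne]
  ext j
  by_cases hj : j = I.k
  · subst hj; simp
  · have := congrFun h j
    rw [solvePt, Function.update_of_ne hj, Function.update_of_ne hj, ← solvePt] at this
    rw [Function.update_of_ne hj, this]

theorem param_i (u : Fin 3 → ℂ) : param J u I.i = 1 := by
  rw [param, Function.update_of_ne (I.i_ne.2.2.1 I.k I.k_ne), pre_i]

theorem param_l (u : Fin 3 → ℂ) : param J u (emb I.l) = 1 := by
  rw [param, Function.update_of_ne (emb_ne I.k_ne_l.symm), pre_l]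

theorem param_idx (u : Fin 3 → ℂ) (l : Fin 3) : param J u (I.idx l) = u l := by
  rw [param, Function.update_of_ne (I.idx_ne l), pre_idx]

theorem param_mem {u : Fin 3 → ℂ} (hu : I.solvePt u ∈ J.target) : param J u ∈ coneB a₁ := by
  refine mem_coneB_iff.2 ⟨mem_coneX4_iff.2 ⟨?_, ?_⟩, ?_⟩
  · have h := param_i J u
    rcases I.first with ⟨h1, -⟩ | ⟨h1, -⟩ <;> rw [h1] at h
    · exact Or.inl (by rw [h]; exact one_ne_zero)
    · exact Or.inr (by rw [h]; exact one_ne_zero)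
  · have h := param_l J u
    have hl : emb I.l = 1 ∨ emb I.l = 2 ∨ emb I.l = 3 := by
      have : ∀ l : Fin 4, l ≠ 0 → emb l = 1 ∨ emb l = 2 ∨ emb l = 3 := by decide
      exact this _ I.l_ne
    have h1 : (1 : ℂ) ≠ 0 := one_ne_zero
    rw [← h] at h1
    rcases hl with hl | hl | hl <;> rw [hl] at h1 <;> tauto
  · rw [blowCoord_param J hu]
    have h := congrFun (J.right_inv _ hu).2 I.k
    rw [Function.update_self] at h
    rw [h, param, (I.update_pre_four_five u _).1, (I.update_pre_four_five u _).2, solvePt,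
      Function.update_self]

/-- The slice near the exceptional divisor. -/
def paramSlice : ParamSlice a₁ where
  toNormalizingPair := I.pair
  idx := I.idx
  region := blowCoord ⁻¹' J.dom
  target := I.solvePt ⁻¹' J.target
  param := param J
  isOpen_region := J.isOpen_dom.preimage contDiff_blowCoord.continuous
  isOpen_target := J.isOpen_target.preimage I.contDiff_solvePt.continuous
  contDiffOn_param := by
    rw [contDiffOn_pi]
    intro j
    by_cases h : j = emb I.k
    · subst h
      simp only [param, Function.update_self]
      exact (contDiffOn_pi.1 J.contDiffOn_inv I.k).comp I.contDiff_solvePt.contDiffOn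
        fun _ hu => hu
    · simp only [param, Function.update_of_ne h]
      exact (contDiff_pi.1 I.contDiff_pre j).contDiffOn
  param_mem _ hu := param_mem J hu
  param_mem_region u hu := by
    rw [Set.mem_preimage, blowCoord_param J hu]
    exact (J.right_inv _ hu).1
  fst_param u _ := (blowCoord_apply_of_ne _ I.l_ne).trans (param_l J u)
  snd_param u _ := by
    change param J u I.i / blowCoord (param J u) I.l ^ I.e = 1
    rw [blowCoord_apply_of_ne _ I.l_ne, param_l, param_i, one_pow, div_one]
  param_idx u _ l := param_idx J u l
  param_eq z hz h1 h2 hzr _ := by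
    have h1' : z (emb I.l) = 1 := (blowCoord_apply_of_ne _ I.l_ne).symm.trans h1
    have h2' : z I.i = 1 := by
      have h2 : z I.i / blowCoord z I.l ^ I.e = 1 := h2
      have h1 : blowCoord z I.l = 1 := h1
      rwa [h1, one_pow, div_one] at h2
    have h := I.update_pre_eq h2' h1'
    set u : Fin 3 → ℂ := fun l => z (I.idx l)
    have hs : I.solvePt u = Function.update (blowCoord z) I.k
        (MvPolynomial.eval (blowCoord z) a₁) := by
      rw [← (mem_coneB_iff.1 hz).2, solvePt]
      conv_rhs => rw [← h, blowCoord_update _ I.k_ne, Function.update_idem,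
        (I.update_pre_four_five u _).1, (I.update_pre_four_five u _).2]
    rw [param, hs, (J.left_inv _ hzr).2, blowCoord_apply_of_ne _ I.k_ne, h]

theorem isAdapted (ha₁ : a₁.IsHomogeneous 4) (base : coneB a₁) :
    IsAdapted ((paramSlice J).toSliceChart ha₁ base) := by
  refine ⟨I.idx, I.i, emb I.l, fun u _ => ⟨param_idx J u, param_i J u, param_l J u⟩, ?_,
    Or.inr (Or.inr ⟨2, rfl⟩)⟩
  have hl : emb I.l = 1 ∨ emb I.l = 2 ∨ emb I.l = 3 := by
    have : ∀ l : Fin 4, l ≠ 0 → emb l = 1 ∨ emb l = 2 ∨ emb l = 3 := by decide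
    exact this _ I.l_ne
  rcases I.first with ⟨h1, -⟩ | ⟨h1, -⟩ <;> rcases hl with hl | hl | hl <;> rw [h1, hl] <;>
    simp [weightX4]

end ExcIndex

theorem exists_inverse {a₁ : MvPolynomial (Fin 4) ℂ} {k : Fin 4} {x : Fin 4 → ℂ}
    (hk : MvPolynomial.eval x (MvPolynomial.pderiv k a₁) ≠ 0) :
    ∃ J : ExcIndex.Inverse a₁ k, x ∈ J.dom := by
  obtain ⟨O, O', ψ, h1, h2, h3, h4, h5, h6⟩ := exists_inverse_update (contDiff_eval a₁) k x
    (by rwa [fderiv_eval_single])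
  exact ⟨⟨O, O', ψ, h1, h2, h4, h5, h6⟩, h3⟩

theorem ExcIndex.mem_dom {I : ExcIndex} {a₁ : MvPolynomial (Fin 4) ℂ} (ha₁ : a₁.IsHomogeneous 4)
    (J : ExcIndex.Inverse a₁ I.k) (z : coneB a₁) (hd : z.1 ∈ I.pair.dom)
    (hJ : blowCoord (I.pair.normalize z.1) ∈ J.dom) :
    z.1 ∈ ((paramSlice J).toSliceChart ha₁ z).dom := by
  refine ⟨hd, hJ, ?_⟩
  set z' := I.pair.normalize z.1
  have hz : z' ∈ coneB a₁ := torusAct_mem_coneB ha₁ _ _ z.2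
  have h1 : blowCoord z' I.l = 1 := NormalizingPair.fst_normalize hd
  have h1' : z' (emb I.l) = 1 := (blowCoord_apply_of_ne _ I.l_ne).symm.trans h1
  have h2' : z' I.i = 1 := by
    have h2 : z' I.i / blowCoord z' I.l ^ I.e = 1 := NormalizingPair.snd_normalize hd
    rwa [h1, one_pow, div_one] at h2
  have h := I.update_pre_eq h2' h1'
  change I.solvePt (fun l => z' (I.idx l)) ∈ J.target
  have hs : I.solvePt (fun l => z' (I.idx l)) = Function.update (blowCoord z') I.k
      (MvPolynomial.eval (blowCoord z') a₁) := by
    rw [← (mem_coneB_iff.1 hz).2, solvePt]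
    conv_rhs => rw [← h, blowCoord_update _ I.k_ne, Function.update_idem,
      (I.update_pre_four_five _ _).1, (I.update_pre_four_five _ _).2]
  rw [hs]
  exact (J.left_inv _ hJ).1

/-- The nonzero points of the affine cone over the center. -/
def centerCone (a₁ : MvPolynomial (Fin 4) ℂ) : Set (Fin 4 → ℂ) :=
  {x | x ∈ coneP3 ∧ x 0 = 0 ∧ MvPolynomial.eval x a₁ = 0}

theorem blowCoord_mem_centerCone {a₁ : MvPolynomial (Fin 4) ℂ} (ha₁ : a₁.IsHomogeneous 4)
    {z : Fin 6 → ℂ} (hz : z ∈ coneB a₁) (h5 : z 5 = 0) : blowCoord z ∈ centerCone a₁ := by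
  refine ⟨blowCoord_mem ha₁ hz, by simp [blowCoord, h5], ?_⟩
  rw [← (mem_coneB_iff.1 hz).2, h5, zero_mul]

/-- After normalisation the image in `ℂ⁴` is `x` divided by its coordinate `l`, wherever the point
sits in the fibre. So one application of the inverse function theorem covers a whole affine line of
the exceptional curve, which later yields frames over that line. -/
theorem exists_chart_along_fiber {a₁ : MvPolynomial (Fin 4) ℂ} (ha₁ : a₁.IsHomogeneous 4)
    (hsmooth : IsSmoothCenter a₁) {x : Fin 4 → ℂ} (hx : x ∈ centerCone a₁) {i : Fin 6}
    (hi : i = 0 ∨ i = 4) (base : coneB a₁) :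
    ∃ c : SliceChart 3 weightX4 (coneB a₁), IsAdapted c ∧
      ∀ z : coneB a₁, blowCoord z.1 = x → z.1 i ≠ 0 → z.1 ∈ c.dom := by
  obtain ⟨hx, hx0, hxa⟩ := hx
  obtain ⟨k, hk0, hk⟩ := hsmooth _ hx hx0 hxa
  -- If all coordinates other than `k` vanished, Euler's relation `x k * ∂ₖ a₁ = 4 a₁ = 0` would
  -- force `x = 0`.
  obtain ⟨l, hl0, hlk, hl⟩ : ∃ l : Fin 4, l ≠ 0 ∧ l ≠ k ∧ x l ≠ 0 := by
    by_contra! hcon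
    have heuler := congrArg (MvPolynomial.eval x) ha₁.sum_X_mul_pderiv
    have hother : ∀ l, l ≠ k → x l = 0 := fun l hlk => by
      by_cases hl0 : l = 0
      · rw [hl0, hx0]
      · exact hcon l hl0 hlk
    simp only [map_sum, map_mul, MvPolynomial.eval_X, map_nsmul, hxa, smul_zero] at heuler
    rw [Finset.sum_eq_single k (fun l _ hlk => by rw [hother l hlk, zero_mul]) (by simp)] at heuler
    have hxk := (mul_eq_zero.1 heuler).resolve_right hk
    refine hx (funext fun l => ?_)
    by_cases hlk : l = k
    · rw [hlk, hxk]; rfl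
    · exact hother l hlk
  obtain ⟨m, hm0, hkm, hlm⟩ : ∃ m : Fin 4, m ≠ 0 ∧ k ≠ m ∧ l ≠ m := by
    have : ∀ k l : Fin 4, ∃ m : Fin 4, m ≠ 0 ∧ k ≠ m ∧ l ≠ m := by decide
    exact this k l
  obtain ⟨I, hIk, hIl, hIi⟩ : ∃ I : ExcIndex, I.k = k ∧ I.l = l ∧ I.i = i := by
    rcases hi with rfl | rfl
    · exact ⟨⟨0, 4, 1, k, l, m, by simp, hk0, hl0, hm0, hlk.symm, hkm, hlm⟩, rfl, rfl, rfl⟩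
    · exact ⟨⟨4, 0, 4, k, l, m, by simp, hk0, hl0, hm0, hlk.symm, hkm, hlm⟩, rfl, rfl, rfl⟩
  subst hIk hIl hIi
  have hs : MvPolynomial.eval (fun j => (x I.l)⁻¹ * x j) (MvPolynomial.pderiv I.k a₁) ≠ 0 := by
    rw [eval_smul_of_isHomogeneous ha₁.pderiv]
    exact mul_ne_zero (pow_ne_zero _ (inv_ne_zero hl)) hk
  obtain ⟨J, hJ⟩ := exists_inverse hs
  refine ⟨_, ExcIndex.isAdapted J ha₁ base, fun z hzx hzi => ?_⟩
  have hd : z.1 ∈ I.pair.dom := by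
    subst hzx
    exact ⟨hl, div_ne_zero hzi (pow_ne_zero _ hl)⟩
  refine ExcIndex.mem_dom ha₁ J z hd ?_
  have h1 : ∀ j, blowCoord (I.pair.normalize z.1) j = (I.pair.norm z.1 0 : ℂ) * x j := fun j =>
    (blowCoord_act _ _ j).trans (by rw [hzx])
  have h2 : (I.pair.norm z.1 0 : ℂ) = (x I.l)⁻¹ :=
    eq_inv_of_mul_eq_one_left ((h1 I.l).symm.trans (NormalizingPair.fst_normalize hd))
  rwa [show blowCoord (I.pair.normalize z.1) = fun j => (x I.l)⁻¹ * x j from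
    funext fun j => by rw [h1, h2]]

theorem exists_exceptional_chart {a₁ : MvPolynomial (Fin 4) ℂ} (ha₁ : a₁.IsHomogeneous 4)
    (hsmooth : IsSmoothCenter a₁) (z : coneB a₁) (h5 : z.1 5 = 0) :
    ∃ c : SliceChart 3 weightX4 (coneB a₁), z.1 ∈ c.dom ∧ IsAdapted c := by
  obtain ⟨i, hi, hzi⟩ : ∃ i : Fin 6, (i = 0 ∨ i = 4) ∧ z.1 i ≠ 0 := by
    rcases (mem_coneX4_iff.1 z.2.1).1 with h | h
    · exact ⟨0, Or.inl rfl, h⟩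
    · exact ⟨4, Or.inr rfl, h⟩
  obtain ⟨c, hc, hmem⟩ := exists_chart_along_fiber ha₁ hsmooth
    (blowCoord_mem_centerCone ha₁ z.2 h5) hi z
  exact ⟨c, hmem z rfl hzi, hc⟩

theorem exists_adapted_chart {a₁ : MvPolynomial (Fin 4) ℂ} (ha₁ : a₁.IsHomogeneous 4)
    (hsmooth : IsSmoothCenter a₁) (z : coneB a₁) :
    ∃ c : SliceChart 3 weightX4 (coneB a₁), z.1 ∈ c.dom ∧ IsAdapted c := by
  by_cases h5 : z.1 5 = 0
  · exact exists_exceptional_chart ha₁ hsmooth z h5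
  · exact exists_affine_chart ha₁ z h5

/-- The atlas of the blow-up. -/
def sliceAtlasB {a₁ : MvPolynomial (Fin 4) ℂ} (ha₁ : a₁.IsHomogeneous 4)
    (hsmooth : IsSmoothCenter a₁) : SliceAtlas 3 weightX4 (coneB a₁) where
  act_mem := torusAct_mem_coneB ha₁
  sliceAt z := (exists_adapted_chart ha₁ hsmooth z).choose
  mem_sliceAt z := (exists_adapted_chart ha₁ hsmooth z).choose_spec.1

theorem isAdapted_sliceAtlasB {a₁ : MvPolynomial (Fin 4) ℂ} (ha₁ : a₁.IsHomogeneous 4)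
    (hsmooth : IsSmoothCenter a₁) (z : coneB a₁) :
    IsAdapted ((sliceAtlasB ha₁ hsmooth).sliceAt z) :=
  (exists_adapted_chart ha₁ hsmooth z).choose_spec.2

/-! ### The residue form on the blow-up -/

theorem fderiv_pi_eq_sum {m : ℕ} (L : (Fin m → ℂ) →L[ℂ] ℂ) (V : Fin m → ℂ) :
    L V = ∑ i, V i * L (Pi.single i 1) := by
  conv_lhs => rw [pi_eq_sum_univ' V]
  simp

section Residue

variable (a₁ : MvPolynomial (Fin 4) ℂ)

/-- The complex conjugate of the gradient of the equation. -/
def conjGrad (z : Fin 6 → ℂ) : Fin 6 → ℂ :=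
  fun i => (starRingEnd ℂ) (fderiv ℂ (blowEq a₁) z (Pi.single i 1))

/-- The value is the sum of the squared moduli of the partial derivatives. -/
theorem fderiv_conjGrad_ne_zero {z : Fin 6 → ℂ} (h : fderiv ℂ (blowEq a₁) z ≠ 0) :
    fderiv ℂ (blowEq a₁) z (conjGrad a₁ z) ≠ 0 := by
  have hsum : fderiv ℂ (blowEq a₁) z (conjGrad a₁ z) =
      ((∑ i, Complex.normSq (fderiv ℂ (blowEq a₁) z (Pi.single i 1)) : ℝ) : ℂ) := by
    rw [fderiv_pi_eq_sum, Complex.ofReal_sum]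
    exact Finset.sum_congr rfl fun i _ => (Complex.normSq_eq_conj_mul_self).symm
  rw [hsum, Complex.ofReal_ne_zero]
  intro h0
  refine h (ContinuousLinearMap.ext fun V => ?_)
  rw [fderiv_pi_eq_sum]
  refine Finset.sum_eq_zero fun i _ => ?_
  have := (Finset.sum_eq_zero_iff_of_nonneg fun i _ => Complex.normSq_nonneg _).1 h0 i
    (Finset.mem_univ i)
  rw [Complex.normSq_eq_zero.1 this, mul_zero]

/-- The matrix with rows the two Euler vectors, `m` and `V₀, V₁, V₂`. -/
def rowMatrix (z m : Fin 6 → ℂ) (V : Fin 3 → Fin 6 → ℂ) : Matrix (Fin 6) (Fin 6) ℂ :=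
  Matrix.of (Matrix.vecCons (eulerVec weightX4 0 z) (Matrix.vecCons (eulerVec weightX4 1 z)
    (Matrix.vecCons m V)))

/-- The alternating form on `ℂ⁶` given by the determinant with first row `E`. -/
def rowDetFive (E : Fin 6 → ℂ) : (Fin 6 → ℂ) [⋀^Fin 5]→ₗ[ℂ] ℂ :=
  (Matrix.detRowAlternating (n := Fin 6) (R := ℂ)).curryLeft E

theorem detRowAlternating_apply {n : Type} [DecidableEq n] [Fintype n] (f : n → n → ℂ) :
    Matrix.detRowAlternating f = (Matrix.of f).det := rfl

theorem rowDetFive_apply (E : Fin 6 → ℂ) (V : Fin 5 → Fin 6 → ℂ) :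
    rowDetFive E V = (Matrix.of (Matrix.vecCons E V)).det := by
  rw [← detRowAlternating_apply, rowDetFive, AlternatingMap.curryLeft_apply_apply]

/-- The alternating form given by the determinant of `rowMatrix`. -/
def rowDetFour (z : Fin 6 → ℂ) : (Fin 6 → ℂ) [⋀^Fin 4]→ₗ[ℂ] ℂ :=
  (rowDetFive (eulerVec weightX4 0 z)).curryLeft (eulerVec weightX4 1 z)

/-- The alternating form given by the determinant of `rowMatrix`. -/
def rowDet (z m : Fin 6 → ℂ) : (Fin 6 → ℂ) [⋀^Fin 3]→ₗ[ℂ] ℂ :=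
  (rowDetFour z).curryLeft m

theorem rowDet_apply (z m : Fin 6 → ℂ) (V : Fin 3 → Fin 6 → ℂ) :
    rowDet z m V = (rowMatrix z m V).det := by
  rw [rowDet, AlternatingMap.curryLeft_apply_apply, rowDetFour,
    AlternatingMap.curryLeft_apply_apply, rowDetFive_apply]
  rfl

theorem rowMatrix_forall {p : (Fin 6 → ℂ) → Prop} {z m : Fin 6 → ℂ} {V : Fin 3 → Fin 6 → ℂ}
    (h0 : p (eulerVec weightX4 0 z)) (h1 : p (eulerVec weightX4 1 z)) (hm : p m)
    (hV : ∀ i, p (V i)) (i : Fin 6) : p (rowMatrix z m V i) := by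
  refine Fin.cases h0 (fun i => ?_) i
  refine Fin.cases h1 (fun i => ?_) i
  exact Fin.cases hm hV i

theorem continuous_rowDet : Continuous
    fun p : ((Fin 6 → ℂ) × (Fin 6 → ℂ)) × (Fin 3 → Fin 6 → ℂ) => rowDet p.1.1 p.1.2 p.2 := by
  simp only [rowDet_apply]
  have hE : ∀ k, Continuous (eulerVec weightX4 k) := fun k => by unfold eulerVec; fun_prop
  refine Continuous.matrix_det (continuous_pi fun i => ?_)
  refine Fin.cases ?_ (fun i => ?_) i
  · exact (hE 0).comp (continuous_fst.comp continuous_fst)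
  refine Fin.cases ?_ (fun i => ?_) i
  · exact (hE 1).comp (continuous_fst.comp continuous_fst)
  refine Fin.cases ?_ (fun i => ?_) i
  · exact continuous_snd.comp continuous_fst
  · exact (continuous_apply i).comp continuous_snd

theorem eulerVec_torusAct {n r : ℕ} (Q : Fin n → Fin r → ℤ) (k : Fin r) (t : Fin r → ℂˣ)
    (z : Fin n → ℂ) : eulerVec Q k (torusAct Q t z) = torusAct Q t (eulerVec Q k z) := by
  ext i
  simp only [eulerVec, torusAct]
  ring

/-- Each column is scaled by the character of its coordinate, and the six weights add up to `(8,
1)`. -/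
theorem rowDet_act (t : Fin 2 → ℂˣ) (z m : Fin 6 → ℂ) (V : Fin 3 → Fin 6 → ℂ) :
    rowDet (torusAct weightX4 t z) (torusAct weightX4 t m) (fun i => torusAct weightX4 t (V i)) =
      (t 0 : ℂ) ^ 8 * t 1 * rowDet z m V := by
  have h : (t 0 : ℂ) ^ 8 * t 1 = ∏ j, torusChar t (weightX4 j) := by
    have h0 := (t 0).ne_zero
    have h1 := (t 1).ne_zero
    have h4 : ∀ x : ℂ, x ^ (4 : ℤ) = x ^ 4 := fun x => by norm_cast
    simp only [torusChar_fin_two, Fin.prod_univ_six]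
    simp [weightX4, h4]
    field_simp
  rw [rowDet_apply, rowDet_apply, h, ← Matrix.det_mul_row]
  congr 1
  ext i j
  revert i
  simp only [rowMatrix, eulerVec_torusAct]
  intro i
  refine Fin.cases rfl (fun i => ?_) i
  refine Fin.cases rfl (fun i => ?_) i
  exact Fin.cases rfl (fun i => rfl) i

/-- The Euler vectors are the first two rows; their multiples are cleared by row operations, one
pivot row at a time. -/
theorem rowDet_add_euler (z m : Fin 6 → ℂ) (V : Fin 3 → Fin 6 → ℂ) (a : Fin 3 → Fin 2 → ℂ) :
    rowDet z m (fun i => V i + ∑ k, a i k • eulerVec weightX4 k z) = rowDet z m V := by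
  have h1 : (rowMatrix z m (fun i => V i + ∑ k, a i k • eulerVec weightX4 k z)).det =
      (rowMatrix z m (fun i => V i + a i 1 • eulerVec weightX4 1 z)).det := by
    refine Matrix.det_eq_of_forall_row_eq_smul_add_const
      (Matrix.vecCons 0 (Matrix.vecCons 0 (Matrix.vecCons 0 fun i => a i 0))) 0 rfl ?_
    intro i j
    refine Fin.cases (by simp [rowMatrix]) (fun i => ?_) i
    refine Fin.cases (by simp [rowMatrix]) (fun i => ?_) i
    refine Fin.cases (by simp [rowMatrix]) (fun i => ?_) i
    simp [rowMatrix, Fin.sum_univ_two]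
    ring
  have h2 : (rowMatrix z m (fun i => V i + a i 1 • eulerVec weightX4 1 z)).det =
      (rowMatrix z m V).det := by
    refine Matrix.det_eq_of_forall_row_eq_smul_add_const
      (Matrix.vecCons 0 (Matrix.vecCons 0 (Matrix.vecCons 0 fun i => a i 1))) 1 rfl ?_
    intro i j
    refine Fin.cases (by simp [rowMatrix]) (fun i => ?_) i
    refine Fin.cases (by simp [rowMatrix]) (fun i => ?_) i
    refine Fin.cases (by simp [rowMatrix]) (fun i => ?_) i
    simp [rowMatrix]
  rw [rowDet_apply, rowDet_apply, h1, h2]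

/-- All six rows lie in the hyperplane `ker L`, so the coefficient vector of `L` is in the kernel of
the matrix. -/
theorem rowDet_eq_zero {z m : Fin 6 → ℂ} {V : Fin 3 → Fin 6 → ℂ} {L : (Fin 6 → ℂ) →L[ℂ] ℂ}
    (hL : L ≠ 0) (h0 : L (eulerVec weightX4 0 z) = 0) (h1 : L (eulerVec weightX4 1 z) = 0)
    (hm : L m = 0) (hV : ∀ i, L (V i) = 0) : rowDet z m V = 0 := by
  rw [rowDet_apply, ← Matrix.exists_mulVec_eq_zero_iff]
  refine ⟨fun j => L (Pi.single j 1), fun h => hL (ContinuousLinearMap.ext fun W => ?_), ?_⟩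
  · rw [fderiv_pi_eq_sum]
    refine Finset.sum_eq_zero fun i _ => ?_
    rw [show L (Pi.single i 1) = 0 from congrFun h i, mul_zero]
  · ext i
    have := rowMatrix_forall (p := fun W => L W = 0) h0 h1 hm hV i
    rw [fderiv_pi_eq_sum] at this
    exact this

/-- The combination `L n • m - L m • n` is killed by `L`, so the previous lemma applies to it. Thus
the residue `rowDet z m V / L m` does not depend on the transversal vector `m`. -/
theorem rowDet_mul_eq {z m n : Fin 6 → ℂ} {V : Fin 3 → Fin 6 → ℂ} {L : (Fin 6 → ℂ) →L[ℂ] ℂ}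
    (hL : L ≠ 0) (h0 : L (eulerVec weightX4 0 z) = 0) (h1 : L (eulerVec weightX4 1 z) = 0)
    (hV : ∀ i, L (V i) = 0) : L n * rowDet z m V = L m * rowDet z n V := by
  have h := rowDet_eq_zero (m := L n • m - L m • n) hL h0 h1
    (by rw [map_sub, map_smul, map_smul, smul_eq_mul, smul_eq_mul, mul_comm, sub_self]) hV
  simp only [rowDet, map_sub, map_smul, AlternatingMap.sub_apply, AlternatingMap.smul_apply,
    smul_eq_mul] at h
  exact sub_eq_zero.1 h

theorem hasDerivAt_blowEq_line (z V : Fin 6 → ℂ) :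
    HasDerivAt (fun ε : ℂ => blowEq a₁ (z + ε • V)) (fderiv ℂ (blowEq a₁) z V) 0 := by
  have hline : HasDerivAt (fun ε : ℂ => z + ε • V) V 0 := by
    simpa using ((hasDerivAt_id (0 : ℂ)).smul_const V).const_add z
  have hz : z + (0 : ℂ) • V = z := by simp
  have h2 : HasFDerivAt (blowEq a₁) (fderiv ℂ (blowEq a₁) z) (z + (0 : ℂ) • V) := by
    rw [hz]
    exact ((contDiff_blowEq a₁).differentiable (by simp) z).hasFDerivAt
  exact h2.comp_hasDerivAt (0 : ℂ) hline

variable {a₁}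

theorem fderiv_blowEq_act (ha₁ : a₁.IsHomogeneous 4) (t : Fin 2 → ℂˣ) (z V : Fin 6 → ℂ) :
    fderiv ℂ (blowEq a₁) (torusAct weightX4 t z) (torusAct weightX4 t V) =
      (t 0 : ℂ) ^ 4 * fderiv ℂ (blowEq a₁) z V := by
  have h1 := hasDerivAt_blowEq_line a₁ (torusAct weightX4 t z) (torusAct weightX4 t V)
  have h2 := (hasDerivAt_blowEq_line a₁ z V).const_mul ((t 0 : ℂ) ^ 4)
  have h3 : (fun ε : ℂ => blowEq a₁ (torusAct weightX4 t z + ε • torusAct weightX4 t V)) =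
      fun ε : ℂ => (t 0 : ℂ) ^ 4 * blowEq a₁ (z + ε • V) := by
    funext ε
    rw [← blowEq_act t _ ha₁]
    congr 1
    ext i
    simp only [torusAct, Pi.add_apply, Pi.smul_apply, smul_eq_mul]
    ring
  rw [h3] at h1
  exact h1.unique h2

/-- The derivative in the direction of `a` is `w`, so a singular point has `w = 0` and lies over the
center. There the derivative along `x k` is `-∂ₖ a₁`, nonzero for a suitable `k ≠ 0` by smoothness.
-/
theorem fderiv_blowEq_ne_zero (ha₁ : a₁.IsHomogeneous 4) (hsmooth : IsSmoothCenter a₁)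
    {z : Fin 6 → ℂ} (hz : z ∈ coneB a₁) : fderiv ℂ (blowEq a₁) z ≠ 0 := by
  intro h0
  have hdir : ∀ V, HasDerivAt (fun ε : ℂ => blowEq a₁ (z + ε • V)) 0 0 := fun V => by
    have := hasDerivAt_blowEq_line a₁ z V
    rwa [h0] at this
  have h5 : z 5 = 0 := by
    have h1 : HasDerivAt (fun ε : ℂ => blowEq a₁ (z + ε • Pi.single 4 1)) (z 5) 0 := by
      have h2 : (fun ε : ℂ => blowEq a₁ (z + ε • Pi.single 4 1)) =
          fun ε : ℂ => ε * z 5 + blowEq a₁ z := by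
        funext ε
        have hb : blowCoord (z + ε • Pi.single 4 1) = blowCoord z := by
          simp [blowCoord]
        rw [blowEq, blowEq, hb]
        simp
        ring
      rw [h2]
      simpa using ((hasDerivAt_id (0 : ℂ)).mul_const (z 5)).add_const (blowEq a₁ z)
    exact h1.unique (hdir _)
  have hx0 : blowCoord z 0 = 0 := by simp [blowCoord, h5]
  have hxa : MvPolynomial.eval (blowCoord z) a₁ = 0 := by
    rw [← (mem_coneB_iff.1 hz).2, h5, zero_mul]
  obtain ⟨k, hk0, hk⟩ := hsmooth _ (blowCoord_mem ha₁ hz) hx0 hxa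
  refine hk ?_
  have hline : HasDerivAt (fun ε : ℂ => blowCoord z + ε • (Pi.single k 1 : Fin 4 → ℂ))
      (Pi.single k 1) 0 := by
    simpa using ((hasDerivAt_id (0 : ℂ)).smul_const (Pi.single k 1 : Fin 4 → ℂ)).const_add
      (blowCoord z)
  have h1 := (hasDerivAt_eval a₁ hline).neg.const_add (z 5 * z 4)
  have h2 : (fun ε : ℂ => blowEq a₁ (z + ε • Pi.single (emb k) 1)) =
      fun ε : ℂ => z 5 * z 4 + -MvPolynomial.eval (blowCoord z + ε • (Pi.single k 1 : Fin 4 → ℂ)) a₁ := by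
    funext ε
    have h4 : ∀ k : Fin 4, (4 : Fin 6) ≠ emb k := by decide
    have hc : ∀ k : Fin 4, (5 : Fin 6) ≠ emb k := by decide
    have hc0 : ∀ k : Fin 4, k ≠ 0 → (0 : Fin 6) ≠ emb k := by decide
    have hb : blowCoord (z + ε • Pi.single (emb k) 1) = blowCoord z + ε • (Pi.single k 1 : Fin 4 → ℂ) := by
      ext j
      by_cases hj : j = 0
      · subst hj
        simp [blowCoord, hc0 k hk0, hc k, hk0.symm]
      · rw [blowCoord_apply_of_ne _ hj, Pi.add_apply, Pi.add_apply, blowCoord_apply_of_ne _ hj]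
        by_cases hjk : j = k
        · subst hjk; simp
        · have : emb j ≠ emb k := ExcIndex.emb_ne hjk
          simp [hjk, this]
    rw [blowEq, hb]
    simp [h4 k, hc k, sub_eq_add_neg]
  have h3 := hdir (Pi.single (emb k) 1)
  rw [h2] at h3
  have h4 := h3.unique h1
  have h5' : MvPolynomial.eval (blowCoord z) (MvPolynomial.pderiv k a₁) =
      ∑ j, MvPolynomial.eval (blowCoord z) (MvPolynomial.pderiv j a₁) *
        (Pi.single k 1 : Fin 4 → ℂ) j := by
    simp [Pi.single_apply]
  rw [h5']
  simpa using h4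

theorem fderiv_blowEq_eq_zero_of_hasDerivAt {γ : ℂ → Fin 6 → ℂ} {V : Fin 6 → ℂ} {ε : ℂ}
    (hγ : HasDerivAt γ V ε) (hZ : ∀ᶠ ε' in 𝓝 ε, γ ε' ∈ coneB a₁) :
    fderiv ℂ (blowEq a₁) (γ ε) V = 0 := by
  have h2 : HasFDerivAt (blowEq a₁) (fderiv ℂ (blowEq a₁) (γ ε)) (γ ε) :=
    ((contDiff_blowEq a₁).differentiable (by simp) (γ ε)).hasFDerivAt
  have h3 : HasDerivAt (fun _ : ℂ => (0 : ℂ)) (fderiv ℂ (blowEq a₁) (γ ε) V) ε :=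
    (h2.comp_hasDerivAt ε hγ).congr_of_eventuallyEq
      (hZ.mono fun ε' h => (blowEq_eq_zero h).symm)
  exact h3.unique (hasDerivAt_const ε 0)

/-- Euler vectors are velocities of torus orbits, which stay inside the cone. -/
theorem fderiv_blowEq_eulerVec (ha₁ : a₁.IsHomogeneous 4) {z : Fin 6 → ℂ} (hz : z ∈ coneB a₁)
    (k : Fin 2) : fderiv ℂ (blowEq a₁) z (eulerVec weightX4 k z) = 0 := by
  have hτ0 : eulerUnit k 0 = (1 : Fin 2 → ℂˣ) := eulerUnit_zero k
  have h := fderiv_blowEq_eq_zero_of_hasDerivAt (a₁ := a₁)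
    (hasDerivAt_torusAct weightX4 (hasDerivAt_eulerUnit k) (hasDerivAt_const (0 : ℂ) z))
    (Filter.Eventually.of_forall fun ε => torusAct_mem_coneB ha₁ (eulerUnit k ε) z hz)
  simpa [hτ0, torusAct_one] using h

/-- The residue of `dx₁ ∧ ⋯ ∧ dw / (wa - a₁)`, contracted with the Euler vectors. -/
def residueForm (ha₁ : a₁.IsHomogeneous 4) (hsmooth : IsSmoothCenter a₁) :
    SliceForm 3 weightX4 (coneB a₁) ![4, 1] where
  tangent z := LinearMap.ker (fderiv ℂ (blowEq a₁) z : (Fin 6 → ℂ) →ₗ[ℂ] ℂ)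
  -- Any transversal vector gives the same residue on tangent vectors. The conjugate gradient is a
  -- choice defined at all points at once; it is not holomorphic, but continuity is enough here.
  form z := (fderiv ℂ (blowEq a₁) z (conjGrad a₁ z))⁻¹ • rowDet z (conjGrad a₁ z)
  hasDerivAt_mem γ V ε hγ hZ := fderiv_blowEq_eq_zero_of_hasDerivAt hγ hZ
  continuousOn_form := by
    have h1 : Continuous (fderiv ℂ (blowEq a₁)) :=
      (contDiff_blowEq a₁).continuous_fderiv (by simp)
    have h2 : Continuous (conjGrad a₁) := continuous_pi fun i =>
      Complex.continuous_conj.comp (h1.clm_apply continuous_const)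
    simp only [AlternatingMap.smul_apply, smul_eq_mul]
    refine ContinuousOn.mul (ContinuousOn.inv₀ ?_ ?_) ?_
    · exact ((h1.clm_apply h2).comp continuous_fst).continuousOn
    · exact fun p hp => fderiv_conjGrad_ne_zero a₁ (fderiv_blowEq_ne_zero ha₁ hsmooth hp.1)
    · have h3 : Continuous fun p : (Fin 6 → ℂ) × (Fin 3 → Fin 6 → ℂ) =>
          ((p.1, conjGrad a₁ p.1), p.2) := by fun_prop
      have h4 := continuous_rowDet.comp h3
      simp only [Function.comp_def] at h4
      exact h4.continuousOn
  form_act t z hz V hV := by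
    have hL := fderiv_blowEq_ne_zero ha₁ hsmooth hz
    have hn := fderiv_conjGrad_ne_zero a₁ hL
    have hz' := torusAct_mem_coneB ha₁ t z hz
    have hn' := fderiv_conjGrad_ne_zero a₁ (fderiv_blowEq_ne_zero ha₁ hsmooth hz')
    obtain ⟨m, hm⟩ : ∃ m, conjGrad a₁ (torusAct weightX4 t z) = torusAct weightX4 t m :=
      ⟨_, (torusAct_torusAct_inv t _).symm⟩
    rw [AlternatingMap.smul_apply, AlternatingMap.smul_apply, smul_eq_mul, smul_eq_mul]
    rw [hm] at hn' ⊢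
    rw [fderiv_blowEq_act ha₁] at hn' ⊢
    rw [rowDet_act]
    have hkey := rowDet_mul_eq (m := m) (n := conjGrad a₁ z) hL (fderiv_blowEq_eulerVec ha₁ hz 0)
      (fderiv_blowEq_eulerVec ha₁ hz 1) (V := V) hV
    have h4 : torusChar t ![4, 1] = (t 0 : ℂ) ^ 4 * t 1 := by
      rw [torusChar_fin_two]
      simp
    have hm0 := right_ne_zero_of_mul hn'
    have ht := (t 0).ne_zero
    rw [h4]
    field_simp
    linear_combination hkey
  form_add_euler z _ V a _ := by
    rw [AlternatingMap.smul_apply, AlternatingMap.smul_apply, rowDet_add_euler]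

/-- In a linear relation among the rows, the differential of the equation kills the coefficient of
the transversal vector. The two components normalised to `1` give a `2 × 2` system in the Euler
coefficients with invertible weight matrix, and the three chart components kill what remains. -/
theorem residueForm_ne_zero (ha₁ : a₁.IsHomogeneous 4) (hsmooth : IsSmoothCenter a₁)
    {c : SliceChart 3 weightX4 (coneB a₁)} (hc : IsAdapted c) {u : Fin 3 → ℂ} (hu : u ∈ c.target) :
    (residueForm ha₁ hsmooth).form (c.param u)
      (fun l => fderiv ℂ c.param u (Pi.single l 1)) ≠ 0 := by
  obtain ⟨p, i, j, hp, hdet, -⟩ := hc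
  set z := c.param u with hzdef
  have hz : z ∈ coneB a₁ := c.param_mem u hu
  have hL := fderiv_blowEq_ne_zero ha₁ hsmooth hz
  have hn := fderiv_conjGrad_ne_zero a₁ hL
  have hd : DifferentiableAt ℂ c.param u := SliceChart.differentiableAt_param hu
  have hN := c.isOpen_target.mem_nhds hu
  have hi : ∀ w, fderiv ℂ c.param u w i = 0 := fun w =>
    fderiv_apply_eq_of_eventually_const hd (Filter.mem_of_superset hN fun v hv => (hp v hv).2.1) w
  have hj : ∀ w, fderiv ℂ c.param u w j = 0 := fun w =>
    fderiv_apply_eq_of_eventually_const hd (Filter.mem_of_superset hN fun v hv => (hp v hv).2.2) w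
  have hl : ∀ l w, fderiv ℂ c.param u w (p l) = w l := fun l w =>
    fderiv_apply_eq_of_eventually_coord hd (Filter.mem_of_superset hN fun v hv => (hp v hv).1 l) w
  refine mul_ne_zero (inv_ne_zero hn) fun h0 => ?_
  have h0 : rowDet z (conjGrad a₁ z) (fun l => fderiv ℂ c.param u (Pi.single l 1)) = 0 := h0
  rw [rowDet_apply] at h0
  obtain ⟨v, hv, hv0⟩ := Matrix.exists_vecMul_eq_zero_iff.2 h0
  have hrow : v 0 • eulerVec weightX4 0 z + (v 1 • eulerVec weightX4 1 z +
      (v 2 • conjGrad a₁ z + ∑ l : Fin 3, v l.succ.succ.succ •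
        fderiv ℂ c.param u (Pi.single l 1))) = 0 := by
    rw [← hv0]
    ext k
    simp [Matrix.vecMul, dotProduct, rowMatrix, Fin.sum_univ_succ]
  have hT : ∀ w, fderiv ℂ (blowEq a₁) z (fderiv ℂ c.param u w) = 0 := fun w =>
    (residueForm ha₁ hsmooth).fderiv_mem hd (Filter.mem_of_superset hN fun v hv => c.param_mem v hv) w
  have hv2 : v 2 = 0 := by
    have := congrArg (fderiv ℂ (blowEq a₁) z) hrow
    simp only [map_add, map_smul, map_sum, hT, fderiv_blowEq_eulerVec ha₁ hz, mul_zero,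
      Finset.sum_const_zero, zero_add, add_zero, map_zero, smul_eq_mul] at this
    exact (mul_eq_zero.1 this).resolve_right hn
  have hzi : z i = 1 := (hp u hu).2.1
  have hzj : z j = 1 := (hp u hu).2.2
  have hei : v 0 * weightX4 i 0 + v 1 * weightX4 i 1 = 0 := by
    have := congrFun hrow i
    simpa [eulerVec, hzi, hi, hv2] using this
  have hej : v 0 * weightX4 j 0 + v 1 * weightX4 j 1 = 0 := by
    have := congrFun hrow j
    simpa [eulerVec, hzj, hj, hv2] using this
  have hdet' : ((weightX4 i 0 : ℂ) * weightX4 j 1 - weightX4 i 1 * weightX4 j 0) ≠ 0 := by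
    exact_mod_cast hdet
  have hv0' : v 0 = 0 := by
    refine (mul_eq_zero.1 ?_).resolve_right hdet'
    linear_combination (weightX4 j 1 : ℂ) * hei - (weightX4 i 1 : ℂ) * hej
  have hv1 : v 1 = 0 := by
    refine (mul_eq_zero.1 ?_).resolve_right hdet'
    linear_combination (weightX4 i 0 : ℂ) * hej - (weightX4 j 0 : ℂ) * hei
  have hvl : ∀ l : Fin 3, v l.succ.succ.succ = 0 := fun l => by
    have := congrFun hrow (p l)
    simpa [hv0', hv1, hv2, hl, Pi.single_apply] using this
  refine hv (funext fun k => ?_)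
  refine Fin.cases hv0' (fun k => ?_) k
  refine Fin.cases hv1 (fun k => ?_) k
  exact Fin.cases hv2 hvl k

theorem firstChernClassEq_BTilde (ha₁ : a₁.IsHomogeneous 4) (hsmooth : IsSmoothCenter a₁)
    [ChartedSpace (Fin 3 → ℂ) (BTilde a₁)] [IsQuotientManifold 3 weightX4 (coneB a₁)] :
    FirstChernClassEq 3 weightX4 (coneB a₁) ![4, 1] :=
  (residueForm ha₁ hsmooth).firstChernClassEq (𝒜 := sliceAtlasB ha₁ hsmooth) fun z _ hu =>
    residueForm_ne_zero ha₁ hsmooth (isAdapted_sliceAtlasB ha₁ hsmooth z) hu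

end Residue

/-! ### The universal property of the blow-up -/

section BlowUp

variable {a₁ : MvPolynomial (Fin 4) ℂ}

theorem blowDown_mkPt (ha₁ : a₁.IsHomogeneous 4) (z : coneB a₁) :
    blowDown ha₁ (mkPt weightX4 z) = mkPt weightP3 ⟨blowCoord z.1, blowCoord_mem ha₁ z.2⟩ := rfl

theorem exists_smul_of_mkPt_P3_eq {x x' : coneP3} (h : mkPt weightP3 x = mkPt weightP3 x') :
    ∃ c : ℂ, c ≠ 0 ∧ x'.1 = fun i => c * x.1 i := by
  obtain ⟨t, ht⟩ := mkPt_eq_mkPt_iff.1 h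
  exact ⟨t 0, (t 0).ne_zero, ht.trans (funext (torusAct_weightP3 t x.1))⟩

/-- Where `w ≠ 0`, both `x₁` and `a` are recovered from the image as `w x₁` and `a₁` divided by `w`.
-/
theorem mkPt_eq_of_blowDown_eq (ha₁ : a₁.IsHomogeneous 4) {z z' : coneB a₁} (h5 : z.1 5 ≠ 0)
    (h5' : z'.1 5 ≠ 0) (h : blowDown ha₁ (mkPt weightX4 z) = blowDown ha₁ (mkPt weightX4 z')) :
    mkPt weightX4 z = mkPt weightX4 z' := by
  rw [mkPt_BTilde_eq_iff ha₁]
  refine ⟨mkPt_P3_eq_iff.1 h, fun i => ?_⟩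
  obtain ⟨c, -, hc⟩ := exists_smul_of_mkPt_P3_eq h
  have hc : blowCoord z'.1 = fun i => c * blowCoord z.1 i := hc
  have h0 : z'.1 5 * z'.1 0 = c * (z.1 5 * z.1 0) := congrFun hc 0
  have h4 : z'.1 5 * z'.1 4 = c ^ 4 * (z.1 5 * z.1 4) := by
    rw [(mem_coneB_iff.1 z'.2).2, hc, eval_smul_of_isHomogeneous ha₁, (mem_coneB_iff.1 z.2).2]
  rw [hc]
  refine mul_left_cancel₀ (mul_ne_zero h5 h5') ?_
  linear_combination (z.1 5 * z.1 0 * blowCoord z.1 i ^ 3) * h4 -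
    (z.1 5 * z.1 4 * c ^ 3 * blowCoord z.1 i ^ 3) * h0

theorem mkPt_eq_of_blowDown_eq_mkPt (ha₁ : a₁.IsHomogeneous 4) {p p' : BTilde a₁} {x : coneP3}
    (hx : x.1 0 ≠ 0 ∨ MvPolynomial.eval x.1 a₁ ≠ 0) (h : blowDown ha₁ p = mkPt weightP3 x)
    (h' : blowDown ha₁ p' = mkPt weightP3 x) : p = p' := by
  have key : ∀ z : coneB a₁, blowDown ha₁ (mkPt weightX4 z) = mkPt weightP3 x → z.1 5 ≠ 0 := by
    intro z hz h5
    obtain ⟨c, -, hc⟩ := exists_smul_of_mkPt_P3_eq hz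
    have hc : x.1 = fun i => c * blowCoord z.1 i := hc
    rw [hc, eval_smul_of_isHomogeneous ha₁, ← (mem_coneB_iff.1 z.2).2] at hx
    simp [blowCoord, h5] at hx
  rw [← mkPt_out p] at h ⊢
  rw [← mkPt_out p'] at h' ⊢
  exact mkPt_eq_of_blowDown_eq ha₁ (key _ h) (key _ h') (h.trans h'.symm)

/-- If two lifts differed at a point, disjoint neighbourhoods of their values would keep them apart
on an open set. That set contains a point with `e ≠ 0`, which maps off the center, where the
blow-down is injective. -/
theorem eq_of_blowDown_comp_eq (ha₁ : a₁.IsHomogeneous 4) {k : ℕ} {Y : Type} [TopologicalSpace Y]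
    [ChartedSpace (Fin k → ℂ) Y] {ψ : Y → P3} (hψ : PullbackIdealInvertible a₁ k ψ)
    {W : Set Y} (hW : IsOpen W) {Φ Φ' : Y → BTilde a₁} (hΦ : ContinuousOn Φ W)
    (hΦ' : ContinuousOn Φ' W) (h : ∀ y ∈ W, blowDown ha₁ (Φ y) = ψ y)
    (h' : ∀ y ∈ W, blowDown ha₁ (Φ' y) = ψ y) : Set.EqOn Φ Φ' W := by
  intro y hy
  by_contra hne
  have := t2Space_BTilde ha₁
  obtain ⟨A, A', hA, hA', hyA, hyA', hdisj⟩ := t2_separation hne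
  obtain ⟨U, hU, hyU, s, u, v, e, -, -, -, -, h1, h2⟩ := hψ y
  have hV : W ∩ Φ ⁻¹' A ∩ (W ∩ Φ' ⁻¹' A') ∩ U ∈ 𝓝 y :=
    Filter.inter_mem (Filter.inter_mem ((hΦ.isOpen_inter_preimage hW hA).mem_nhds ⟨hy, hyA⟩)
      ((hΦ'.isOpen_inter_preimage hW hA').mem_nhds ⟨hy, hyA'⟩)) (hU.mem_nhds hyU)
  obtain ⟨V, hVs, hVo, hyV⟩ := mem_nhds_iff.1 hV
  obtain ⟨y', hy', he⟩ := h2 V hVo ⟨y, hyV⟩ fun q hq => (hVs hq).2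
  obtain ⟨⟨⟨hW', hA1⟩, -, hA2⟩, hU'⟩ := hVs hy'
  obtain ⟨⟨hs, hψs⟩, hs0, hsa, huv⟩ := h1 y' hU'
  have hx : (⟨s y', hs⟩ : coneP3).1 0 ≠ 0 ∨
      MvPolynomial.eval (⟨s y', hs⟩ : coneP3).1 a₁ ≠ 0 := by
    simp only [hs0, hsa]
    exact huv.imp (mul_ne_zero he) (mul_ne_zero he)
  have heq := mkPt_eq_of_blowDown_eq_mkPt ha₁ hx ((h y' hW').trans hψs) ((h' y' hW').trans hψs)
  exact Set.disjoint_left.1 hdisj hA1 (heq ▸ hA2)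

theorem vecCons_mem_coneB {x : Fin 4 → ℂ} {u v e : ℂ} (hx : x ∈ coneP3) (h0 : x 0 = e * u)
    (ha : MvPolynomial.eval x a₁ = e * v) (huv : u ≠ 0 ∨ v ≠ 0) :
    ![u, x 1, x 2, x 3, v, e] ∈ coneB a₁ ∧ blowCoord ![u, x 1, x 2, x 3, v, e] = x := by
  have hb : blowCoord ![u, x 1, x 2, x 3, v, e] = x := by
    ext i
    fin_cases i
    · exact h0.symm
    all_goals rfl
  refine ⟨mem_coneB_iff.2 ⟨mem_coneX4_iff.2 ⟨huv, ?_⟩, ?_⟩, hb⟩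
  · by_contra! h
    obtain ⟨h1, h2, h3, h5⟩ := h
    refine hx (funext fun i => ?_)
    fin_cases i
    · have h5 : e = 0 := h5
      exact h0.trans (by rw [h5, zero_mul]; rfl)
    · exact h1
    · exact h2
    · exact h3
  · rw [hb, ha]; rfl

variable [ChartedSpace (Fin 3 → ℂ) (BTilde a₁)] [IsQuotientManifold 3 weightX4 (coneB a₁)]

/-- The factorisations `x₁ = e u`, `a₁ = e v` are themselves homogeneous coordinates `[u : x₂ : x₃ :
x₄ : v : e]` of a lift. -/
theorem exists_local_lift (ha₁ : a₁.IsHomogeneous 4) (hsmooth : IsSmoothCenter a₁) {k : ℕ} {Y : Type}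
    [TopologicalSpace Y] [ChartedSpace (Fin k → ℂ) Y] {ψ : Y → P3}
    (hψ : PullbackIdealInvertible a₁ k ψ) (y₀ : Y) :
    ∃ U : Set Y, IsOpen U ∧ y₀ ∈ U ∧ ∃ Φ : Y → BTilde a₁,
      ContMDiffOn 𝓘(ℂ, Fin k → ℂ) 𝓘(ℂ, Fin 3 → ℂ) ω Φ U ∧ ∀ y ∈ U, blowDown ha₁ (Φ y) = ψ y := by
  obtain ⟨U, hU, hyU, s, u, v, e, hs, hu, hv, he, h1, -⟩ := hψ y₀
  have hmem : ∀ y ∈ U, ![u y, s y 1, s y 2, s y 3, v y, e y] ∈ coneB a₁ ∧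
      blowCoord ![u y, s y 1, s y 2, s y 3, v y, e y] = s y := fun y hy => by
    obtain ⟨⟨hsy, -⟩, hs0, hsa, huv⟩ := h1 y hy
    exact vecCons_mem_coneB hsy hs0 hsa huv
  classical
  let f : Y → coneB a₁ := fun y =>
    if h : y ∈ U then ⟨_, (hmem y h).1⟩ else ⟨_, (hmem y₀ hyU).1⟩
  have hf : ∀ y ∈ U, (f y).1 = ![u y, s y 1, s y 2, s y 3, v y, e y] := fun y hy => by
    simp only [f, dif_pos hy]
  refine ⟨U, hU, hyU, fun y => mkPt weightX4 (f y),
    (sliceAtlasB ha₁ hsmooth).contMDiffOn_mkPt_comp ?_, fun y hy => ?_⟩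
  · refine ContMDiffOn.congr ?_ hf
    rw [contMDiffOn_pi_space] at hs ⊢
    intro i
    fin_cases i
    · exact hu
    · exact hs 1
    · exact hs 2
    · exact hs 3
    · exact hv
    · exact he
  · obtain ⟨⟨hsy, hψy⟩, -⟩ := h1 y hy
    rw [hψy, blowDown_mkPt]
    congr 2
    rw [hf y hy, (hmem y hy).2]

theorem contMDiff_blowDown [ChartedSpace (Fin 3 → ℂ) P3] [IsQuotientManifold 3 weightP3 coneP3]
    (ha₁ : a₁.IsHomogeneous 4) (hsmooth : IsSmoothCenter a₁) :
    ContMDiff 𝓘(ℂ, Fin 3 → ℂ) 𝓘(ℂ, Fin 3 → ℂ) ω (blowDown ha₁) := by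
  intro x
  set c := (sliceAtlasB ha₁ hsmooth).chartOf x
  have hx : x ∈ c.source := (sliceAtlasB ha₁ hsmooth).mem_chartOf x
  have h1 : ContMDiffOn 𝓘(ℂ, Fin 3 → ℂ) 𝓘(ℂ, Fin 3 → ℂ) ω (fun y => mkPt weightP3
      (⟨blowCoord (c.sect y).1, blowCoord_mem ha₁ (c.sect y).2⟩ : coneP3)) c.source :=
    sliceAtlasP3.contMDiffOn_mkPt_comp
      (contDiff_blowCoord.contMDiff.comp_contMDiffOn SliceChart.contMDiffOn_sect)
  refine (h1.congr fun y hy => ?_).contMDiffAt (SliceChart.isOpen_source.mem_nhds hx)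
  conv_lhs => rw [← SliceChart.mkPt_sect hy]
  rfl

/-- Along a slice section one takes `u = x₁`, `v = a`, `e = w`; the equation of `B̃₃` and the
Stanley–Reisner condition are what is required. -/
theorem pullbackIdealInvertible_blowDown (ha₁ : a₁.IsHomogeneous 4) (hsmooth : IsSmoothCenter a₁) :
    PullbackIdealInvertible a₁ 3 (blowDown ha₁) := by
  intro x
  set c := (sliceAtlasB ha₁ hsmooth).chartOf x
  have hx : x ∈ c.source := (sliceAtlasB ha₁ hsmooth).mem_chartOf x
  have hs : ∀ i : Fin 6, ContMDiffOn 𝓘(ℂ, Fin 3 → ℂ) 𝓘(ℂ, ℂ) ω (fun y => (c.sect y).1 i) c.source :=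
    contMDiffOn_pi_space.1 SliceChart.contMDiffOn_sect
  refine ⟨c.source, SliceChart.isOpen_source, hx, fun y => blowCoord (c.sect y).1,
    fun y => (c.sect y).1 0, fun y => (c.sect y).1 4, fun y => (c.sect y).1 5,
    contDiff_blowCoord.contMDiff.comp_contMDiffOn SliceChart.contMDiffOn_sect, hs 0, hs 4, hs 5,
    fun y hy => ⟨⟨blowCoord_mem ha₁ (c.sect y).2, ?_⟩, rfl, (mem_coneB_iff.1 (c.sect y).2).2.symm,
      (mem_coneX4_iff.1 (c.sect y).2.1).1⟩, fun V hV hne hVc => ?_⟩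
  · conv_lhs => rw [← SliceChart.mkPt_sect hy]
    rfl
  · by_contra! h
    obtain ⟨y, hy⟩ := hne
    have hu := SliceChart.chart_mem_target (hVc hy)
    have hev : ∀ᶠ u in 𝓝 (c.chart y), u ∈ c.target ∧ c.param u 5 = 0 := by
      have hcont := (SliceChart.contMDiffOn_mkPt_lift (c := c)).continuousOn.isOpen_inter_preimage
        c.isOpen_target hV
      filter_upwards [hcont.mem_nhds ⟨hu, by
        rw [Set.mem_preimage, show mkPt weightX4 (c.lift (c.chart y)) = y from
          SliceChart.mkPt_sect (hVc hy)]; exact hy⟩] with u ⟨hut, huV⟩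
      refine ⟨hut, ?_⟩
      have := h _ huV
      rwa [SliceChart.sect_val (hVc huV), SliceChart.chart_mkPt_lift hut] at this
    -- In an adapted chart `w` is either constantly `1` or one of the coordinates, so it cannot
    -- vanish on a neighbourhood.
    have hc : IsAdapted c := isAdapted_sliceAtlasB ha₁ hsmooth x.out
    obtain ⟨p, i, j, hp, -, h5 | h5 | ⟨l, h5⟩⟩ := hc
    · have := (hp _ hu).2.1
      rw [← h5, hev.self_of_nhds.2] at this
      exact zero_ne_one this
    · have := (hp _ hu).2.2
      rw [← h5, hev.self_of_nhds.2] at this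
      exact zero_ne_one this
    · have hline : Filter.Tendsto (fun ε : ℂ => c.chart y + ε • (Pi.single l 1 : Fin 3 → ℂ)) (𝓝[≠] 0)
          (𝓝 (c.chart y)) := by
        have h1 : Continuous fun ε : ℂ => c.chart y + ε • (Pi.single l 1 : Fin 3 → ℂ) := by fun_prop
        simpa using (h1.tendsto 0).mono_left nhdsWithin_le_nhds
      obtain ⟨ε, hε, hε0⟩ := ((hline.eventually hev).and self_mem_nhdsWithin).exists
      have h1 := (hp _ hε.1).1 l
      have h0 := (hp _ hu).1 l
      rw [h5, hε.2] at h1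
      rw [h5, hev.self_of_nhds.2] at h0
      refine hε0 ?_
      simpa [← h0] using h1.symm

theorem isBlowUp_blowDown [ChartedSpace (Fin 3 → ℂ) P3] [IsQuotientManifold 3 weightP3 coneP3]
    (ha₁ : a₁.IsHomogeneous 4) (hsmooth : IsSmoothCenter a₁) : IsBlowUp a₁ (blowDown ha₁) := by
  refine ⟨contMDiff_blowDown ha₁ hsmooth, pullbackIdealInvertible_blowDown ha₁ hsmooth, ?_⟩
  intro k Y _ _ _ ψ _ hψ
  choose U hU hyU Φ hΦ hΦψ using exists_local_lift ha₁ hsmooth hψ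
  have hloc : ∀ y₀, ∀ y ∈ U y₀, Φ y y = Φ y₀ y := fun y₀ y hy =>
    eq_of_blowDown_comp_eq ha₁ hψ ((hU y).inter (hU y₀))
      ((hΦ y).continuousOn.mono Set.inter_subset_left)
      ((hΦ y₀).continuousOn.mono Set.inter_subset_right) (fun q hq => hΦψ y q hq.1)
      (fun q hq => hΦψ y₀ q hq.2) ⟨hyU y, hy⟩
  have hglob : ContMDiff 𝓘(ℂ, Fin k → ℂ) 𝓘(ℂ, Fin 3 → ℂ) ω fun y => Φ y y := fun y₀ =>
    ((hΦ y₀).congr (hloc y₀)).contMDiffAt ((hU y₀).mem_nhds (hyU y₀))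
  refine ⟨fun y => Φ y y, ⟨hglob, funext fun y => hΦψ y y (hyU y)⟩, ?_⟩
  rintro Ψ ⟨hΨ, hΨψ⟩
  funext y
  exact eq_of_blowDown_comp_eq ha₁ hψ isOpen_univ hΨ.continuous.continuousOn
    hglob.continuous.continuousOn (fun q _ => congrFun hΨψ q)
    (fun q _ => hΦψ q q (hyU q)) (Set.mem_univ y)

end BlowUp

/-! ### Logarithms and winding numbers -/

/-- The exponential is a covering of the punctured plane, so maps from a simply connected space
lift. -/
theorem exists_continuous_log {X : Type*} [TopologicalSpace X] [SimplyConnectedSpace X]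
    [LocallyPathConnectedSpace X] {g : X → ℂ} (hg : Continuous g) (h0 : ∀ x, g x ≠ 0) :
    ∃ f : X → ℂ, Continuous f ∧ ∀ x, g x = Complex.exp (f x) := by
  obtain ⟨x₀⟩ : Nonempty X := inferInstance
  obtain ⟨f, ⟨-, hf⟩, -⟩ := Complex.isCoveringMapOn_exp.existsUnique_continuousMap_lifts ⟨g, hg⟩
    (a₀ := x₀) (Complex.exp_log (h0 x₀)) h0
  exact ⟨f, f.continuous, fun x => (congrFun hf x).symm⟩

/-- The difference `f - g` takes values in the discrete fibre of `exp` over `1`, hence is constant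
on the line. -/
theorem sub_eq_sub_of_exp_eq {f g : ℝ → ℂ} (hf : Continuous f) (hg : Continuous g)
    (h : ∀ x, Complex.exp (f x) = Complex.exp (g x)) (a b : ℝ) : f a - f b = g a - g b := by
  have h1 : ∀ x, Complex.exp (f x - g x) = 1 := fun x => by
    rw [Complex.exp_sub, h, div_self (Complex.exp_ne_zero _)]
  have h2 : f a - g a = f b - g b :=
    Complex.isCoveringMap_exp.const_of_comp (g := fun x => f x - g x) (hf.sub hg)
      (fun x y => Subtype.ext ((h1 x).trans (h1 y).symm)) a b
  linear_combination h2

theorem HasWindingNumber.unique {h : ℂ → ℂ} {m m' : ℤ} (hm : HasWindingNumber h m)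
    (hm' : HasWindingNumber h m') : m = m' := by
  obtain ⟨ψ, hψ, h1, h2⟩ := hm
  obtain ⟨ψ', hψ', h1', h2'⟩ := hm'
  have := sub_eq_sub_of_exp_eq hψ hψ' (fun x => (h1 x).symm.trans (h1' x)) (2 * Real.pi) 0
  rw [h2, h2'] at this
  exact_mod_cast mul_left_cancel₀ Complex.two_pi_I_ne_zero this

/-! ### Frames and alternating forms -/

/-- The basis given by `d` independent vectors in `ℂᵈ`. -/
def frameBasis {d : ℕ} {e : Fin d → Fin d → ℂ} (he : LinearIndependent ℂ e) :
    Module.Basis (Fin d) ℂ (Fin d → ℂ) :=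
  Module.Basis.mk he (he.span_eq_top_of_card_eq_finrank' (by simp)).ge

theorem coe_frameBasis {d : ℕ} {e : Fin d → Fin d → ℂ} (he : LinearIndependent ℂ e) :
    ⇑(frameBasis he) = e :=
  Module.Basis.coe_mk he _

theorem alternatingMap_apply_sum {d : ℕ} (w : (Fin d → ℂ) [⋀^Fin d]→ₗ[ℂ] ℂ)
    {e : Fin d → Fin d → ℂ} (he : LinearIndependent ℂ e) (A : Matrix (Fin d) (Fin d) ℂ) :
    w (fun i => ∑ j, A i j • e j) = A.det * w e := by
  let b := frameBasis he
  have hb : ⇑b = e := coe_frameBasis he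
  have h1 : w = w e • b.det := by rw [← hb]; exact w.eq_smul_basis_det b
  have h2 : b.toMatrix (fun i => ∑ j, A i j • e j) = A.transpose := by
    ext i j
    rw [Module.Basis.toMatrix_apply, ← hb]
    simp [Finsupp.single_apply]
  have h3 : w (fun i => ∑ j, A i j • e j) = w e * b.det (fun i => ∑ j, A i j • e j) :=
    congrArg (fun w : (Fin d → ℂ) [⋀^Fin d]→ₗ[ℂ] ℂ => w (fun i => ∑ j, A i j • e j)) h1
  rw [h3, Module.Basis.det_apply, h2, Matrix.det_transpose, mul_comm]

theorem alternatingMap_apply_ne_zero {d : ℕ} {w : (Fin d → ℂ) [⋀^Fin d]→ₗ[ℂ] ℂ} (hw : w ≠ 0)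
    {e : Fin d → Fin d → ℂ} (he : LinearIndependent ℂ e) : w e ≠ 0 := by
  let b := frameBasis he
  have hb : ⇑b = e := coe_frameBasis he
  intro h0
  refine hw ?_
  rw [w.eq_smul_basis_det b, hb, h0, zero_smul]

theorem tangentBundle_apply_congr {d : ℕ} {M : Type} [TopologicalSpace M]
    [ChartedSpace (Fin d → ℂ) M] [IsManifold 𝓘(ℂ, Fin d → ℂ) ω M] {Z : Type} {π : Z → M}
    (F : ∀ x, {z : Z // π z = x} → ((TangentSpace 𝓘(ℂ, Fin d → ℂ) x) [⋀^Fin d]→ₗ[ℂ] ℂ)) {x x' : M} (hx : x = x')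
    {z : Z} (hz : π z = x) {f : Fin d → TangentSpace 𝓘(ℂ, Fin d → ℂ) x}
    {w : Fin d → TangentSpace 𝓘(ℂ, Fin d → ℂ) x'}
    (h : ∀ i, (⟨x, f i⟩ : TangentBundle 𝓘(ℂ, Fin d → ℂ) M) = ⟨x', w i⟩) :
    F x ⟨z, hz⟩ f = F x' ⟨z, hz.trans hx⟩ w := by
  subst hx
  have : f = w := funext fun i => by simpa using h i
  rw [this]

/-- A family that stays in one slice chart inherits the coordinate frame of that chart, pushed
forward by its inverse. -/
theorem SliceChart.exists_frame {d n r : ℕ} {Q : Fin n → Fin r → ℤ} {Z : Set (Fin n → ℂ)}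
    [ChartedSpace (Fin d → ℂ) (TorusQuotient Q Z)] [IsQuotientManifold d Q Z]
    (c : SliceChart d Q Z) {Y : Type*} [TopologicalSpace Y] {z : Y → Z} (hz : Continuous z)
    (hmem : ∀ y, (z y).1 ∈ c.dom) :
    ∃ e : Fin d → ∀ y, TangentSpace 𝓘(ℂ, Fin d → ℂ) (mkPt Q (z y)),
      (∀ i, Continuous fun y =>
        (⟨mkPt Q (z y), e i y⟩ : TangentBundle 𝓘(ℂ, Fin d → ℂ) (TorusQuotient Q Z))) ∧
      ∀ y, LinearIndependent ℂ fun i => e i y := by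
  have hu : ∀ y, c.coord (z y).1 ∈ c.target := fun y => c.coord_mem _ (hmem y)
  have hmk : ∀ y, mkPt Q (c.lift (c.coord (z y).1)) = mkPt Q (z y) := fun y => by
    rw [← chart_mkPt (hmem y)]
    exact mkPt_sect (mkPt_mem_source_iff.2 (hmem y))
  refine ⟨fun i y => (mfderiv 𝓘(ℂ, Fin d → ℂ) 𝓘(ℂ, Fin d → ℂ) (fun u => mkPt Q (c.lift u))
    (c.coord (z y).1) (Pi.single i 1 : Fin d → ℂ) :), fun i => ?_, fun y => ?_⟩
  · have h1 := (contMDiffOn_mkPt_lift (c := c)).continuousOn_tangentMapWithin (by simp)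
      c.isOpen_target.uniqueMDiffOn
    have h2 : Continuous fun y => (tangentBundleModelSpaceHomeomorph 𝓘(ℂ, Fin d → ℂ)).symm
        (c.coord (z y).1, (Pi.single i 1 : Fin d → ℂ)) :=
      (Homeomorph.continuous _).comp ((c.contDiffOn_coord.continuousOn.comp_continuous
        (continuous_subtype_val.comp hz) hmem).prodMk continuous_const)
    have h3 := h1.comp_continuous h2 hu
    refine h3.congr fun y => ?_
    refine Eq.trans ?_ (tangentBundle_mk_congr (hmk y) _)
    change (⟨_, mfderivWithin 𝓘(ℂ, Fin d → ℂ) 𝓘(ℂ, Fin d → ℂ) (fun u => mkPt Q (c.lift u)) c.target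
      (c.coord (z y).1) (Pi.single i 1 : Fin d → ℂ)⟩ :
      TangentBundle 𝓘(ℂ, Fin d → ℂ) (TorusQuotient Q Z)) = _
    rw [mfderivWithin_of_isOpen c.isOpen_target (hu y)]
  · have hb : LinearIndependent ℂ fun i : Fin d => (Pi.single i 1 : Fin d → ℂ) := by
      convert (Pi.basisFun ℂ (Fin d)).linearIndependent with i
      simp
    refine LinearIndependent.of_comp (c.dchart (mkPt Q (c.lift (c.coord (z y).1))) :
      (Fin d → ℂ) →ₗ[ℂ] (Fin d → ℂ)) ?_
    convert hb with i
    exact dchart_mfderiv_mkPt_lift (hu y) _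

/-! ### The exceptional curves -/

section ExceptionalCurve

variable {a₁ : MvPolynomial (Fin 4) ℂ}

theorem exceptional_mem (x : centerCone a₁) {s t : ℂ} (h : s ≠ 0 ∨ t ≠ 0) :
    ![s, x.1 1, x.1 2, x.1 3, t, 0] ∈ coneB a₁ :=
  (vecCons_mem_coneB x.2.1 (x.2.2.1.trans (zero_mul s).symm) (x.2.2.2.trans (zero_mul t).symm) h).1

/-- The point with affine coordinate `t` of the exceptional curve over `x`. -/
def northPt (x : centerCone a₁) (t : ℂ) : coneB a₁ :=
  ⟨![1, x.1 1, x.1 2, x.1 3, t, 0], exceptional_mem x (Or.inl one_ne_zero)⟩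

/-- The point with affine coordinate `u` at infinity of the exceptional curve over `x`. -/
def southPt (x : centerCone a₁) (u : ℂ) : coneB a₁ :=
  ⟨![u, x.1 1, x.1 2, x.1 3, 1, 0], exceptional_mem x (Or.inr one_ne_zero)⟩

theorem blowCoord_northPt (x : centerCone a₁) (t : ℂ) : blowCoord (northPt x t).1 = x.1 :=
  (vecCons_mem_coneB x.2.1 (x.2.2.1.trans (zero_mul 1).symm) (x.2.2.2.trans (zero_mul t).symm)
    (Or.inl one_ne_zero)).2

theorem blowCoord_southPt (x : centerCone a₁) (u : ℂ) : blowCoord (southPt x u).1 = x.1 :=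
  (vecCons_mem_coneB x.2.1 (x.2.2.1.trans (zero_mul u).symm) (x.2.2.2.trans (zero_mul 1).symm)
    (Or.inr one_ne_zero)).2

theorem contDiff_northPt (x : centerCone a₁) : ContDiff ℂ ω fun t => (northPt x t).1 := by
  rw [contDiff_pi]
  intro i
  fin_cases i
  on_goal 5 => exact contDiff_id
  all_goals exact contDiff_const

theorem contDiff_southPt (x : centerCone a₁) : ContDiff ℂ ω fun u => (southPt x u).1 := by
  rw [contDiff_pi]
  intro i
  fin_cases i
  on_goal 1 => exact contDiff_id
  all_goals exact contDiff_const

theorem continuous_northPt (x : centerCone a₁) : Continuous (northPt x) :=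
  (contDiff_northPt x).continuous.subtype_mk _

theorem continuous_southPt (x : centerCone a₁) : Continuous (southPt x) :=
  (contDiff_southPt x).continuous.subtype_mk _

/-- The element `(1, t)` multiplies `x₁` and `a` by `t` and fixes the rest, as `w = 0`. This is the
gluing of the two affine lines, and the character `(4, 1)` on it equals `t`. -/
theorem northPt_eq_torusAct (x : centerCone a₁) {t : ℂ} (ht : t ≠ 0) :
    (northPt x t).1 = torusAct weightX4 ![1, Units.mk0 t ht] (southPt x t⁻¹).1 := by
  apply fin_six_ext
  · rw [torusAct_weightX4_zero]; simp [northPt, southPt, ht]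
  · rw [torusAct_weightX4_one]; simp [northPt, southPt]
  · rw [torusAct_weightX4_two]; simp [northPt, southPt]
  · rw [torusAct_weightX4_three]; simp [northPt, southPt]
  · rw [torusAct_weightX4_four]; simp [northPt, southPt]
  · rw [torusAct_weightX4_five]; simp [northPt, southPt]

theorem mkPt_southPt_inv (x : centerCone a₁) {t : ℂ} (ht : t ≠ 0) :
    mkPt weightX4 (southPt x t⁻¹) = mkPt weightX4 (northPt x t) :=
  mkPt_eq_mkPt_iff.2 ⟨_, northPt_eq_torusAct x ht⟩

/-- The exceptional curve over the point `x`. -/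
def exceptionalSphere (x : centerCone a₁) : SphereMap (BTilde a₁) where
  north t := mkPt weightX4 (northPt x t)
  south u := mkPt weightX4 (southPt x u)
  continuous_north := continuous_mkPt.comp (continuous_northPt x)
  continuous_south := continuous_mkPt.comp (continuous_southPt x)
  glue _ ht := mkPt_southPt_inv x ht

theorem northPt_injective (ha₁ : a₁.IsHomogeneous 4) (x : centerCone a₁) :
    Function.Injective (exceptionalSphere x).north := by
  intro t t' h
  obtain ⟨i, hi⟩ := exists_ne_zero_of_mem_coneP3 x.2.1
  have := ((mkPt_BTilde_eq_iff ha₁).1 h).2 i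
  rw [blowCoord_northPt, blowCoord_northPt] at this
  have h2 : t' * 1 = t * 1 := mul_right_cancel₀ (pow_ne_zero 3 hi) this
  simpa using h2.symm

theorem southPt_injective (ha₁ : a₁.IsHomogeneous 4) (x : centerCone a₁) :
    Function.Injective (exceptionalSphere x).south := by
  intro u u' h
  obtain ⟨i, hi⟩ := exists_ne_zero_of_mem_coneP3 x.2.1
  have := ((mkPt_BTilde_eq_iff ha₁).1 h).2 i
  rw [blowCoord_southPt, blowCoord_southPt] at this
  have h2 : 1 * u = 1 * u' := mul_right_cancel₀ (pow_ne_zero 3 hi) this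
  simpa using h2

theorem south_zero_notMem_range_north (ha₁ : a₁.IsHomogeneous 4) (x : centerCone a₁) :
    (exceptionalSphere x).south 0 ∉ Set.range (exceptionalSphere x).north := by
  rintro ⟨t, h⟩
  obtain ⟨i, hi⟩ := exists_ne_zero_of_mem_coneP3 x.2.1
  have := ((mkPt_BTilde_eq_iff ha₁).1 h).2 i
  rw [blowCoord_northPt, blowCoord_southPt] at this
  have h2 : (1 : ℂ) * 1 = t * 0 := mul_right_cancel₀ (pow_ne_zero 3 hi) this
  simp at h2

theorem range_union_range_exceptionalSphere (ha₁ : a₁.IsHomogeneous 4) {x : centerCone a₁}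
    (hx : x.1 = ![0, 0, 0, 1]) :
    Set.range (exceptionalSphere x).north ∪ Set.range (exceptionalSphere x).south = cycleC a₁ := by
  have hx1 : x.1 1 = 0 := by rw [hx]; rfl
  have hx2 : x.1 2 = 0 := by rw [hx]; rfl
  refine Set.Subset.antisymm (Set.union_subset ?_ ?_) ?_
  · rintro _ ⟨t, rfl⟩
    exact ⟨northPt x t, rfl, hx1, hx2, rfl⟩
  · rintro _ ⟨u, rfl⟩
    exact ⟨southPt x u, rfl, hx1, hx2, rfl⟩
  · rintro _ ⟨z, rfl, h1, h2, h5⟩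
    obtain ⟨h04, h1235⟩ := mem_coneX4_iff.1 z.2.1
    have h3 : z.1 3 ≠ 0 := by tauto
    have hb : blowCoord z.1 = fun i => z.1 3 * x.1 i := by
      rw [hx]
      ext i
      fin_cases i <;> simp [blowCoord, h1, h2, h5]
    -- The base point has entries `0` and `1`. The parameters chosen below are the invariant `a /
    -- (x₁ x₄³)` of weight `(0, 0)`, and its reciprocal where `x₁ = 0`.
    have hx3 : ∀ i, x.1 i ^ 3 = x.1 i := fun i => by
      rw [hx]
      fin_cases i <;> simp
    by_cases h0 : z.1 0 = 0
    · have h4 : z.1 4 ≠ 0 := h04.resolve_left (not_not.2 h0)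
      refine Or.inr ⟨z.1 0 * z.1 3 ^ 3 / z.1 4, (mkPt_BTilde_eq_iff ha₁).2 ⟨fun i j => ?_, fun i => ?_⟩⟩
      · rw [blowCoord_southPt, hb]; ring
      · rw [blowCoord_southPt, hb, mul_pow, hx3]
        change z.1 4 * (z.1 0 * z.1 3 ^ 3 / z.1 4) * x.1 i = 1 * z.1 0 * (z.1 3 ^ 3 * x.1 i)
        field_simp
    · refine Or.inl ⟨z.1 4 / (z.1 0 * z.1 3 ^ 3), (mkPt_BTilde_eq_iff ha₁).2 ⟨fun i j => ?_, fun i => ?_⟩⟩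
      · rw [blowCoord_northPt, hb]; ring
      · rw [blowCoord_northPt, hb, mul_pow, hx3]
        change z.1 4 * 1 * x.1 i = z.1 4 / (z.1 0 * z.1 3 ^ 3) * z.1 0 * (z.1 3 ^ 3 * x.1 i)
        field_simp

theorem mem_coneB_of_mul_add_mul {ah atl : MvPolynomial (Fin 4) ℂ}
    (h : a₁ = MvPolynomial.X 1 * ah + MvPolynomial.X 2 * atl) {z : Fin 6 → ℂ} (hz : z ∈ coneX4)
    (h1 : z 1 = 0) (h2 : z 2 = 0) (h5 : z 5 = 0) : z ∈ coneB a₁ := by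
  refine ⟨hz, ?_⟩
  simp [h, h1, h2, h5]

theorem mem_centerCone_of_mul_add_mul {ah atl : MvPolynomial (Fin 4) ℂ}
    (h : a₁ = MvPolynomial.X 1 * ah + MvPolynomial.X 2 * atl) : ![0, 0, 0, 1] ∈ centerCone a₁ := by
  refine ⟨fun h0 => one_ne_zero (congrFun h0 3), rfl, ?_⟩
  simp [h]

variable [ChartedSpace (Fin 3 → ℂ) (BTilde a₁)] [IsQuotientManifold 3 weightX4 (coneB a₁)]

theorem exists_frame_northPt (ha₁ : a₁.IsHomogeneous 4) (hsmooth : IsSmoothCenter a₁)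
    (x : centerCone a₁) :
    ∃ e : Fin 3 → ∀ t, TangentSpace 𝓘(ℂ, Fin 3 → ℂ) (mkPt weightX4 (northPt x t)),
      (∀ i, Continuous fun t => (⟨mkPt weightX4 (northPt x t), e i t⟩ :
        TangentBundle 𝓘(ℂ, Fin 3 → ℂ) (BTilde a₁))) ∧
      ∀ t, LinearIndependent ℂ fun i => e i t := by
  obtain ⟨c, -, hc⟩ := exists_chart_along_fiber ha₁ hsmooth x.2 (Or.inl rfl) (northPt x 0)
  exact c.exists_frame (continuous_northPt x) fun t =>
    hc _ (blowCoord_northPt x t) one_ne_zero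

theorem exists_frame_southPt (ha₁ : a₁.IsHomogeneous 4) (hsmooth : IsSmoothCenter a₁)
    (x : centerCone a₁) :
    ∃ f : Fin 3 → ∀ u, TangentSpace 𝓘(ℂ, Fin 3 → ℂ) (mkPt weightX4 (southPt x u)),
      (∀ i, Continuous fun u => (⟨mkPt weightX4 (southPt x u), f i u⟩ :
        TangentBundle 𝓘(ℂ, Fin 3 → ℂ) (BTilde a₁))) ∧
      ∀ u, LinearIndependent ℂ fun i => f i u := by
  obtain ⟨c, -, hc⟩ := exists_chart_along_fiber ha₁ hsmooth x.2 (Or.inr rfl) (northPt x 0)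
  exact c.exists_frame (continuous_southPt x) fun u =>
    hc _ (blowCoord_southPt x u) one_ne_zero

/-- Evaluating the form of weight `(4, 1)` on the two frames gives nowhere vanishing functions `gN`
and `gS` on `ℂ`, with `t * gS t⁻¹ = det A * gN t` on the equator. Both have logarithms on the whole
plane and so no winding; all of it comes from the factor `t`. -/
theorem hasWindingNumber_det (ha₁ : a₁.IsHomogeneous 4) (hsmooth : IsSmoothCenter a₁)
    (x : centerCone a₁)
    {e : Fin 3 → ∀ t, TangentSpace 𝓘(ℂ, Fin 3 → ℂ) ((exceptionalSphere x).north t)}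
    {f : Fin 3 → ∀ u, TangentSpace 𝓘(ℂ, Fin 3 → ℂ) ((exceptionalSphere x).south u)}
    {A : ℂ → Matrix (Fin 3) (Fin 3) ℂ}
    (he : ∀ i, Continuous fun t => (⟨(exceptionalSphere x).north t, e i t⟩ :
      TangentBundle 𝓘(ℂ, Fin 3 → ℂ) (BTilde a₁)))
    (hf : ∀ i, Continuous fun u => (⟨(exceptionalSphere x).south u, f i u⟩ :
      TangentBundle 𝓘(ℂ, Fin 3 → ℂ) (BTilde a₁)))
    (hei : ∀ t, LinearIndependent ℂ fun i => e i t)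
    (hfi : ∀ u, LinearIndependent ℂ fun i => f i u)
    (hA : ∀ t : ℂ, ‖t‖ = 1 → ∀ i, (⟨(exceptionalSphere x).south t⁻¹, f i t⁻¹⟩ :
      TangentBundle 𝓘(ℂ, Fin 3 → ℂ) (BTilde a₁)) =
        ⟨(exceptionalSphere x).north t, ∑ j, A t i j • e j t⟩) :
    HasWindingNumber (fun t => (A t).det) 1 := by
  obtain ⟨Ω, hΩ0, hΩact, hΩc⟩ := firstChernClassEq_BTilde ha₁ hsmooth
  let gN : ℂ → ℂ := fun t => Ω (mkPt weightX4 (northPt x t)) ⟨northPt x t, rfl⟩ fun i => e i t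
  let gS : ℂ → ℂ := fun u => Ω (mkPt weightX4 (southPt x u)) ⟨southPt x u, rfl⟩ fun i => f i u
  have hgN : Continuous gN := hΩc ℂ (northPt x) e (continuous_northPt x) he
  have hgS : Continuous gS := hΩc ℂ (southPt x) f (continuous_southPt x) hf
  have hN0 : ∀ t, gN t ≠ 0 := fun t => alternatingMap_apply_ne_zero (hΩ0 _ _) (hei t)
  have hS0 : ∀ u, gS u ≠ 0 := fun u => alternatingMap_apply_ne_zero (hΩ0 _ _) (hfi u)
  have key : ∀ t : ℂ, ‖t‖ = 1 → t * gS t⁻¹ = (A t).det * gN t := by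
    intro t ht
    have ht0 : t ≠ 0 := norm_ne_zero_iff.1 (by rw [ht]; exact one_ne_zero)
    have h1 : gS t⁻¹ = (A t).det * Ω (mkPt weightX4 (northPt x t))
        ⟨southPt x t⁻¹, mkPt_southPt_inv x ht0⟩ fun i => e i t := by
      exact (tangentBundle_apply_congr Ω (mkPt_southPt_inv x ht0) rfl (hA t ht)).trans
        (alternatingMap_apply_sum _ (hei t) (A t))
    have h2 : gN t = t * Ω (mkPt weightX4 (northPt x t))
        ⟨southPt x t⁻¹, mkPt_southPt_inv x ht0⟩ fun i => e i t := by
      have h := hΩact (mkPt weightX4 (northPt x t))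
        ⟨southPt x t⁻¹, mkPt_southPt_inv x ht0⟩ ⟨northPt x t, rfl⟩
        ![1, Units.mk0 t ht0] (fun i => congrFun (northPt_eq_torusAct x ht0) i)
      have hχ : torusChar ![1, Units.mk0 t ht0] ![4, 1] = t := by simp [torusChar_fin_two]
      rw [hχ] at h
      exact congrArg (fun w : (Fin 3 → ℂ) [⋀^Fin 3]→ₗ[ℂ] ℂ => w fun i => e i t) h
    rw [h1, h2]
    ring
  obtain ⟨a, ha, hga⟩ := exists_continuous_log hgN hN0
  obtain ⟨b, hb, hgb⟩ := exists_continuous_log hgS hS0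
  refine ⟨fun θ => θ * Complex.I + b (Complex.exp (θ * Complex.I))⁻¹ -
    a (Complex.exp (θ * Complex.I)), ?_, fun θ => ?_, ?_⟩
  · have h1 : Continuous fun θ : ℝ => Complex.exp (θ * Complex.I) := by fun_prop
    have h2 : Continuous fun θ : ℝ => (Complex.exp (θ * Complex.I))⁻¹ :=
      h1.inv₀ fun θ => Complex.exp_ne_zero _
    exact ((by fun_prop : Continuous fun θ : ℝ => (θ : ℂ) * Complex.I).add (hb.comp h2)).sub
      (ha.comp h1)
  · rw [Complex.exp_sub, Complex.exp_add, ← hga, ← hgb, eq_div_iff (hN0 _)]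
    exact (key _ (Complex.norm_exp_ofReal_mul_I θ)).symm
  · have h1 : Complex.exp ((2 * Real.pi : ℝ) * Complex.I) = 1 := by
      push_cast
      exact Complex.exp_two_pi_mul_I
    simp only [h1]
    simp

theorem hasC1Integral_exceptionalSphere (ha₁ : a₁.IsHomogeneous 4) (hsmooth : IsSmoothCenter a₁)
    (x : centerCone a₁) (m : ℤ) : (exceptionalSphere x).HasC1Integral 3 m ↔ m = 1 := by
  constructor
  · rintro ⟨e, f, A, he, hf, hei, hfi, hA, hm⟩
    exact hm.unique (hasWindingNumber_det ha₁ hsmooth x he hf hei hfi hA)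
  · rintro rfl
    obtain ⟨e, he, hei⟩ := exists_frame_northPt ha₁ hsmooth x
    obtain ⟨f, hf, hfi⟩ := exists_frame_southPt ha₁ hsmooth x
    let b : ∀ t : ℂ, Module.Basis (Fin 3) ℂ (Fin 3 → ℂ) := fun t => frameBasis (hei t)
    have hA : ∀ t : ℂ, ‖t‖ = 1 → ∀ i, (⟨(exceptionalSphere x).south t⁻¹, f i t⁻¹⟩ :
        TangentBundle 𝓘(ℂ, Fin 3 → ℂ) (BTilde a₁)) = ⟨(exceptionalSphere x).north t,
          ∑ j, (Matrix.of fun i j => (b t).repr (f i t⁻¹) j) i j • e j t⟩ := by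
      intro t ht i
      have ht0 : t ≠ 0 := norm_ne_zero_iff.1 (by rw [ht]; exact one_ne_zero)
      refine (tangentBundle_mk_congr ((exceptionalSphere x).glue t ht0) (f i t⁻¹)).trans ?_
      congr 1
      have := (b t).sum_repr (f i t⁻¹)
      rw [show ⇑(b t) = fun i => e i t from coe_frameBasis (hei t)] at this
      exact this.symm
    exact ⟨e, f, _, he, hf, hei, hfi, hA, hasWindingNumber_det ha₁ hsmooth x he hf hei hfi hA⟩

theorem parametrizes_cycleC (ha₁ : a₁.IsHomogeneous 4) (hsmooth : IsSmoothCenter a₁)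
    {x : centerCone a₁} (hx : x.1 = ![0, 0, 0, 1]) :
    (exceptionalSphere x).Parametrizes 3 (cycleC a₁) :=
  ⟨(sliceAtlasB ha₁ hsmooth).contMDiff_mkPt_comp (contDiff_northPt x).contMDiff,
    (sliceAtlasB ha₁ hsmooth).contMDiff_mkPt_comp (contDiff_southPt x).contMDiff,
    northPt_injective ha₁ x, southPt_injective ha₁ x, south_zero_notMem_range_north ha₁ x,
    range_union_range_exceptionalSphere ha₁ hx⟩

theorem exists_sphere_cycleC (ha₁ : a₁.IsHomogeneous 4) (hsmooth : IsSmoothCenter a₁)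
    {ah atl : MvPolynomial (Fin 4) ℂ} (h : a₁ = MvPolynomial.X 1 * ah + MvPolynomial.X 2 * atl) :
    ∃ σ : SphereMap (BTilde a₁), σ.Parametrizes 3 (cycleC a₁) ∧
      ∀ m : ℤ, σ.HasC1Integral 3 m ↔ m = 1 :=
  ⟨exceptionalSphere ⟨_, mem_centerCone_of_mul_add_mul h⟩, parametrizes_cycleC ha₁ hsmooth rfl,
    hasC1Integral_exceptionalSphere ha₁ hsmooth _⟩

end ExceptionalCurve

/-! ### Square roots of the anticanonical bundle -/

section LineBundle

open Bundle

/-- Near `x₀` the quotient `h / h x₀` stays in the slit plane, where the logarithm is continuous;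
one root of `h x₀` fixes the constant. -/
theorem exists_continuousOn_sqrt {X : Type*} [TopologicalSpace X] {B : Set X} (hB : IsOpen B)
    {h : X → ℂ} (hh : ContinuousOn h B) (h0 : ∀ x ∈ B, h x ≠ 0) {x₀ : X} (hx₀ : x₀ ∈ B) :
    ∃ U ⊆ B, IsOpen U ∧ x₀ ∈ U ∧ ∃ r : X → ℂ, ContinuousOn r U ∧ ∀ x ∈ U, r x ^ 2 = h x := by
  obtain ⟨c, hc⟩ := IsAlgClosed.exists_pow_nat_eq (h x₀) two_pos
  have hd : ContinuousOn (fun x => h x / h x₀) B := hh.div_const _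
  refine ⟨B ∩ (fun x => h x / h x₀) ⁻¹' Complex.slitPlane, Set.inter_subset_left,
    hd.isOpen_inter_preimage hB Complex.isOpen_slitPlane, ⟨hx₀, ?_⟩,
    fun x => c * Complex.exp (Complex.log (h x / h x₀) / 2), ?_, ?_⟩
  · rw [Set.mem_preimage, div_self (h0 x₀ hx₀)]
    exact Complex.one_mem_slitPlane
  · refine continuousOn_const.mul (Complex.continuous_exp.comp_continuousOn ?_)
    exact ((hd.mono Set.inter_subset_left).clog fun x hx => hx.2).div_const 2
  · rintro x ⟨hxB, -⟩
    rw [mul_pow, hc, ← Complex.exp_nat_mul, Nat.cast_ofNat, mul_div_cancel₀ _ two_ne_zero,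
      Complex.exp_log (div_ne_zero (h0 x hxB) (h0 x₀ hx₀)), mul_div_cancel₀ _ (h0 x₀ hx₀)]

variable {X : Type*} [TopologicalSpace X] {E : X → Type*} [∀ x, AddCommMonoid (E x)]
  [∀ x, Module ℂ (E x)] [∀ x, TopologicalSpace (E x)] [TopologicalSpace (TotalSpace ℂ E)]
  [FiberBundle ℂ E] [VectorBundle ℂ ℂ E]

/-- In a trivialisation with a local root `r` of the value of `q` on the unit section, the vectors
with `q = 1` have coordinate `c` with `c r = ±1`. So they form a two-sheeted cover. -/
theorem isCoveringMap_of_quadratic (q : ∀ x, E x → ℂ)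
    (hq : Continuous fun v : TotalSpace ℂ E => q v.1 v.2)
    (hsmul : ∀ x (c : ℂ) (l : E x), q x (c • l) = c ^ 2 * q x l)
    (h0 : ∀ x (l : E x), l ≠ 0 → q x l ≠ 0) :
    IsCoveringMap (fun v : {v : TotalSpace ℂ E // q v.1 v.2 = 1} => v.1.1) ∧
      ∀ x, ∃ l : E x, q x l = 1 := by
  have key : ∀ x₀ : X, ∃ U : Set X, IsOpen U ∧ x₀ ∈ U ∧ U ⊆ (trivializationAt ℂ E x₀).baseSet ∧
      ∃ r : X → ℂ, ContinuousOn r U ∧ ∀ x ∈ U, r x ≠ 0 ∧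
        ∀ c, q x ((trivializationAt ℂ E x₀).symm x c) = (c * r x) ^ 2 := by
    intro x₀
    set e := trivializationAt ℂ E x₀
    have hone : ∀ x ∈ e.baseSet, e.symm x (1 : ℂ) ≠ 0 := fun x hx h =>
      one_ne_zero ((e.linearEquivAt ℂ x hx).symm.map_eq_zero_iff.1 h)
    have hh : ContinuousOn (fun x => q x (e.symm x (1 : ℂ))) e.baseSet := by
      have h1 : ContinuousOn (fun x => (⟨x, e.symm x (1 : ℂ)⟩ : TotalSpace ℂ E)) e.baseSet :=
        e.continuousOn_symm.comp (f := fun x => (x, (1 : ℂ))) (by fun_prop) fun x hx => ⟨hx, trivial⟩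
      exact hq.comp_continuousOn h1
    obtain ⟨U, hUB, hU, hxU, r, hr, hr2⟩ := exists_continuousOn_sqrt e.open_baseSet hh
      (fun x hx => h0 x _ (hone x hx)) (mem_baseSet_trivializationAt ℂ E x₀)
    refine ⟨U, hU, hxU, hUB, r, hr, fun x hx => ⟨fun hrx => ?_, fun c => ?_⟩⟩
    · refine h0 x _ (hone x (hUB hx)) ?_
      rw [← hr2 x hx, hrx]
      simp
    · have h1 : e.symm x c = c • e.symm x (1 : ℂ) := by
        have h2 := (e.linearEquivAt ℂ x (hUB hx)).symm.map_smul c (1 : ℂ)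
        rw [smul_eq_mul, mul_one] at h2
        exact h2
      rw [h1, hsmul, mul_pow, hr2 x hx]
  refine ⟨fun x₀ => ?_, fun x₀ => ?_⟩
  · obtain ⟨U, hU, hxU, hUB, r, hr, hr2⟩ := key x₀
    set e := trivializationAt ℂ E x₀
    have hπ : Continuous fun v : {v : TotalSpace ℂ E // q v.1 v.2 = 1} => v.1.1 :=
      (FiberBundle.continuous_proj ℂ E).comp continuous_subtype_val
    let I : Set ℂ := {1, -1}
    have hI : ∀ μ, μ ∈ I ↔ μ ^ 2 = 1 := fun μ => sq_eq_one_iff.symm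
    have hmul : ∀ v : TotalSpace ℂ E, v.1 ∈ U → q v.1 v.2 = ((e v).2 * r v.1) ^ 2 := by
      intro v hv
      rw [← (hr2 v.1 hv).2, e.symm_proj_apply v (hUB hv)]
    have heq : ∀ x ∈ U, ∀ μ ∈ I, q x (e.symm x (μ / r x)) = 1 := by
      intro x hx μ hμ
      rw [(hr2 x hx).2, div_mul_cancel₀ _ (hr2 x hx).1, (hI μ).1 hμ]
    let H : ((fun v : {v : TotalSpace ℂ E // q v.1 v.2 = 1} => v.1.1) ⁻¹' U) ≃ₜ U × I :=
      { toFun v := (⟨v.1.1.1, v.2⟩, ⟨(e v.1.1).2 * r v.1.1.1,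
          (hI _).2 ((hmul v.1.1 v.2).symm.trans v.1.2)⟩)
        invFun w := ⟨⟨⟨w.1.1, e.symm w.1.1 (w.2.1 / r w.1.1)⟩, heq _ w.1.2 _ w.2.2⟩, w.1.2⟩
        left_inv v := by
          refine Subtype.ext (Subtype.ext ?_)
          have hv := (hr2 v.1.1.1 v.2).1
          simp only [mul_div_cancel_right₀ _ hv]
          exact Bundle.TotalSpace.ext rfl (heq_of_eq (e.symm_proj_apply v.1.1 (hUB v.2)))
        right_inv w := by
          refine Prod.ext rfl (Subtype.ext ?_)
          have hw := (hr2 w.1.1 w.1.2).1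
          simp only [e.apply_mk_symm (hUB w.1.2), div_mul_cancel₀ _ hw]
        continuous_toFun := by
          have h1 : Continuous fun v : ((fun v : {v : TotalSpace ℂ E // q v.1 v.2 = 1} => v.1.1) ⁻¹' U) =>
              v.1.1 := continuous_subtype_val.comp continuous_subtype_val
          have h2 := hπ.comp (continuous_subtype_val (p := fun v => v ∈ (fun v :
            {v : TotalSpace ℂ E // q v.1 v.2 = 1} => v.1.1) ⁻¹' U))
          refine (h2.subtype_mk _).prodMk (Continuous.subtype_mk (Continuous.mul ?_ ?_) _)
          · exact continuous_snd.comp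
              (e.continuousOn.comp_continuous h1 fun v => e.mem_source.2 (hUB v.2))
          · exact hr.comp_continuous h2 fun v => v.2
        continuous_invFun := by
          have h1 : Continuous fun w : U × I => w.1.1 := continuous_subtype_val.comp continuous_fst
          have h2 : Continuous fun w : U × I => w.2.1 / r w.1.1 :=
            (continuous_subtype_val.comp continuous_snd).div
              (hr.comp_continuous h1 fun w => w.1.2) fun w => (hr2 _ w.1.2).1
          exact ((e.continuousOn_symm.comp_continuous (h1.prodMk h2) fun w =>
            ⟨hUB w.1.2, trivial⟩).subtype_mk _).subtype_mk _ }
    have hev : IsEvenlyCovered (fun v : {v : TotalSpace ℂ E // q v.1 v.2 = 1} => v.1.1) x₀ I :=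
      ⟨inferInstance, U, hxU, hU, hU.preimage hπ, H, fun v => rfl⟩
    exact hev.to_isEvenlyCovered_preimage
  · obtain ⟨U, hU, hxU, hUB, r, hr, hr2⟩ := key x₀
    refine ⟨(trivializationAt ℂ E x₀).symm x₀ (r x₀)⁻¹, ?_⟩
    rw [(hr2 x₀ hxU).2, inv_mul_cancel₀ (hr2 x₀ hxU).1, one_pow]

theorem exists_continuous_ratio {M Y : Type*} [TopologicalSpace Y] [TopologicalSpace M]
    {L : M → Type*} [∀ x, AddCommMonoid (L x)]
    [∀ x, Module ℂ (L x)] [∀ x, TopologicalSpace (L x)] [TopologicalSpace (TotalSpace ℂ L)]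
    [FiberBundle ℂ L] [VectorBundle ℂ ℂ L] {p : Y → M} {s s' : ∀ y, L (p y)}
    (hs : Continuous fun y => (⟨p y, s y⟩ : TotalSpace ℂ L))
    (hs' : Continuous fun y => (⟨p y, s' y⟩ : TotalSpace ℂ L)) (h0 : ∀ y, s' y ≠ 0) :
    ∃ c : Y → ℂ, Continuous c ∧ ∀ y, s y = c y • s' y := by
  have key : ∀ y₀ : Y, ∃ U : Set Y, IsOpen U ∧ y₀ ∈ U ∧ ∃ c : Y → ℂ, ContinuousOn c U ∧
      ∀ y ∈ U, s y = c y • s' y := by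
    intro y₀
    set e := trivializationAt ℂ L (p y₀)
    have hp : Continuous p := (FiberBundle.continuous_proj ℂ L).comp hs
    have hU : IsOpen (p ⁻¹' e.baseSet) := e.open_baseSet.preimage hp
    have hco : ∀ {s : ∀ y, L (p y)}, Continuous (fun y => (⟨p y, s y⟩ : TotalSpace ℂ L)) →
        ContinuousOn (fun y => (e ⟨p y, s y⟩).2) (p ⁻¹' e.baseSet) := fun hs =>
      continuous_snd.comp_continuousOn
        (e.continuousOn.comp hs.continuousOn fun y hy => e.mem_source.2 hy)
    have hlin : ∀ {y} (hy : p y ∈ e.baseSet) (l : L (p y)),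
        (e ⟨p y, l⟩).2 = e.linearEquivAt ℂ (p y) hy l := fun _ _ => rfl
    have hne : ∀ y ∈ p ⁻¹' e.baseSet, (e ⟨p y, s' y⟩).2 ≠ 0 := fun y hy h => by
      rw [hlin hy] at h
      exact h0 y ((e.linearEquivAt ℂ (p y) hy).map_eq_zero_iff.1 h)
    refine ⟨_, hU, mem_baseSet_trivializationAt ℂ L (p y₀), _, (hco hs).div (hco hs') hne,
      fun y hy => (e.linearEquivAt ℂ (p y) hy).injective ?_⟩
    rw [map_smul, smul_eq_mul, ← hlin hy, ← hlin hy, Pi.div_apply, div_mul_cancel₀ _ (hne y hy)]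
  choose U hU hyU c hc hcs using key
  have huniq : ∀ y (a b : ℂ), s y = a • s' y → s y = b • s' y → a = b := by
    intro y a b ha hb
    set e := trivializationAt ℂ L (p y)
    have hy : p y ∈ e.baseSet := mem_baseSet_trivializationAt ℂ L (p y)
    have h1 := congrArg (e.linearEquivAt ℂ (p y) hy) (ha.symm.trans hb)
    rw [map_smul, map_smul, smul_eq_mul, smul_eq_mul] at h1
    exact mul_right_cancel₀ (fun h => h0 y ((e.linearEquivAt ℂ (p y) hy).map_eq_zero_iff.1 h)) h1
  refine ⟨fun y => c y y, continuous_iff_continuousAt.2 fun y => ?_, fun y => hcs y y (hyU y)⟩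
  refine ((hc y).continuousAt ((hU y).mem_nhds (hyU y))).congr ?_
  filter_upwards [(hU y).mem_nhds (hyU y)] with y' hy'
  exact huniq y' _ _ (hcs y y' hy') (hcs y' y' (hyU y'))

/-- Over a simply connected base the identity lifts to the double cover of vectors with `q = 1`. -/
theorem exists_section_of_quadratic [SimplyConnectedSpace X] [LocallyPathConnectedSpace X]
    (q : ∀ x, E x → ℂ) (hq : Continuous fun v : TotalSpace ℂ E => q v.1 v.2)
    (hsmul : ∀ x (c : ℂ) (l : E x), q x (c • l) = c ^ 2 * q x l)
    (h0 : ∀ x (l : E x), l ≠ 0 → q x l ≠ 0) :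
    ∃ s : ∀ x, E x, Continuous (fun x => (⟨x, s x⟩ : TotalSpace ℂ E)) ∧ ∀ x, q x (s x) = 1 := by
  obtain ⟨hcov, hne⟩ := isCoveringMap_of_quadratic q hq hsmul h0
  obtain ⟨x₀⟩ : Nonempty X := inferInstance
  obtain ⟨l₀, hl₀⟩ := hne x₀
  obtain ⟨F, ⟨-, hF⟩, -⟩ := hcov.existsUnique_continuousMap_lifts (ContinuousMap.id X) x₀
    ⟨⟨x₀, l₀⟩, hl₀⟩ rfl
  have hF : ∀ x, (F x).1.1 = x := fun x => congrFun hF x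
  have hs : ∀ x, ∃ l : E x, (⟨x, l⟩ : TotalSpace ℂ E) = (F x).1 ∧ q x l = 1 := by
    intro x
    obtain ⟨v, hv⟩ : ∃ v, F x = v := ⟨_, rfl⟩
    have h := hF x
    rw [hv] at h ⊢
    obtain ⟨⟨y, l⟩, hl⟩ := v
    obtain rfl : y = x := h
    exact ⟨l, rfl, hl⟩
  choose s hs using hs
  refine ⟨s, ?_, fun x => (hs x).2⟩
  simp only [fun x => (hs x).1]
  exact continuous_subtype_val.comp F.continuous

end LineBundle

/-! ### The blow-up is not spin -/

/-- Along the loop a logarithm of the root would grow by `π i`, so the root would return with the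
opposite sign. -/
theorem not_exists_sqrt_circle {c : Circle → ℂ} (hc : Continuous c) : ¬ ∀ w, c w ^ 2 = (w : ℂ) := by
  intro h
  have h0 : ∀ θ : ℝ, c (Circle.exp θ) ≠ 0 := fun θ h0 => by
    have := h (Circle.exp θ)
    rw [h0] at this
    exact (Circle.exp θ).coe_ne_zero (by rw [← this]; simp)
  obtain ⟨γ, hγ, hcγ⟩ := exists_continuous_log (hc.comp Circle.exp.continuous) h0
  have h1 := sub_eq_sub_of_exp_eq (f := fun θ => 2 * γ θ) (g := fun θ => θ * Complex.I) (by fun_prop)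
    (by fun_prop) (fun θ => by
      rw [← Circle.coe_exp, ← h, ← Nat.cast_ofNat, Complex.exp_nat_mul]
      exact congrArg (· ^ 2) (hcγ θ).symm) (2 * Real.pi) 0
  have h2 : γ (2 * Real.pi) = γ 0 + Real.pi * Complex.I := by
    push_cast at h1
    linear_combination h1 / 2
  have h3 := hcγ (2 * Real.pi)
  have h4 := hcγ 0
  rw [h2, Complex.exp_add, Complex.exp_pi_mul_I, ← h4] at h3
  have h5 : Circle.exp (2 * Real.pi) = Circle.exp 0 := by rw [Circle.exp_two_pi, Circle.exp_zero]
  simp only [Function.comp_apply, h5] at h3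
  exact h0 0 (by linear_combination h3 / 2)

/-- The line `x₁ = x₄ = 0` meets the quartic: on it `a₁` becomes a polynomial in one variable, which
has a root unless it is a nonzero constant `c`. In that case `a₁(0, s, 1, 0) = s⁴ c` for `s ≠ 0`,
and `s → 0` gives a zero at infinity. -/
theorem exists_mem_centerCone {a₁ : MvPolynomial (Fin 4) ℂ} (ha₁ : a₁.IsHomogeneous 4) :
    ∃ x, x ∈ centerCone a₁ := by
  let f : Polynomial ℂ := MvPolynomial.aeval ![0, 1, Polynomial.X, 0] a₁
  have hf : ∀ t, f.eval t = MvPolynomial.eval ![0, 1, t, 0] a₁ := by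
    intro t
    have h1 : (Polynomial.evalRingHom t).comp
        (MvPolynomial.aeval ![0, 1, Polynomial.X, 0] : MvPolynomial (Fin 4) ℂ →ₐ[ℂ] _).toRingHom =
        MvPolynomial.eval ![0, 1, t, 0] := by
      refine MvPolynomial.ringHom_ext (fun c => by simp) fun i => ?_
      fin_cases i <;> simp
    exact congrArg (fun φ : MvPolynomial (Fin 4) ℂ →+* ℂ => φ a₁) h1
  by_cases hdeg : f.degree = 0
  · refine ⟨![0, 0, 1, 0], fun h => one_ne_zero (congrFun h 2), rfl, ?_⟩
    obtain ⟨c, hc⟩ : ∃ c, f = Polynomial.C c := ⟨_, Polynomial.eq_C_of_degree_eq_zero hdeg⟩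
    have h1 : ∀ s : ℂ, s ≠ 0 → MvPolynomial.eval ![0, s, 1, 0] a₁ = s ^ 4 * c := by
      intro s hs
      have h2 : (![0, s, 1, 0] : Fin 4 → ℂ) = fun i => s * (![0, 1, s⁻¹, 0] : Fin 4 → ℂ) i := by
        ext i
        fin_cases i <;> simp [hs]
      rw [h2, eval_smul_of_isHomogeneous ha₁, ← hf, hc, Polynomial.eval_C]
    have h2 : Continuous fun s : ℂ => MvPolynomial.eval ![0, s, 1, 0] a₁ := by
      refine (contDiff_eval a₁).continuous.comp (continuous_pi fun i => ?_)
      fin_cases i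
      on_goal 2 => exact continuous_id
      all_goals exact continuous_const
    have h3 : Filter.Tendsto (fun s : ℂ => s ^ 4 * c) (𝓝[≠] 0) (𝓝 0) := by
      have : Continuous fun s : ℂ => s ^ 4 * c := by fun_prop
      simpa using (this.tendsto 0).mono_left nhdsWithin_le_nhds
    refine tendsto_nhds_unique ((h2.tendsto 0).mono_left nhdsWithin_le_nhds) (h3.congr' ?_)
    filter_upwards [self_mem_nhdsWithin] with s hs using (h1 s hs).symm
  · obtain ⟨t, ht⟩ := IsAlgClosed.exists_root f hdeg
    exact ⟨![0, 1, t, 0], fun h => one_ne_zero (congrFun h 1), rfl, (hf t).symm.trans ht⟩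

theorem alternatingMap_ext_of_linearIndependent {d : ℕ} {w w' : (Fin d → ℂ) [⋀^Fin d]→ₗ[ℂ] ℂ}
    {e : Fin d → Fin d → ℂ} (he : LinearIndependent ℂ e) (h : w e = w' e) : w = w' := by
  rw [w.eq_smul_basis_det (frameBasis he), w'.eq_smul_basis_det (frameBasis he), coe_frameBasis, h]

theorem bilin_smul_smul {V W : Type*} [AddCommGroup V] [Module ℂ V] [AddCommGroup W] [Module ℂ W]
    (B : V →ₗ[ℂ] V →ₗ[ℂ] W) (c : ℂ) (l : V) : B (c • l) (c • l) = c ^ 2 • B l l := by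
  rw [map_smul, map_smul, LinearMap.smul_apply, smul_smul, sq]

theorem exists_transport {d : ℕ} {M : Type} [TopologicalSpace M] [ChartedSpace (Fin d → ℂ) M]
    {L : ComplexLineBundle M}
    {B : ∀ x : M, L.fiber x →ₗ[ℂ] L.fiber x →ₗ[ℂ]
      ((TangentSpace 𝓘(ℂ, Fin d → ℂ) x) [⋀^Fin d]→ₗ[ℂ] ℂ)} {Z : Type} {ρ : Z → M}
    (Ω : ∀ x, {z : Z // ρ z = x} → ((TangentSpace 𝓘(ℂ, Fin d → ℂ) x) [⋀^Fin d]→ₗ[ℂ] ℂ)) {x x' : M}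
    (hx : x = x') {z : Z} (hz : ρ z = x) {l : L.fiber x} (h : B x l l = Ω x ⟨z, hz⟩) :
    ∃ l' : L.fiber x', (⟨x', l'⟩ : Bundle.TotalSpace ℂ L.fiber) = ⟨x, l⟩ ∧
      B x' l' l' = Ω x' ⟨z, hz.trans hx⟩ := by
  subst hx
  exact ⟨l, rfl, h⟩

section NotSpin

open Bundle

variable {d : ℕ} {M : Type} [TopologicalSpace M] [ChartedSpace (Fin d → ℂ) M]
  [IsManifold 𝓘(ℂ, Fin d → ℂ) ω M]

/-- On the pullback of `L`, the quotient of `B l l` by `w`, measured on the frame, is a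
nondegenerate quadratic function. A section on which it is `1` is a root of `w`, since a top form is
determined by its value on a frame. -/
theorem exists_root_along {L : ComplexLineBundle M}
    {B : ∀ x : M, L.fiber x →ₗ[ℂ] L.fiber x →ₗ[ℂ]
      ((TangentSpace 𝓘(ℂ, Fin d → ℂ) x) [⋀^Fin d]→ₗ[ℂ] ℂ)}
    (hB0 : ∀ (x : M) (l : L.fiber x), l ≠ 0 → B x l l ≠ 0)
    (hB : ∀ (Y : Type) [TopologicalSpace Y] (p : Y → M) (l l' : ∀ y, L.fiber (p y))
      (v : Fin d → ∀ y, TangentSpace 𝓘(ℂ, Fin d → ℂ) (p y)),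
      Continuous (fun y => (⟨p y, l y⟩ : Bundle.TotalSpace ℂ L.fiber)) →
      Continuous (fun y => (⟨p y, l' y⟩ : Bundle.TotalSpace ℂ L.fiber)) →
      (∀ i, Continuous (fun y => (⟨p y, v i y⟩ : TangentBundle 𝓘(ℂ, Fin d → ℂ) M))) →
      Continuous (fun y => B (p y) (l y) (l' y) (fun i => v i y)))
    {X : Type} [TopologicalSpace X] [SimplyConnectedSpace X] [LocallyPathConnectedSpace X]
    {p : X → M} (hp : Continuous p)
    {w : ∀ t, (TangentSpace 𝓘(ℂ, Fin d → ℂ) (p t)) [⋀^Fin d]→ₗ[ℂ] ℂ} (hw0 : ∀ t, w t ≠ 0)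
    {e : Fin d → ∀ t, TangentSpace 𝓘(ℂ, Fin d → ℂ) (p t)}
    (he : ∀ i, Continuous fun t => (⟨p t, e i t⟩ : TangentBundle 𝓘(ℂ, Fin d → ℂ) M))
    (hei : ∀ t, LinearIndependent ℂ fun i => e i t) (hw : Continuous fun t => w t fun i => e i t) :
    ∃ l : ∀ t, L.fiber (p t), Continuous (fun t => (⟨p t, l t⟩ : TotalSpace ℂ L.fiber)) ∧
      ∀ t, B (p t) (l t) (l t) = w t := by
  have hwe : ∀ t, w t (fun i => e i t) ≠ 0 := fun t => alternatingMap_apply_ne_zero (hw0 t) (hei t)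
  let f : C(X, M) := ⟨p, hp⟩
  let q : ∀ t, ((f : X → M) *ᵖ L.fiber) t → ℂ := fun t l =>
    B (p t) l l (fun i => e i t) / w t fun i => e i t
  have hq : Continuous fun v : TotalSpace ℂ ((f : X → M) *ᵖ L.fiber) => q v.1 v.2 := by
    have hproj := Pullback.continuous_proj ℂ L.fiber f
    have hlift := Pullback.continuous_lift ℂ L.fiber f
    refine (hB _ (fun v : TotalSpace ℂ ((f : X → M) *ᵖ L.fiber) => p v.1) (fun v => v.2)
      (fun v => v.2) (fun i v => e i v.1) hlift hlift fun i => ?_).div (hw.comp hproj)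
      fun v => hwe v.1
    exact (he i).comp hproj
  obtain ⟨s, hs, hs1⟩ := exists_section_of_quadratic q hq (fun t c l => by
    have h := congrArg (fun b : (TangentSpace 𝓘(ℂ, Fin d → ℂ) (p t)) [⋀^Fin d]→ₗ[ℂ] ℂ =>
      b (fun i => e i t) / w t (fun i => e i t)) (bilin_smul_smul (B (p t)) c l)
    exact h.trans (mul_div_assoc _ _ _))
    (fun t l hl => div_ne_zero (alternatingMap_apply_ne_zero (hB0 _ _ hl) (hei t)) (hwe t))
  refine ⟨s, (Pullback.continuous_lift ℂ L.fiber f).comp hs, fun t => ?_⟩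
  exact alternatingMap_ext_of_linearIndependent (hei t) ((div_eq_one_iff_eq (hwe t)).1 (hs1 t))

end NotSpin

theorem not_isSpin_BTilde {a₁ : MvPolynomial (Fin 4) ℂ} (ha₁ : a₁.IsHomogeneous 4)
    (hsmooth : IsSmoothCenter a₁)
    [ChartedSpace (Fin 3 → ℂ) (BTilde a₁)] [IsQuotientManifold 3 weightX4 (coneB a₁)] :
    ¬ IsSpin 3 (BTilde a₁) := by
  rintro ⟨L, B, hB0, hB⟩
  obtain ⟨Ω, hΩ0, hΩact, hΩc⟩ := firstChernClassEq_BTilde ha₁ hsmooth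
  obtain ⟨x, hx⟩ := exists_mem_centerCone ha₁
  let x : centerCone a₁ := ⟨x, hx⟩
  obtain ⟨e, he, hei⟩ := exists_frame_northPt ha₁ hsmooth x
  obtain ⟨f, hf, hfi⟩ := exists_frame_southPt ha₁ hsmooth x
  obtain ⟨lN, hlN, hBN⟩ := exists_root_along hB0 hB (exceptionalSphere x).continuous_north
    (w := fun t => Ω _ ⟨northPt x t, rfl⟩) (fun t => hΩ0 _ _) he hei
    (hΩc ℂ (northPt x) e (continuous_northPt x) he)
  obtain ⟨lS, hlS, hBS⟩ := exists_root_along hB0 hB (exceptionalSphere x).continuous_south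
    (w := fun t => Ω _ ⟨southPt x t, rfl⟩) (fun t => hΩ0 _ _) hf hfi
    (hΩc ℂ (southPt x) f (continuous_southPt x) hf)
  -- The southern root at `w⁻¹` sits over the same point as the northern root at `w`, but in a fibre
  -- named differently; it is transported so that both can be compared.
  choose sS hsS hBsS using fun w : Circle =>
    exists_transport Ω (mkPt_southPt_inv x w.coe_ne_zero) rfl (hBS (w : ℂ)⁻¹)
  have hsS0 : ∀ w, sS w ≠ 0 := fun w h0 => by
    have := hBsS w
    rw [h0, map_zero] at this
    exact hΩ0 _ _ this.symm
  have hcoe : Continuous fun w : Circle => (w : ℂ) := by fun_prop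
  obtain ⟨c, hc, hcs⟩ := exists_continuous_ratio (Y := Circle)
    (p := fun w => mkPt weightX4 (northPt x w)) (s := fun w => lN w) (s' := sS)
    (hlN.comp hcoe)
    (by
      simp only [hsS]
      exact hlS.comp (hcoe.inv₀ Circle.coe_ne_zero)) hsS0
  -- With `lN = c sS` on the equator, the squares of `lN` and `sS` are the form at the northern and
  -- southern coordinates, which differ by the character value `w`; hence `c² = w`.
  refine not_exists_sqrt_circle hc fun w => ?_
  have h1 : B _ (lN w) (lN w) = (c w ^ 2) • B _ (sS w) (sS w) :=
    (congrArg (fun l => B (mkPt weightX4 (northPt x w)) l l) (hcs w)).trans (bilin_smul_smul _ _ _)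
  have h2 := hΩact (mkPt weightX4 (northPt x w)) ⟨southPt x (w : ℂ)⁻¹, mkPt_southPt_inv x w.coe_ne_zero⟩
    ⟨northPt x w, rfl⟩ ![1, Units.mk0 (w : ℂ) w.coe_ne_zero]
    (fun i => congrFun (northPt_eq_torusAct x w.coe_ne_zero) i)
  have hχ : torusChar ![1, Units.mk0 (w : ℂ) w.coe_ne_zero] ![4, 1] = w := by
    simp [torusChar_fin_two]
  rw [hχ] at h2
  have h3 := (h1.symm.trans (hBN w)).trans h2
  rw [hBsS w] at h3
  exact smul_left_injective ℂ (hΩ0 _ _) h3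

/-! ### The intersection form -/

section IntersectionForm

theorem divisorClass_eq : divisorClass 0 = clsH - clsE ∧ divisorClass 1 = clsH ∧
    divisorClass 2 = clsH ∧ divisorClass 3 = clsH ∧ divisorClass 4 = 4 * clsH - clsE ∧
    divisorClass 5 = clsE := by
  have h4 : (4 : ℚ) • clsH = 4 * clsH := by
    rw [MvPolynomial.smul_eq_C_mul]; rfl
  refine ⟨?_, ?_, ?_, ?_, ?_, ?_⟩ <;> simp [divisorClass, weightX4, h4]

theorem prod_stanleyReisner_zero_four :
    ∏ i ∈ ({0, 4} : Finset (Fin 6)), divisorClass i = (clsH - clsE) * (4 * clsH - clsE) := by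
  obtain ⟨h0, h1, h2, h3, h4, h5⟩ := divisorClass_eq
  rw [Finset.prod_pair (by decide), h0, h4]

theorem prod_stanleyReisner_one_two_three_five :
    ∏ i ∈ ({1, 2, 3, 5} : Finset (Fin 6)), divisorClass i = clsH ^ 3 * clsE := by
  obtain ⟨h0, h1, h2, h3, h4, h5⟩ := divisorClass_eq
  rw [Finset.prod_insert (by decide), Finset.prod_insert (by decide),
    Finset.prod_pair (by decide), h1, h2, h3, h5]
  ring

theorem isHomogeneous_clsH_pow_mul_clsE_pow (a b : ℕ) :
    (clsH ^ a * clsE ^ b).IsHomogeneous (a + b) := by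
  simpa [clsH, clsE] using ((MvPolynomial.isHomogeneous_X ℚ (0 : Fin 2)).pow a).mul
    ((MvPolynomial.isHomogeneous_X ℚ (1 : Fin 2)).pow b)

/-- Linear functionals on `ℚ[H, E]` are determined by their values on the products `Hᵃ Eᵇ`. -/
theorem linearMap_ext_clsH_clsE {f g : MvPolynomial (Fin 2) ℚ →ₗ[ℚ] ℚ}
    (h : ∀ a b : ℕ, f (clsH ^ a * clsE ^ b) = g (clsH ^ a * clsE ^ b)) : f = g := by
  refine (MvPolynomial.basisMonomials (Fin 2) ℚ).ext fun m => ?_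
  have hm : MvPolynomial.basisMonomials (Fin 2) ℚ m = clsH ^ m 0 * clsE ^ m 1 := by
    rw [MvPolynomial.coe_basisMonomials]
    change MvPolynomial.monomial m 1 = _
    rw [MvPolynomial.monomial_eq, map_one, one_mul,
      Finsupp.prod_fintype _ _ (by simp), Fin.prod_univ_two]
    rfl
  rw [hm, h]

/-- The intersection number of `a` copies of `H` and `b` copies of `E`. -/
def intersectionNumber (a b : ℕ) : ℚ :=
  if a = 4 ∧ b = 0 then 1 / 4 else if a = 2 ∧ b = 2 then -1 else
  if a = 1 ∧ b = 3 then -5 else if a = 0 ∧ b = 4 then -21 else 0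

theorem intersectionNumber_of_add_ne {a b : ℕ} (h : a + b ≠ 4) : intersectionNumber a b = 0 := by
  rw [intersectionNumber, if_neg (by omega), if_neg (by omega), if_neg (by omega),
    if_neg (by omega)]

/-- The intersection form of `X₄`. -/
def intersectionForm : MvPolynomial (Fin 2) ℚ →ₗ[ℚ] ℚ :=
  (MvPolynomial.basisMonomials (Fin 2) ℚ).constr ℚ fun m => intersectionNumber (m 0) (m 1)

theorem intersectionForm_apply (a b : ℕ) :
    intersectionForm (clsH ^ a * clsE ^ b) = intersectionNumber a b := by
  have hm : clsH ^ a * clsE ^ b =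
      MvPolynomial.basisMonomials (Fin 2) ℚ (Finsupp.single 0 a + Finsupp.single 1 b) := by
    rw [MvPolynomial.coe_basisMonomials]
    change _ = MvPolynomial.monomial (Finsupp.single 0 a + Finsupp.single 1 b) 1
    rw [clsH, clsE, MvPolynomial.X_pow_eq_monomial,
      MvPolynomial.X_pow_eq_monomial, MvPolynomial.monomial_mul, one_mul]
  rw [hm, intersectionForm, Module.Basis.constr_basis]
  simp

/-- It suffices to take monomials `P`. Only degree `2` contributes, and there the three identities
are the recursion `4 (HᵃEᵇ)H² - 5 (HᵃEᵇ)HE + (HᵃEᵇ)E² = 0`. -/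
theorem intersectionForm_mul_zero_four (P : MvPolynomial (Fin 2) ℚ) :
    intersectionForm (P * ((clsH - clsE) * (4 * clsH - clsE))) = 0 := by
  suffices h : intersectionForm ∘ₗ
      LinearMap.mulRight ℚ ((clsH - clsE) * (4 * clsH - clsE)) = 0 from LinearMap.congr_fun h P
  refine linearMap_ext_clsH_clsE fun a b => ?_
  have h : clsH ^ a * clsE ^ b * ((clsH - clsE) * (4 * clsH - clsE)) =
      (4 : ℚ) • (clsH ^ (a + 2) * clsE ^ b) - (5 : ℚ) • (clsH ^ (a + 1) * clsE ^ (b + 1)) +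
        clsH ^ a * clsE ^ (b + 2) := by
    simp only [MvPolynomial.smul_eq_C_mul, map_ofNat]
    ring
  rw [LinearMap.comp_apply, LinearMap.mulRight_apply, h, map_add, map_sub, map_smul, map_smul,
    intersectionForm_apply, intersectionForm_apply, intersectionForm_apply, LinearMap.zero_apply]
  by_cases hab : a + b = 2
  · obtain rfl : b = 2 - a := by omega
    have ha : a ≤ 2 := by omega
    interval_cases a <;> norm_num [intersectionNumber]
  · rw [intersectionNumber_of_add_ne (by omega), intersectionNumber_of_add_ne (by omega),
      intersectionNumber_of_add_ne (by omega)]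
    simp

theorem intersectionForm_mul_one_two_three_five (P : MvPolynomial (Fin 2) ℚ) :
    intersectionForm (P * (clsH ^ 3 * clsE)) = 0 := by
  suffices h : intersectionForm ∘ₗ LinearMap.mulRight ℚ (clsH ^ 3 * clsE) = 0 from
    LinearMap.congr_fun h P
  refine linearMap_ext_clsH_clsE fun a b => ?_
  have h : clsH ^ a * clsE ^ b * (clsH ^ 3 * clsE) = clsH ^ (a + 3) * clsE ^ (b + 1) := by ring
  rw [LinearMap.comp_apply, LinearMap.mulRight_apply, h, intersectionForm_apply,
    LinearMap.zero_apply]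
  by_cases hab : a + b = 0
  · obtain ⟨rfl, rfl⟩ : a = 0 ∧ b = 0 := by omega
    norm_num [intersectionNumber]
  · exact intersectionNumber_of_add_ne (by omega)

theorem intersectionForm_of_isHomogeneous {k : ℕ} (hk : k ≠ 4) {P : MvPolynomial (Fin 2) ℚ}
    (hP : P.IsHomogeneous k) : intersectionForm P = 0 := by
  rw [intersectionForm, Module.Basis.constr_apply]
  refine Finset.sum_eq_zero fun m hm => ?_
  have hc : P.coeff m ≠ 0 := Finsupp.mem_support_iff.1 hm
  have hdeg : m 0 + m 1 = k := by
    rw [← hP hc, Finsupp.weight_apply, Finsupp.sum_fintype _ _ (by simp), Fin.sum_univ_two]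
    simp
  change _ • intersectionNumber (m 0) (m 1) = 0
  rw [intersectionNumber_of_add_ne (by omega), smul_zero]

theorem intersectionForm_values : intersectionForm (clsH ^ 4) = 1 / 4 ∧
    intersectionForm (clsH ^ 3 * clsE) = 0 ∧ intersectionForm (clsH ^ 2 * clsE ^ 2) = -1 := by
  have h4 := intersectionForm_apply 4 0
  have h3 := intersectionForm_apply 3 1
  have h2 := intersectionForm_apply 2 2
  rw [pow_zero, mul_one] at h4
  rw [pow_one] at h3
  rw [h4, h3, h2]
  norm_num [intersectionNumber]

theorem prod_compl_zero {j : Fin 6} (hj : j = 1 ∨ j = 2 ∨ j = 3) :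
    ∏ k ∈ ({0, j} : Finset (Fin 6))ᶜ, divisorClass k =
      (4 : ℚ) • (clsH ^ 3 * clsE) - clsH ^ 2 * clsE ^ 2 := by
  obtain ⟨h0, h1, h2, h3, h4, h5⟩ := divisorClass_eq
  simp only [MvPolynomial.smul_eq_C_mul, map_ofNat]
  rcases hj with rfl | rfl | rfl
  · rw [show ({0, 1} : Finset (Fin 6))ᶜ = {2, 3, 4, 5} by decide, Finset.prod_insert (by decide),
      Finset.prod_insert (by decide), Finset.prod_pair (by decide), h2, h3, h4, h5]
    ring
  · rw [show ({0, 2} : Finset (Fin 6))ᶜ = {1, 3, 4, 5} by decide, Finset.prod_insert (by decide),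
      Finset.prod_insert (by decide), Finset.prod_pair (by decide), h1, h3, h4, h5]
    ring
  · rw [show ({0, 3} : Finset (Fin 6))ᶜ = {1, 2, 4, 5} by decide, Finset.prod_insert (by decide),
      Finset.prod_insert (by decide), Finset.prod_pair (by decide), h1, h2, h4, h5]
    ring

theorem prod_compl_zero_five :
    ∏ k ∈ ({0, 5} : Finset (Fin 6))ᶜ, divisorClass k =
      (4 : ℚ) • clsH ^ 4 - clsH ^ 3 * clsE := by
  obtain ⟨h0, h1, h2, h3, h4, h5⟩ := divisorClass_eq
  rw [show ({0, 5} : Finset (Fin 6))ᶜ = {1, 2, 3, 4} by decide, Finset.prod_insert (by decide),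
    Finset.prod_insert (by decide), Finset.prod_pair (by decide), h1, h2, h3, h4]
  simp only [MvPolynomial.smul_eq_C_mul, map_ofNat]
  ring

theorem prod_compl_four {i : Fin 6} (hi : i = 1 ∨ i = 2 ∨ i = 3) :
    ∏ k ∈ ({i, 4} : Finset (Fin 6))ᶜ, divisorClass k =
      clsH ^ 3 * clsE - clsH ^ 2 * clsE ^ 2 := by
  obtain ⟨h0, h1, h2, h3, h4, h5⟩ := divisorClass_eq
  rcases hi with rfl | rfl | rfl
  · rw [show ({1, 4} : Finset (Fin 6))ᶜ = {0, 2, 3, 5} by decide, Finset.prod_insert (by decide),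
      Finset.prod_insert (by decide), Finset.prod_pair (by decide), h0, h2, h3, h5]
    ring
  · rw [show ({2, 4} : Finset (Fin 6))ᶜ = {0, 1, 3, 5} by decide, Finset.prod_insert (by decide),
      Finset.prod_insert (by decide), Finset.prod_pair (by decide), h0, h1, h3, h5]
    ring
  · rw [show ({3, 4} : Finset (Fin 6))ᶜ = {0, 1, 2, 5} by decide, Finset.prod_insert (by decide),
      Finset.prod_insert (by decide), Finset.prod_pair (by decide), h0, h1, h2, h5]
    ring

theorem prod_compl_four_five :
    ∏ k ∈ ({4, 5} : Finset (Fin 6))ᶜ, divisorClass k = clsH ^ 4 - clsH ^ 3 * clsE := by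
  obtain ⟨h0, h1, h2, h3, h4, h5⟩ := divisorClass_eq
  rw [show ({4, 5} : Finset (Fin 6))ᶜ = {0, 1, 2, 3} by decide, Finset.prod_insert (by decide),
    Finset.prod_insert (by decide), Finset.prod_pair (by decide), h0, h1, h2, h3]
  ring

theorem isIntersectionForm_intersectionForm : IsIntersectionForm intersectionForm where
  of_degree_ne _ _ hk hP := intersectionForm_of_isHomogeneous hk hP
  of_stanleyReisner S hS P := by
    simp only [stanleyReisner, Finset.mem_insert, Finset.mem_singleton] at hS
    rcases hS with rfl | rfl
    · rw [prod_stanleyReisner_zero_four, intersectionForm_mul_zero_four]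
    · rw [prod_stanleyReisner_one_two_three_five, intersectionForm_mul_one_two_three_five]
  fixedPoint i j hij hS := by
    obtain ⟨v4, v3, v2⟩ := intersectionForm_values
    -- These are the eight torus-fixed points. All have trivial stabiliser except the one with
    -- nonzero `a` and `w`, where it has order `4`.
    have key : ∀ i j : Fin 6, i < j → (∀ S ∈ stanleyReisner, i ∈ S ∨ j ∈ S) →
        (i = 0 ∧ (j = 1 ∨ j = 2 ∨ j = 3)) ∨ (i = 0 ∧ j = 5) ∨
        ((i = 1 ∨ i = 2 ∨ i = 3) ∧ j = 4) ∨ (i = 4 ∧ j = 5) := by decide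
    rcases key i j hij hS with ⟨rfl, hj⟩ | ⟨rfl, rfl⟩ | ⟨hi, rfl⟩ | ⟨rfl, rfl⟩
    · rw [prod_compl_zero hj, map_sub, map_smul, v3, v2]
      rw [show weightX4 0 0 * weightX4 j 1 - weightX4 0 1 * weightX4 j 0 = -1 by
        rcases hj with rfl | rfl | rfl <;> decide]
      norm_num
    · rw [prod_compl_zero_five, map_sub, map_smul, v4, v3,
        show weightX4 0 0 * weightX4 5 1 - weightX4 0 1 * weightX4 5 0 = -1 by decide]
      norm_num
    · rw [prod_compl_four hi, map_sub, v3, v2]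
      rw [show weightX4 i 0 * weightX4 4 1 - weightX4 i 1 * weightX4 4 0 = 1 by
        rcases hi with rfl | rfl | rfl <;> decide]
      norm_num
    · rw [prod_compl_four_five, map_sub, v4, v3,
        show weightX4 4 0 * weightX4 5 1 - weightX4 4 1 * weightX4 5 0 = -4 by decide]
      norm_num

/-- The relation `H³E = 0` and the fixed points `{4, 5}` (order `4`) and `{0, 1}` (order `1`) give
`H⁴` and `H²E²`. Multiplying `4H² - 5HE + E² = 0` by `HE` and by `E²` gives the other two numbers.
-/
theorem IsIntersectionForm.values {deg : MvPolynomial (Fin 2) ℚ →ₗ[ℚ] ℚ}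
    (h : IsIntersectionForm deg) :
    deg (clsH ^ 4) = 1 / 4 ∧ deg (clsH ^ 3 * clsE) = 0 ∧ deg (clsH ^ 2 * clsE ^ 2) = -1 ∧
      deg (clsH * clsE ^ 3) = -5 ∧ deg (clsE ^ 4) = -21 := by
  have e31 : deg (clsH ^ 3 * clsE) = 0 := by
    have := h.of_stanleyReisner {1, 2, 3, 5} (by simp [stanleyReisner]) 1
    rwa [prod_stanleyReisner_one_two_three_five, one_mul] at this
  have e45 := h.fixedPoint 4 5 (by decide) (by decide)
  have e01 := h.fixedPoint 0 1 (by decide) (by decide)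
  have eSR : ∀ P : MvPolynomial (Fin 2) ℚ, deg (P * ((clsH - clsE) * (4 * clsH - clsE))) = 0 := by
    intro P
    have := h.of_stanleyReisner {0, 4} (by simp [stanleyReisner]) P
    rwa [prod_stanleyReisner_zero_four] at this
  have e45 : deg (clsH ^ 4) = 1 / 4 := by
    rw [prod_compl_four_five, map_sub, e31, sub_zero] at e45
    rw [e45, show weightX4 4 0 * weightX4 5 1 - weightX4 4 1 * weightX4 5 0 = -4 by decide]
    norm_num
  have e22 : deg (clsH ^ 2 * clsE ^ 2) = -1 := by
    rw [prod_compl_zero (.inl rfl), map_sub, map_smul, e31, smul_zero, zero_sub] at e01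
    rw [← neg_neg (deg _), e01,
      show weightX4 0 0 * weightX4 1 1 - weightX4 0 1 * weightX4 1 0 = -1 by decide]
    norm_num
  have e13 : deg (clsH * clsE ^ 3) = -5 := by
    have := eSR (clsH * clsE)
    rw [show clsH * clsE * ((clsH - clsE) * (4 * clsH - clsE)) = (4 : ℚ) • (clsH ^ 3 * clsE) -
        (5 : ℚ) • (clsH ^ 2 * clsE ^ 2) + clsH * clsE ^ 3 by
      simp only [MvPolynomial.smul_eq_C_mul, map_ofNat]
      ring, map_add, map_sub, map_smul, map_smul, e31, e22, smul_eq_mul, smul_eq_mul] at this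
    linarith
  have e04 : deg (clsE ^ 4) = -21 := by
    have := eSR (clsE ^ 2)
    rw [show clsE ^ 2 * ((clsH - clsE) * (4 * clsH - clsE)) = (4 : ℚ) • (clsH ^ 2 * clsE ^ 2) -
        (5 : ℚ) • (clsH * clsE ^ 3) + clsE ^ 4 by
      simp only [MvPolynomial.smul_eq_C_mul, map_ofNat]
      ring, map_add, map_sub, map_smul, map_smul, e22, e13, smul_eq_mul, smul_eq_mul] at this
    linarith
  exact ⟨e45, e31, e22, e13, e04⟩

theorem IsIntersectionForm.eq {deg deg' : MvPolynomial (Fin 2) ℚ →ₗ[ℚ] ℚ}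
    (h : IsIntersectionForm deg) (h' : IsIntersectionForm deg') : deg = deg' := by
  obtain ⟨h4, h3, h2, h1, h0⟩ := h.values
  obtain ⟨h4', h3', h2', h1', h0'⟩ := h'.values
  refine linearMap_ext_clsH_clsE fun a b => ?_
  by_cases hab : a + b = 4
  · have ha : a ≤ 4 := by omega
    obtain rfl : b = 4 - a := by omega
    interval_cases a
    · simpa using h0.trans h0'.symm
    · simpa using h1.trans h1'.symm
    · simpa using h2.trans h2'.symm
    · simpa using h3.trans h3'.symm
    · simpa using h4.trans h4'.symm
  · rw [h.of_degree_ne _ _ hab (isHomogeneous_clsH_pow_mul_clsE_pow a b),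
      h'.of_degree_ne _ _ hab (isHomogeneous_clsH_pow_mul_clsE_pow a b)]

theorem IsIntersectionForm.apply_anticanonical {deg : MvPolynomial (Fin 2) ℚ →ₗ[ℚ] ℚ}
    (h : IsIntersectionForm deg) : deg ((4 * clsH - clsE) * clsE * clsH ^ 2) = 1 := by
  obtain ⟨-, h3, h2, -, -⟩ := h.values
  have : (4 * clsH - clsE) * clsE * clsH ^ 2 =
      (4 : ℚ) • (clsH ^ 3 * clsE) - clsH ^ 2 * clsE ^ 2 := by
    simp only [MvPolynomial.smul_eq_C_mul, map_ofNat]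
    ring
  rw [this, map_sub, map_smul, h3, h2]
  norm_num

end IntersectionForm

end ToricBlowUp

end

theorem mainTheorem6 (a₁ : MvPolynomial (Fin 4) ℂ) (ha₁ : a₁.IsHomogeneous 4)
    (hsmooth : IsSmoothCenter a₁) :
    -- `ℙ³` and `B̃₃` are compact complex threefolds
    (CompactSpace P3 ∧ T2Space P3 ∧
      ∃ _ : ChartedSpace (Fin 3 → ℂ) P3, IsQuotientManifold 3 weightP3 coneP3) ∧
    (CompactSpace (BTilde a₁) ∧ T2Space (BTilde a₁) ∧
      ∃ _ : ChartedSpace (Fin 3 → ℂ) (BTilde a₁), IsQuotientManifold 3 weightX4 (coneB a₁)) ∧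
    -- with their complex structures
    (∀ [ChartedSpace (Fin 3 → ℂ) P3] [IsQuotientManifold 3 weightP3 coneP3]
        [ChartedSpace (Fin 3 → ℂ) (BTilde a₁)] [IsQuotientManifold 3 weightX4 (coneB a₁)],
      -- `ℙ³` is spin
      IsSpin 3 P3 ∧
      -- `B̃₃` is the blow-up of `ℙ³`
      IsBlowUp a₁ (blowDown ha₁) ∧
      -- `c₁(B̃₃) = 4 H - E`
      FirstChernClassEq 3 weightX4 (coneB a₁) ![4, 1] ∧
      -- `B̃₃` is not spin
      ¬ IsSpin 3 (BTilde a₁) ∧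
      -- the 2-cycle for a specialised `a₁`
      ∀ ah atl : MvPolynomial (Fin 4) ℂ, ah.IsHomogeneous 3 → atl.IsHomogeneous 3 →
        a₁ = MvPolynomial.X 1 * ah + MvPolynomial.X 2 * atl →
        (∀ z ∈ coneX4, z 1 = 0 → z 2 = 0 → z 5 = 0 → z ∈ coneB a₁) ∧
        ∃ σ : SphereMap (BTilde a₁), σ.Parametrizes 3 (cycleC a₁) ∧
          ∀ m : ℤ, σ.HasC1Integral 3 m ↔ m = 1) ∧
    -- the intersection numbers of `X₄`
    (∃! deg : MvPolynomial (Fin 2) ℚ →ₗ[ℚ] ℚ, IsIntersectionForm deg) ∧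
    ∀ deg : MvPolynomial (Fin 2) ℚ →ₗ[ℚ] ℚ, IsIntersectionForm deg →
      deg (clsH ^ 4) = 1 / 4 ∧ deg (clsH ^ 3 * clsE) = 0 ∧ deg (clsH ^ 2 * clsE ^ 2) = -1 ∧
      deg (clsH * clsE ^ 3) = -5 ∧ deg (clsE ^ 4) = -21 ∧
      deg ((4 * clsH - clsE) * clsE * clsH ^ 2) = 1 := by
  refine ⟨⟨compactSpace_P3, t2Space_P3, sliceAtlasP3.chartedSpace,
      sliceAtlasP3.isQuotientManifold⟩,
    ⟨compactSpace_BTilde ha₁, t2Space_BTilde ha₁, (sliceAtlasB ha₁ hsmooth).chartedSpace,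
      (sliceAtlasB ha₁ hsmooth).isQuotientManifold⟩, ?_,
    ⟨intersectionForm, isIntersectionForm_intersectionForm,
      fun deg h => h.eq isIntersectionForm_intersectionForm⟩, fun deg h => ?_⟩
  · intro _ _ _ _
    exact ⟨isSpin_P3, isBlowUp_blowDown ha₁ hsmooth, firstChernClassEq_BTilde ha₁ hsmooth,
      not_isSpin_BTilde ha₁ hsmooth, fun ah atl _ _ h =>
        ⟨fun z hz h1 h2 h5 => mem_coneB_of_mul_add_mul h hz h1 h2 h5,
          exists_sphere_cycleC ha₁ hsmooth h⟩⟩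
  · obtain ⟨h4, h3, h2, h1, h0⟩ := h.values
    exact ⟨h4, h3, h2, h1, h0, h.apply_anticanonical⟩
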